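/- Let $G$ be a compact Lie group of even dimension with Lie algebra $\mathfrak g$ (the bracket being that of left-invariant vector fields), and let $B$ be a bi-invariant metric, i.e. an $\mathrm{Ad}(G)$-invariant positive definite symmetric bilinear form on $\mathfrak g$, extended $\mathbb C$-bilinearly to $\mathfrak g^{\mathbb C}=\mathfrak g\otimes\mathbb C$. Let $\mathfrak h\subset\mathfrak g^{\mathbb C}$ be a Cartan subalgebra stable under complex conjugation, with root decomposition $\mathfrak g^{\mathbb C}=\mathfrak h\oplus\bigoplus_\alpha\mathfrak g_\alpha$, fix a system of positive roots, and let $I_{\mathfrak h}$ be a complex structure on the real vector space $\mathfrak h^{\mathbb R}=\mathfrak g\cap\mathfrak h$ with $B(I_{\mathfrak h}x,I_{\mathfrak h}y)=B(x,y)$. Let $\mathfrak h=\mathfrak h^{1,0}\oplus\mathfrak h^{0,1}$ be the decomposition into the $\pm\sqrt{-1}$-eigenspaces of $I_{\mathfrak h}$, and put $$\mathfrak g^{1,0}=\mathfrak h^{1,0}\oplus\bigoplus_{\alpha>0}\mathfrak g_\alpha,\qquad \mathfrak g^{0,1}=\mathfrak h^{0,1}\oplus\bigoplus_{\alpha<0}\mathfrak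 g_\alpha .$$ Let $\mathfrak d=\mathfrak g\oplus\overline{\mathfrak g}$ be the direct sum of two copies of the Lie algebra $\mathfrak g$, with the form $B_{\mathfrak d}=B\oplus(-B)$, and define subspaces of $\mathfrak d^{\mathbb C}$ by $$\mathcal L_\phi=\mathfrak g^{1,0}\oplus\mathfrak g^{1,0},\qquad \mathcal L_\psi=\mathfrak g^{1,0}\oplus\mathfrak g^{0,1}.$$ Let $\xi^L,\xi^R$ be the left- and right-invariant vector fields with value $\xi\in\mathfrak g$ at the identity, $\theta^L,\theta^R$ the left and right Maurer–Cartan forms, and $$s:\mathfrak d\to\Gamma(TG\oplus T^*G),\qquad s(\xi,\xi')=(\xi^L-\xi'^R)\oplus\big(B(\theta^L,\xi)+B(\theta^R,\xi')\big).$$ Let $H=\frac16B(\theta^L,[\theta^L,\theta^L])$ be the Cartan $3$-form, i.e. $H(\xi_1^L,\xi_2^L,\xi_3^L)=B([\xi_1,\xi_2],\xi_3)$. On $TG\oplus T^*G$ use the pairing $\langle v+\xi,u+\eta\rangle=\frac12(\xi(u)+\eta(v))$ and the $H$-twisted Courant bracket $$[u+\xi,v+\eta]_H=[u,v]+\mathcal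 L_u\eta-\mathcal L_v\xi-\tfrac12 d(i_u\eta-i_v\xi)-i_vi_uH .$$ Then: (1) Each of $\mathcal L_\phi$ and $\mathcal L_\psi$ is maximal isotropic in $\mathfrak d^{\mathbb C}$ for $B_{\mathfrak d}$, satisfies $\mathfrak d^{\mathbb C}=\mathcal L\oplus\overline{\mathcal L}$, and is closed under the bracket of $\mathfrak d^{\mathbb C}$. (2) There are unique fields $\mathcal J_\phi,\mathcal J_\psi$ of real endomorphisms of $TG\oplus T^*G$ whose $-\sqrt{-1}$-eigenspaces at every $g\in G$ are $s(\mathcal L_\phi)|_g$ and $s(\mathcal L_\psi)|_g$, respectively, and $(\mathcal J_\phi,\mathcal J_\psi)$ is an $H$-twisted generalized Kähler structure on $G$: $H$ is smooth and closed; $\mathcal J_\phi$ and $\mathcal J_\psi$ are smooth sections of $SO(TG\oplus T^*G)$ with square $-\mathrm{id}$ whose $-\sqrt{-1}$-eigenbundles are involutive for $[\,,\,]_H$; they commute; and $\langle -\mathcal J_\phi\mathcal J_\psi\,\cdot\,,\,\cdot\,\rangle$ is a positive definite symmetric form on $TG\oplus T^*G$. -/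

import Mathlib

open scoped Manifold ContDiff TensorProduct
open Bundle

noncomputable section

/-! ### Complexification of real vector spaces -/

section Complexification

variable {V : Type*} [AddCommGroup V] [Module ℝ V]

/-- The element `a + i b` of the complexification `ℂ ⊗ V`. -/
def mkC (a b : V) : ℂ ⊗[ℝ] V := 1 ⊗ₜ[ℝ] a + Complex.I ⊗ₜ[ℝ] b

/-- The real part `ℂ ⊗ V → V`. -/
def reC : ℂ ⊗[ℝ] V →ₗ[ℝ] V :=
  (TensorProduct.lid ℝ V).toLinearMap ∘ₗ Complex.reLm.rTensor V

/-- The imaginary part `ℂ ⊗ V → V`. -/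
def imC : ℂ ⊗[ℝ] V →ₗ[ℝ] V :=
  (TensorProduct.lid ℝ V).toLinearMap ∘ₗ Complex.imLm.rTensor V

theorem mkC_reC_imC (z : ℂ ⊗[ℝ] V) : mkC (reC z) (imC z) = z := by
  induction z using TensorProduct.induction_on with
  | zero => simp [mkC]
  | tmul c v =>
    have h : c = (c.re : ℝ) • (1 : ℂ) + (c.im : ℝ) • Complex.I := by
      apply Complex.ext <;> simp
    have h1 : reC (c ⊗ₜ[ℝ] v) = c.re • v := by simp [reC]
    have h2 : imC (c ⊗ₜ[ℝ] v) = c.im • v := by simp [imC]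
    rw [h1, h2, mkC]
    conv_rhs => rw [h, TensorProduct.add_tmul, TensorProduct.smul_tmul, TensorProduct.smul_tmul]
  | add x y hx hy =>
    have : mkC (reC (x + y)) (imC (x + y)) = mkC (reC x) (imC x) + mkC (reC y) (imC y) := by
      simp only [mkC, map_add, TensorProduct.tmul_add]; abel
    rw [this, hx, hy]

/-- Complex conjugation on `ℂ ⊗ V`, as a conjugate-linear map. -/
def conjC : ℂ ⊗[ℝ] V →ₛₗ[starRingEnd ℂ] ℂ ⊗[ℝ] V where
  toFun := Complex.conjAe.toLinearMap.rTensor V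
  map_add' := map_add _
  map_smul' c z := by
    induction z using TensorProduct.induction_on with
    | zero => simp
    | tmul d v => simp [TensorProduct.smul_tmul']
    | add x y hx hy => simp only [smul_add, map_add, hx, hy]

/-- A subspace is maximal isotropic for a bilinear form. -/
def IsMaximalIsotropic {W : Type*} [AddCommGroup W] [Module ℂ W] (B : LinearMap.BilinForm ℂ W)
    (L : Submodule ℂ W) : Prop :=
  Maximal (fun U : Submodule ℂ W => ∀ x ∈ U, ∀ y ∈ U, B x y = 0) L

end Complexification

/-! ### Generalized complex and generalized Kähler structures -/

section GeneralizedGeometry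

variable {E : Type*} [NormedAddCommGroup E] [NormedSpace ℝ E]
  {M : Type*} [TopologicalSpace M] [ChartedSpace E M]

variable (E) in
/-- The fibre `T_x M ⊕ T_x^* M`. -/
abbrev GenTangent (x : M) : Type _ :=
  TangentSpace 𝓘(ℝ, E) x × (TangentSpace 𝓘(ℝ, E) x →L[ℝ] ℝ)

/-- The pairing `⟨v + ξ, u + η⟩ = (ξ(u) + η(v)) / 2` on `T_x M ⊕ T_x^* M`. -/
def genPairing (x : M) : LinearMap.BilinForm ℝ (GenTangent E x) :=
  LinearMap.mk₂ ℝ (fun e f => (1 / 2 : ℝ) * (e.2 f.1 + f.2 e.1))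
    (fun e e' f => by simp; ring) (fun c e f => by simp; ring)
    (fun e f f' => by simp; ring) (fun c e f => by simp; ring)

variable (E) in
/-- Sections (not necessarily smooth) of `TM ⊕ T^*M`. -/
abbrev GenSection (M : Type*) [TopologicalSpace M] [ChartedSpace E M] : Type _ :=
  ∀ x : M, GenTangent E x

/-- Smoothness of a section of `TM ⊕ T^*M`: both components are smooth. -/
def IsSmoothGenSection [IsManifold 𝓘(ℝ, E) ∞ M] (e : GenSection E M) : Prop :=
  ContMDiff 𝓘(ℝ, E) 𝓘(ℝ, E).tangent ∞ (fun x => (⟨x, (e x).1⟩ : TangentBundle 𝓘(ℝ, E) M)) ∧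
  ContMDiff 𝓘(ℝ, E) (𝓘(ℝ, E).prod 𝓘(ℝ, E →L[ℝ] ℝ)) ∞
    (fun x => TotalSpace.mk' (E →L[ℝ] ℝ)
      (E := fun y : M => TangentSpace 𝓘(ℝ, E) y →L[ℝ] Trivial M ℝ y) x (e x).2)

/-- The Lie derivative `L_u η` of a one-form along a vector field at `x₀`: in the chart at `x₀` it
is `w ↦ (Dη · u)(w) + η(Du · w)`. -/
def lieDerivOneForm (u : ∀ x : M, TangentSpace 𝓘(ℝ, E) x)
    (η : ∀ x : M, TangentSpace 𝓘(ℝ, E) x →L[ℝ] ℝ) (x₀ : M) :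
    TangentSpace 𝓘(ℝ, E) x₀ →L[ℝ] ℝ :=
  let φ := extChartAt 𝓘(ℝ, E) x₀
  let u' : E → E := fun y => VectorField.mpullback 𝓘(ℝ, E) 𝓘(ℝ, E) φ.symm u y
  let η' : E → (E →L[ℝ] ℝ) := fun y =>
    (η (φ.symm y)).comp (mfderiv 𝓘(ℝ, E) 𝓘(ℝ, E) φ.symm y)
  (fderiv ℝ η' (φ x₀) (u' (φ x₀)) + (η' (φ x₀)).comp (fderiv ℝ u' (φ x₀))).comp
    (mfderiv 𝓘(ℝ, E) 𝓘(ℝ, E) φ x₀)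

/-- The differential of a real function, as a one-form. -/
def dFun (f : M → ℝ) (x : M) : TangentSpace 𝓘(ℝ, E) x →L[ℝ] ℝ :=
  mfderiv 𝓘(ℝ, E) 𝓘(ℝ, ℝ) f x

variable (E) in
/-- Three-forms (not necessarily smooth) on `M`. -/
abbrev ThreeForm (M : Type*) [TopologicalSpace M] [ChartedSpace E M] : Type _ :=
  ∀ x : M, TangentSpace 𝓘(ℝ, E) x [⋀^Fin 3]→L[ℝ] ℝ

/-- A three-form written in the chart at `x₀`. -/
def ThreeForm.inChart (H : ThreeForm E M) (x₀ : M) (y : E) : E [⋀^Fin 3]→L[ℝ] ℝ :=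
  (H ((extChartAt 𝓘(ℝ, E) x₀).symm y)).compContinuousLinearMap
    (mfderiv 𝓘(ℝ, E) 𝓘(ℝ, E) (extChartAt 𝓘(ℝ, E) x₀).symm y)

/-- A smooth closed three-form. -/
def ThreeForm.IsSmoothClosed (H : ThreeForm E M) : Prop :=
  ∀ x₀ : M, ContDiffOn ℝ ∞ (H.inChart x₀) (extChartAt 𝓘(ℝ, E) x₀).target ∧
    ∀ y ∈ (extChartAt 𝓘(ℝ, E) x₀).target, extDeriv (H.inChart x₀) y = 0

/-- The one-form `i_v i_u H = H(u, v, ·)`. -/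
def contractTwo (H : ThreeForm E M) (x : M) (u v : TangentSpace 𝓘(ℝ, E) x) :
    TangentSpace 𝓘(ℝ, E) x →L[ℝ] ℝ :=
  (H x).toContinuousMultilinearMap.toContinuousLinearMap ![u, v, 0] 2

/-- The `H`-twisted Courant bracket of sections of `TM ⊕ T^*M`,
`[u + ξ, v + η] = [u, v] + L_u η - L_v ξ - d(i_u η - i_v ξ) / 2 - i_v i_u H`. -/
def courant (H : ThreeForm E M) (e f : GenSection E M) : GenSection E M := fun x =>
  (VectorField.mlieBracket 𝓘(ℝ, E) (fun y => (e y).1) (fun y => (f y).1) x,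
    lieDerivOneForm (fun y => (e y).1) (fun y => (f y).2) x
      - lieDerivOneForm (fun y => (f y).1) (fun y => (e y).2) x
      - (1 / 2 : ℝ) • dFun (fun y => (f y).2 (e y).1 - (e y).2 (f y).1) x
      - contractTwo H x (e x).1 (f x).1)

variable (E) in
/-- Sections (not necessarily smooth) of `(TM ⊕ T^*M)^ℂ`. -/
abbrev GenSectionC (M : Type*) [TopologicalSpace M] [ChartedSpace E M] : Type _ :=
  ∀ x : M, ℂ ⊗[ℝ] GenTangent E x

/-- Smoothness of a complex section: real and imaginary parts are smooth. -/
def IsSmoothGenSectionC [IsManifold 𝓘(ℝ, E) ∞ M] (e : GenSectionC E M) : Prop :=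
  IsSmoothGenSection (fun x => reC (e x)) ∧ IsSmoothGenSection (fun x => imC (e x))

/-- The complex bilinear extension of the `H`-twisted Courant bracket. -/
def courantC (H : ThreeForm E M) (e f : GenSectionC E M) : GenSectionC E M := fun x =>
  mkC
    (courant H (fun y => reC (e y)) (fun y => reC (f y)) x
      - courant H (fun y => imC (e y)) (fun y => imC (f y)) x)
    (courant H (fun y => reC (e y)) (fun y => imC (f y)) x
      + courant H (fun y => imC (e y)) (fun y => reC (f y)) x)

variable (E) in
/-- Fields of endomorphisms (not necessarily smooth) of `TM ⊕ T^*M`. -/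
abbrev GenEndField (M : Type*) [TopologicalSpace M] [ChartedSpace E M] : Type _ :=
  ∀ x : M, Module.End ℝ (GenTangent E x)

/-- The `-i`-eigenspace of `J_x` in `(T_x M ⊕ T_x^* M)^ℂ`. -/
def negIEigenspace (J : GenEndField E M) (x : M) : Submodule ℂ (ℂ ⊗[ℝ] GenTangent E x) :=
  Module.End.eigenspace ((J x).baseChange ℂ) (-Complex.I)

/-- An almost generalized complex structure: a smooth section `J` of `SO(TM ⊕ T^*M)` with
`J ^ 2 = -1`. Smoothness of the endomorphism field `J` means that it preserves smooth sections. -/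
structure IsAlmostGeneralizedComplex [IsManifold 𝓘(ℝ, E) ∞ M] (J : GenEndField E M) : Prop where
  smooth : ∀ e : GenSection E M, IsSmoothGenSection e → IsSmoothGenSection fun x => J x (e x)
  orthogonal : ∀ (x : M) (e f : GenTangent E x),
    genPairing x (J x e) (J x f) = genPairing x e f
  det_eq_one : ∀ x : M, LinearMap.det (J x) = 1
  sq_eq_neg_one : ∀ (x : M) (e : GenTangent E x), J x (J x e) = -e

/-- An `H`-twisted generalized complex structure, for a smooth closed three-form `H`: the
`-i`-eigenbundle is involutive for the `H`-twisted Courant bracket. -/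
structure IsTwistedGeneralizedComplex [IsManifold 𝓘(ℝ, E) ∞ M] (H : ThreeForm E M)
    (J : GenEndField E M) : Prop extends IsAlmostGeneralizedComplex J where
  smooth_closed : H.IsSmoothClosed
  involutive : ∀ e f : GenSectionC E M, IsSmoothGenSectionC e → IsSmoothGenSectionC f →
    (∀ x, e x ∈ negIEigenspace J x) → (∀ x, f x ∈ negIEigenspace J x) →
    ∀ x, courantC H e f x ∈ negIEigenspace J x

/-- An `H`-twisted generalized Kähler structure: commuting `H`-twisted generalized complex
structures `J₁`, `J₂` such that `⟨-J₁ J₂ ·, ·⟩` is symmetric and positive definite. -/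
structure IsTwistedGeneralizedKahler [IsManifold 𝓘(ℝ, E) ∞ M] (H : ThreeForm E M)
    (J₁ J₂ : GenEndField E M) : Prop where
  left : IsTwistedGeneralizedComplex H J₁
  right : IsTwistedGeneralizedComplex H J₂
  comm : ∀ (x : M) (e : GenTangent E x), J₁ x (J₂ x e) = J₂ x (J₁ x e)
  symm : ∀ (x : M) (e f : GenTangent E x),
    genPairing x (-J₁ x (J₂ x e)) f = genPairing x (-J₁ x (J₂ x f)) e
  pos : ∀ (x : M) (e : GenTangent E x), e ≠ 0 → 0 < genPairing x (-J₁ x (J₂ x e)) e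

end GeneralizedGeometry

/-! ### Lie groups -/

section LieGroups

instance lieGroup_minSmoothness_three {E : Type*} [NormedAddCommGroup E] [NormedSpace ℝ E]
    {G : Type*} [TopologicalSpace G] [ChartedSpace E G] [Group G] [LieGroup 𝓘(ℝ, E) ∞ G] :
    LieGroup 𝓘(ℝ, E) (minSmoothness ℝ 3) G :=
  LieGroup.of_le (n := ∞) (by simpa using (inferInstance : ENat.LEInfty 3).out)

variable {E : Type*} [NormedAddCommGroup E] [NormedSpace ℝ E]
  {G : Type*} [TopologicalSpace G] [ChartedSpace E G] [Group G]

instance finiteDimensional_tangentSpace [FiniteDimensional ℝ E] (x : G) :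
    FiniteDimensional ℝ (TangentSpace 𝓘(ℝ, E) x) :=
  inferInstanceAs (FiniteDimensional ℝ E)

instance t2Space_tangentSpace (x : G) : T2Space (TangentSpace 𝓘(ℝ, E) x) :=
  inferInstanceAs (T2Space E)

variable (E G) in
/-- The Lie algebra `𝔤` of `G` (the bracket is that of left-invariant vector fields). -/
abbrev LieAlg : Type _ := GroupLieAlgebra 𝓘(ℝ, E) G

theorem continuous_bilin_comp_bilin {F : Type*} [NormedAddCommGroup F] [NormedSpace ℝ F]
    [FiniteDimensional ℝ F] (B : F →ₗ[ℝ] F →ₗ[ℝ] ℝ) (b : F →ₗ[ℝ] F →ₗ[ℝ] F) :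
    Continuous fun v : Fin 3 → F => B (v 0) (b (v 1) (v 2)) := by
  have hB : Continuous fun p : F × F => B p.1 p.2 :=
    (LinearMap.toContinuousBilinearMap B).continuous₂
  have hb : Continuous fun p : F × F => b p.1 p.2 :=
    (LinearMap.toContinuousBilinearMap b).continuous₂
  exact hB.comp ((continuous_apply (A := fun _ : Fin 3 => F) 0).prodMk
    (hb.comp ((continuous_apply (A := fun _ : Fin 3 => F) 1).prodMk (continuous_apply 2))))

/-- The left Maurer-Cartan form. -/
def thetaL (g : G) : TangentSpace 𝓘(ℝ, E) g →L[ℝ] LieAlg E G :=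
  mfderiv 𝓘(ℝ, E) 𝓘(ℝ, E) (fun h : G => g⁻¹ * h) g

/-- The right Maurer-Cartan form. -/
def thetaR (g : G) : TangentSpace 𝓘(ℝ, E) g →L[ℝ] LieAlg E G :=
  mfderiv 𝓘(ℝ, E) 𝓘(ℝ, E) (fun h : G => h * g⁻¹) g

/-- The value at `g` of the left-invariant vector field `ξ^L`, as a linear function of `ξ`. -/
def leftField (g : G) : LieAlg E G →L[ℝ] TangentSpace 𝓘(ℝ, E) g :=
  mfderiv 𝓘(ℝ, E) 𝓘(ℝ, E) (fun h : G => g * h) 1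

/-- The value at `g` of the right-invariant vector field `ξ^R`, as a linear function of `ξ`. -/
def rightField (g : G) : LieAlg E G →L[ℝ] TangentSpace 𝓘(ℝ, E) g :=
  mfderiv 𝓘(ℝ, E) 𝓘(ℝ, E) (fun h : G => h * g) 1

/-- The adjoint action of `G` on its Lie algebra. -/
def adjointAction (g : G) : LieAlg E G →L[ℝ] LieAlg E G :=
  mfderiv 𝓘(ℝ, E) 𝓘(ℝ, E) (fun h : G => g * h * g⁻¹) 1

/-- `B` is a bi-invariant metric: an `Ad`-invariant positive definite symmetric form on `𝔤`. -/
structure IsBiinvariantMetric (B : LinearMap.BilinForm ℝ (LieAlg E G)) : Prop where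
  symm : ∀ x y, B x y = B y x
  pos : ∀ x, x ≠ 0 → 0 < B x x
  invariant : ∀ (g : G) (x y), B (adjointAction g x) (adjointAction g y) = B x y

variable [FiniteDimensional ℝ E]

/-- The map `𝔡 = 𝔤 ⊕ 𝔤 → T_g G ⊕ T_g^* G`,
`s(ξ, ξ') = (ξ^L - ξ'^R) ⊕ (B(θ^L, ξ) + B(θ^R, ξ'))`. -/
def sMap (B : LinearMap.BilinForm ℝ (LieAlg E G)) (g : G) :
    LieAlg E G × LieAlg E G →ₗ[ℝ] GenTangent E g where
  toFun ζ := (leftField g ζ.1 - rightField g ζ.2,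
    (LinearMap.toContinuousLinearMap (B.flip ζ.1)).comp (thetaL g)
      + (LinearMap.toContinuousLinearMap (B.flip ζ.2)).comp (thetaR g))
  map_add' ζ ζ' := by
    ext v
    · simp; abel
    · simp; abel
  map_smul' c ζ := by
    ext v
    · simp [smul_sub]
    · simp

/-- The form `B_𝔡 = B ⊕ (-B)` on `𝔡 = 𝔤 ⊕ 𝔤`. -/
def doubleForm {V : Type*} [AddCommGroup V] [Module ℝ V] (B : LinearMap.BilinForm ℝ V) :
    LinearMap.BilinForm ℝ (V × V) :=
  B.compl₁₂ (LinearMap.fst ℝ V V) (LinearMap.fst ℝ V V)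
    - B.compl₁₂ (LinearMap.snd ℝ V V) (LinearMap.snd ℝ V V)

variable [CompleteSpace E] [LieGroup 𝓘(ℝ, E) ∞ G]

/-- The bracket of `𝔤`, as a bilinear map. -/
def bracketMap : LieAlg E G →ₗ[ℝ] LieAlg E G →ₗ[ℝ] LieAlg E G :=
  LinearMap.mk₂ ℝ (fun x y => ⁅x, y⁆) add_lie smul_lie lie_add (fun c x y => lie_smul c x y)

/-- The trilinear form `(x, y, z) ↦ B(x, [y, z])` on `𝔤`. -/
def trilinearBracketForm (B : LinearMap.BilinForm ℝ (LieAlg E G)) :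
    ContinuousMultilinearMap ℝ (fun _ : Fin 3 => LieAlg E G) ℝ where
  toFun v := B (v 0) ⁅v 1, v 2⁆
  map_update_add' v i x y := by
    rename_i inst
    obtain rfl := Subsingleton.elim inst (instDecidableEqFin 3)
    fin_cases i <;> simp [Function.update]
  map_update_smul' v i c x := by
    rename_i inst
    obtain rfl := Subsingleton.elim inst (instDecidableEqFin 3)
    fin_cases i <;> simp [Function.update]
  cont := continuous_bilin_comp_bilin (F := E) B bracketMap

/-- The Cartan three-form `H = B(θ^L, [θ^L, θ^L]) / 6` on `G`, where `B(θ^L, [θ^L, θ^L])` is the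
wedge product of `𝔤`-valued forms, i.e. the sum over all permutations of the arguments, with signs,
of `B(θ^L(u), [θ^L(v), θ^L(w)])`. -/
def cartanThreeForm (B : LinearMap.BilinForm ℝ (LieAlg E G)) : ThreeForm E G := fun g =>
  (1 / 6 : ℝ) • (ContinuousMultilinearMap.alternatization
    (trilinearBracketForm B)).compContinuousLinearMap (thetaL g)

end LieGroups

/-! ### Root data -/

section Roots

/-- A positive system: a set `P` of roots of `𝔥` such that exactly one of `α`, `-α` lies in `P` for
every root `α`, and such that every root which is a sum of two elements of `P` lies in `P`. -/
structure IsPositiveSystem {L : Type*} [LieRing L] [LieAlgebra ℂ L] (h : LieSubalgebra ℂ L)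
    [LieRing.IsNilpotent h] (P : Set (h → ℂ)) : Prop where
  isRoot : ∀ α ∈ P, α ≠ 0 ∧ LieAlgebra.rootSpace h α ≠ ⊥
  mem_or_neg_mem : ∀ α : h → ℂ, α ≠ 0 → LieAlgebra.rootSpace h α ≠ ⊥ → α ∈ P ∨ -α ∈ P
  neg_notMem : ∀ α ∈ P, -α ∉ P
  add_mem : ∀ α ∈ P, ∀ β ∈ P, α + β ≠ 0 → LieAlgebra.rootSpace h (α + β) ≠ ⊥ → α + β ∈ P

variable {V : Type*} [LieRing V] [LieAlgebra ℝ V]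

/-- The real part `𝔥^ℝ = 𝔤 ∩ 𝔥` of a subalgebra `𝔥` of `𝔤^ℂ`. -/
def realSubspace (h : LieSubalgebra ℂ (ℂ ⊗[ℝ] V)) : Submodule ℝ V :=
  (h.toSubmodule.restrictScalars ℝ).comap (TensorProduct.mk ℝ ℂ V 1)

/-- `𝔥^{1,0}`: the `i`-eigenspace of the complexification of `I_𝔥`, inside `𝔤^ℂ`. -/
def h10 (h : LieSubalgebra ℂ (ℂ ⊗[ℝ] V)) (J : Module.End ℝ (realSubspace h)) :
    Submodule ℂ (ℂ ⊗[ℝ] V) :=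
  (Module.End.eigenspace (J.baseChange ℂ) Complex.I).map ((realSubspace h).subtype.baseChange ℂ)

/-- `𝔥^{0,1}`: the `-i`-eigenspace of the complexification of `I_𝔥`, inside `𝔤^ℂ`. -/
def h01 (h : LieSubalgebra ℂ (ℂ ⊗[ℝ] V)) (J : Module.End ℝ (realSubspace h)) :
    Submodule ℂ (ℂ ⊗[ℝ] V) :=
  (Module.End.eigenspace (J.baseChange ℂ) (-Complex.I)).map ((realSubspace h).subtype.baseChange ℂ)

/-- `𝔤^{1,0} = 𝔥^{1,0} ⊕ ⨁_{α > 0} 𝔤_α`. -/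
def g10 (h : LieSubalgebra ℂ (ℂ ⊗[ℝ] V)) [LieRing.IsNilpotent h] (P : Set (h → ℂ))
    (J : Module.End ℝ (realSubspace h)) : Submodule ℂ (ℂ ⊗[ℝ] V) :=
  h10 h J ⊔ ⨆ α ∈ P, (LieAlgebra.rootSpace h α).toSubmodule

/-- `𝔤^{0,1} = 𝔥^{0,1} ⊕ ⨁_{α < 0} 𝔤_α`. -/
def g01 (h : LieSubalgebra ℂ (ℂ ⊗[ℝ] V)) [LieRing.IsNilpotent h] (P : Set (h → ℂ))
    (J : Module.End ℝ (realSubspace h)) : Submodule ℂ (ℂ ⊗[ℝ] V) :=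
  h01 h J ⊔ ⨆ α ∈ P, (LieAlgebra.rootSpace h (-α)).toSubmodule

/-- The subspace `A ⊕ A'` of `𝔡^ℂ = ℂ ⊗ (𝔤 ⊕ 𝔤)`, for subspaces `A`, `A'` of `𝔤^ℂ`. -/
def directSumC (A A' : Submodule ℂ (ℂ ⊗[ℝ] V)) : Submodule ℂ (ℂ ⊗[ℝ] (V × V)) :=
  A.comap ((LinearMap.fst ℝ V V).baseChange ℂ) ⊓ A'.comap ((LinearMap.snd ℝ V V).baseChange ℂ)

/-- `L_φ = 𝔤^{1,0} ⊕ 𝔤^{1,0}`. -/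
def Lphi (h : LieSubalgebra ℂ (ℂ ⊗[ℝ] V)) [LieRing.IsNilpotent h] (P : Set (h → ℂ))
    (J : Module.End ℝ (realSubspace h)) : Submodule ℂ (ℂ ⊗[ℝ] (V × V)) :=
  directSumC (g10 h P J) (g10 h P J)

/-- `L_ψ = 𝔤^{1,0} ⊕ 𝔤^{0,1}`. -/
def Lpsi (h : LieSubalgebra ℂ (ℂ ⊗[ℝ] V)) [LieRing.IsNilpotent h] (P : Set (h → ℂ))
    (J : Module.End ℝ (realSubspace h)) : Submodule ℂ (ℂ ⊗[ℝ] (V × V)) :=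
  directSumC (g10 h P J) (g01 h P J)

/-- `L` is maximal isotropic in `𝔡^ℂ` for `B_𝔡`, satisfies `𝔡^ℂ = L ⊕ conj L`, and is closed under
the bracket of `𝔡^ℂ`. -/
structure IsIsotropicSplittingSubalgebra (B : LinearMap.BilinForm ℝ V)
    (L : Submodule ℂ (ℂ ⊗[ℝ] (V × V))) : Prop where
  maximalIsotropic : IsMaximalIsotropic ((doubleForm B).baseChange ℂ) L
  isCompl_conj : IsCompl L (L.map conjC)
  lie_mem : ∀ x ∈ L, ∀ y ∈ L, ⁅x, y⁆ ∈ L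

end Roots

/-- The endomorphism field `J` on `G` is induced by the subspace `L` of `𝔡^ℂ`: its `-i`-eigenspace
at every point `g` is the image of `L` under the complexification of `s` at `g`. -/
def IsInducedBy {E : Type*} [NormedAddCommGroup E] [NormedSpace ℝ E] [FiniteDimensional ℝ E]
    {G : Type*} [TopologicalSpace G] [ChartedSpace E G] [Group G]
    (B : LinearMap.BilinForm ℝ (LieAlg E G)) (L : Submodule ℂ (ℂ ⊗[ℝ] (LieAlg E G × LieAlg E G)))
    (J : GenEndField E G) : Prop :=
  ∀ g : G, negIEigenspace J g = L.map ((sMap B g).baseChange ℂ)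

end

set_option linter.unusedSectionVars false

noncomputable section

/-! ### Complexified vectors a + ib and eigenspaces of real complex structures -/

section ComplexificationLemmas

variable {V W : Type*} [AddCommGroup V] [Module ℝ V] [AddCommGroup W] [Module ℝ W]

/-! The proof reduces everything to real linear algebra. A complex subspace L of V^ℂ with V^ℂ = L ⊕
L̄ is the graph {a + iJa} of a unique real J with J² = -1. If J is an isometry then L is isotropic,
and L is closed under the bracket when [x, Jy] + [Jx, y] = J([x, y] - [Jx, Jy]). So 𝔤^{1,0} and
𝔤^{0,1} are the two eigenspaces of one complex structure I on 𝔤 (`exists_isIntegrableIsometry`),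
while L_φ and L_ψ are the graphs of (-I, -I) and (-I, I) on 𝔡. This gives (1).

The existence of I is root theory. Ad-invariance of B, differentiated, makes ad a skew for real a.
As B is positive definite, ad a is then semisimple with imaginary eigenvalues. Hence root spaces
consist of true eigenvectors, conjugation exchanges 𝔤_α and 𝔤_{-α}, and B pairs 𝔤_α only with
𝔤_{-α}. The axioms of a positive system make 𝔤^{1,0} isotropic and closed; the weight decomposition
shows that 𝔤^{1,0} and 𝔤^{0,1} span, and B(z, z̄) > 0 for z ≠ 0 shows that they meet in zero.

For (2), s is at every g a linear isometry from (𝔡, B_𝔡) onto TG ⊕ T^*G, and the required fields are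
the conjugates by s of the two endomorphisms of 𝔡. The heart is `courant_sE`: for smooth 𝔡-valued
functions a, b, the bracket [s(a), s(b)]_H is s of the bracket of the action algebroid plus the
one-form B_𝔡(da, b) - B_𝔡(a, db). On sections a + iJa this one-form vanishes because L is isotropic,
and the rest stays in s(L) because L is a subalgebra (`courantC_mem_negIEigenspace`). The formula
rests on the Maurer-Cartan equation and on the derivative of Ad_{g⁻¹}, which follows from the
commutation of left- and right-invariant fields. Maurer-Cartan and Jacobi also give dH = 0. Finally
-𝒥_φ𝒥_ψ corresponds to (1, -1) on 𝔡, which turns B ⊕ (-B) into the positive form B ⊕ B. -/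

@[simp] theorem reC_mkC (a b : V) : reC (mkC a b) = a := by simp [reC, mkC]

@[simp] theorem imC_mkC (a b : V) : imC (mkC a b) = b := by simp [imC, mkC]

theorem mkC_inj {a b c d : V} : mkC a b = mkC c d ↔ a = c ∧ b = d := by
  constructor
  · intro h
    exact ⟨by simpa using congrArg reC h, by simpa using congrArg imC h⟩
  · rintro ⟨rfl, rfl⟩; rfl

theorem exists_mkC_eq (z : ℂ ⊗[ℝ] V) : ∃ a b, mkC a b = z := ⟨_, _, mkC_reC_imC z⟩

theorem mkC_add (a b c d : V) : mkC a b + mkC c d = mkC (a + c) (b + d) := by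
  simp only [mkC, TensorProduct.tmul_add]; abel

theorem neg_mkC (a b : V) : -mkC a b = mkC (-a) (-b) := by
  simp only [mkC, TensorProduct.tmul_neg]; abel

theorem mkC_zero : mkC (0 : V) 0 = 0 := by simp [mkC]

theorem mkC_eq_zero {a b : V} : mkC a b = 0 ↔ a = 0 ∧ b = 0 := by
  rw [← mkC_zero, mkC_inj]

theorem I_smul_mkC (a b : V) : Complex.I • mkC a b = mkC (-b) a := by
  simp only [mkC, smul_add, TensorProduct.smul_tmul', smul_eq_mul, mul_one, Complex.I_mul_I,
    TensorProduct.neg_tmul, TensorProduct.tmul_neg]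
  abel

theorem neg_I_smul_mkC (a b : V) : (-Complex.I) • mkC a b = mkC b (-a) := by
  rw [neg_smul, I_smul_mkC, neg_mkC, neg_neg]

theorem mkC_eq_add_I_smul (a b : V) : mkC a b = mkC a 0 + Complex.I • mkC b 0 := by
  rw [I_smul_mkC, mkC_add]; simp

@[simp] theorem conjC_mkC (a b : V) : conjC (mkC a b) = mkC a (-b) := by
  have h (c : ℂ) (v : V) : conjC (c ⊗ₜ[ℝ] v) = (starRingEnd ℂ c) ⊗ₜ[ℝ] v := by
    change Complex.conjAe.toLinearMap.rTensor V (c ⊗ₜ[ℝ] v) = _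
    simp
  simp [mkC, h, TensorProduct.neg_tmul, TensorProduct.tmul_neg]

theorem conjC_smul (c : ℂ) (z : ℂ ⊗[ℝ] V) : conjC (c • z) = starRingEnd ℂ c • conjC z :=
  LinearMap.map_smulₛₗ conjC c z

@[simp] theorem conjC_conjC (z : ℂ ⊗[ℝ] V) : conjC (conjC z) = z := by
  obtain ⟨a, b, rfl⟩ := exists_mkC_eq z
  simp

@[simp] theorem baseChange_mkC (f : V →ₗ[ℝ] W) (a b : V) :
    f.baseChange ℂ (mkC a b) = mkC (f a) (f b) := by
  simp [mkC]

theorem bilinBaseChange_mkC (B : LinearMap.BilinForm ℝ V) (a b c d : V) :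
    B.baseChange ℂ (mkC a b) (mkC c d) =
      ((B a c - B b d : ℝ) : ℂ) + ((B a d + B b c : ℝ) : ℂ) * Complex.I := by
  simp only [mkC, map_add, LinearMap.add_apply, LinearMap.BilinForm.baseChange_tmul]
  simp only [one_mul, mul_one, Complex.I_mul_I, Complex.real_smul]
  push_cast
  ring

theorem lie_mkC {V : Type*} [LieRing V] [LieAlgebra ℝ V] (a b c d : V) :
    ⁅mkC a b, mkC c d⁆ = mkC (⁅a, c⁆ - ⁅b, d⁆) (⁅a, d⁆ + ⁅b, c⁆) := by
  simp only [mkC, add_lie, lie_add, LieAlgebra.ExtendScalars.bracket_tmul, mul_one, one_mul,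
    Complex.I_mul_I, TensorProduct.tmul_sub, TensorProduct.tmul_add, TensorProduct.neg_tmul]
  abel

theorem lieC_add {V : Type*} [LieRing V] [LieAlgebra ℝ V] (x y z : ℂ ⊗[ℝ] V) :
    ⁅x, y + z⁆ = ⁅x, y⁆ + ⁅x, z⁆ := lie_add x y z

theorem lieC_zero {V : Type*} [LieRing V] [LieAlgebra ℝ V] (x : ℂ ⊗[ℝ] V) : ⁅x, (0 : ℂ ⊗[ℝ] V)⁆ = 0 :=
  lie_zero x

theorem zero_lieC {V : Type*} [LieRing V] [LieAlgebra ℝ V] (x : ℂ ⊗[ℝ] V) : ⁅(0 : ℂ ⊗[ℝ] V), x⁆ = 0 :=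
  zero_lie x

theorem smul_lieC {V : Type*} [LieRing V] [LieAlgebra ℝ V] (c : ℂ) (x y : ℂ ⊗[ℝ] V) :
    ⁅c • x, y⁆ = c • ⁅x, y⁆ := smul_lie c x y

theorem lieC_smul {V : Type*} [LieRing V] [LieAlgebra ℝ V] (c : ℂ) (x y : ℂ ⊗[ℝ] V) :
    ⁅x, c • y⁆ = c • ⁅x, y⁆ := lie_smul c x y

theorem conjC_lie {V : Type*} [LieRing V] [LieAlgebra ℝ V] (z w : ℂ ⊗[ℝ] V) :
    conjC ⁅z, w⁆ = ⁅conjC z, conjC w⁆ := by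
  obtain ⟨a, b, rfl⟩ := exists_mkC_eq z
  obtain ⟨c, d, rfl⟩ := exists_mkC_eq w
  simp only [lie_mkC, conjC_mkC, neg_lie, lie_neg, neg_neg]
  rw [mkC_inj]
  constructor
  · rfl
  · abel

theorem baseChange_conjC (f : V →ₗ[ℝ] W) (z : ℂ ⊗[ℝ] V) :
    f.baseChange ℂ (conjC z) = conjC (f.baseChange ℂ z) := by
  obtain ⟨a, b, rfl⟩ := exists_mkC_eq z
  simp

theorem conjC_mem_map {L : Submodule ℂ (ℂ ⊗[ℝ] V)} {z : ℂ ⊗[ℝ] V} :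
    z ∈ L.map conjC ↔ conjC z ∈ L := by
  constructor
  · rintro ⟨w, hw, rfl⟩; simpa using hw
  · intro h; exact ⟨_, h, conjC_conjC z⟩

/-- The `i`-eigenspace of the complexification of a real endomorphism. -/
theorem mem_eigenspace_I_iff (J : Module.End ℝ V) (hJ : ∀ x, J (J x) = -x) (a b : V) :
    mkC a b ∈ Module.End.eigenspace (J.baseChange ℂ) Complex.I ↔ b = -J a := by
  rw [Module.End.mem_eigenspace_iff, baseChange_mkC, I_smul_mkC, mkC_inj]
  constructor
  · rintro ⟨h, -⟩; rw [h, neg_neg]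
  · rintro rfl; simp [hJ]

/-- The `-i`-eigenspace of the complexification of a real endomorphism. -/
theorem mem_eigenspace_neg_I_iff (J : Module.End ℝ V) (hJ : ∀ x, J (J x) = -x) (a b : V) :
    mkC a b ∈ Module.End.eigenspace (J.baseChange ℂ) (-Complex.I) ↔ b = J a := by
  rw [Module.End.mem_eigenspace_iff, baseChange_mkC, neg_I_smul_mkC, mkC_inj]
  constructor
  · rintro ⟨h, -⟩; rw [h]
  · rintro rfl; simp [hJ]

/-- A real endomorphism is determined by its `-i`-eigenspace, if that contains an element with each
prescribed real part. -/
theorem end_eq_of_eigenspace_neg_I_eq {J J' : Module.End ℝ V}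
    (hJ' : ∀ x, J' (J' x) = -x)
    (h : Module.End.eigenspace (J.baseChange ℂ) (-Complex.I) =
      Module.End.eigenspace (J'.baseChange ℂ) (-Complex.I)) : J = J' := by
  ext x
  have := (mem_eigenspace_neg_I_iff J' hJ' x (J' x)).2 rfl
  rw [← h, Module.End.mem_eigenspace_iff, baseChange_mkC, neg_I_smul_mkC, mkC_inj] at this
  exact this.1

end ComplexificationLemmas

/-! ### Skew-adjoint endomorphisms and the Hermitian form B(z, z̄) -/

section SkewHermitian

variable {V : Type*} [AddCommGroup V] [Module ℝ V] {B : LinearMap.BilinForm ℝ V}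

/-- The cross terms cancel by symmetry. For positive definite B this makes (z, w) ↦ B(z, w̄) a
Hermitian inner product, the source of all positivity arguments on 𝔤^ℂ. -/
theorem bilinBaseChange_conjC_self (hs : ∀ x y, B x y = B y x) (a b : V) :
    B.baseChange ℂ (mkC a b) (conjC (mkC a b)) = ((B a a + B b b : ℝ) : ℂ) := by
  rw [conjC_mkC, bilinBaseChange_mkC]
  simp [hs b a]

theorem eq_zero_of_bilinBaseChange_conjC_self (hs : ∀ x y, B x y = B y x)
    (hp : ∀ x, x ≠ 0 → 0 < B x x) {z : ℂ ⊗[ℝ] V}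
    (h : B.baseChange ℂ z (conjC z) = 0) : z = 0 := by
  obtain ⟨a, b, rfl⟩ := exists_mkC_eq z
  rw [bilinBaseChange_conjC_self hs, Complex.ofReal_eq_zero] at h
  have hn (x : V) : 0 ≤ B x x := by
    by_cases hx : x = 0
    · simp [hx]
    · exact (hp x hx).le
  have h0 (x : V) (hx : B x x = 0) : x = 0 := by
    by_contra hne
    exact (hp x hne).ne' hx
  rw [mkC_eq_zero]
  exact ⟨h0 a (by linarith [hn a, hn b]), h0 b (by linarith [hn a, hn b])⟩

variable (T : Module.End ℝ V)

theorem bilinBaseChange_skew (hT : ∀ x y, B (T x) y = -B x (T y)) (z w : ℂ ⊗[ℝ] V) :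
    B.baseChange ℂ (T.baseChange ℂ z) w = -B.baseChange ℂ z (T.baseChange ℂ w) := by
  obtain ⟨a, b, rfl⟩ := exists_mkC_eq z
  obtain ⟨c, d, rfl⟩ := exists_mkC_eq w
  simp only [baseChange_mkC, bilinBaseChange_mkC, hT]
  push_cast
  ring

/-- Eigenvalues of a skew-adjoint real endomorphism are purely imaginary. -/
theorem conj_eq_neg_of_skew (hs : ∀ x y, B x y = B y x)
    (hp : ∀ x, x ≠ 0 → 0 < B x x) (hT : ∀ x y, B (T x) y = -B x (T y)) {μ : ℂ} {u : ℂ ⊗[ℝ] V}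
    (hu : u ≠ 0) (h : T.baseChange ℂ u = μ • u) : starRingEnd ℂ μ = -μ := by
  have h1 := bilinBaseChange_skew T hT u (conjC u)
  rw [baseChange_conjC, h, conjC_smul, map_smul, map_smul, LinearMap.smul_apply, smul_eq_mul,
    smul_eq_mul] at h1
  have h2 : B.baseChange ℂ u (conjC u) ≠ 0 := fun h0 =>
    hu (eq_zero_of_bilinBaseChange_conjC_self hs hp h0)
  have h3 : (μ + starRingEnd ℂ μ) * B.baseChange ℂ u (conjC u) = 0 := by linear_combination h1
  linear_combination (mul_eq_zero.1 h3).resolve_right h2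

/-- The complexification of a skew-adjoint real endomorphism is semisimple. -/
theorem eigenvector_of_pow_eq_zero (hs : ∀ x y, B x y = B y x)
    (hp : ∀ x, x ≠ 0 → 0 < B x x) (hT : ∀ x y, B (T x) y = -B x (T y)) {μ : ℂ} (k : ℕ) :
    ∀ v : ℂ ⊗[ℝ] V, ((T.baseChange ℂ - algebraMap ℂ (Module.End ℂ (ℂ ⊗[ℝ] V)) μ) ^ k) v = 0 →
      T.baseChange ℂ v = μ • v := by
  induction k with
  | zero => intro v hv; simp at hv; simp [hv]
  | succ k ih =>
    intro v hv
    rw [pow_succ, Module.End.mul_apply] at hv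
    have h1 := ih _ hv
    have hN (w : ℂ ⊗[ℝ] V) : (T.baseChange ℂ - algebraMap ℂ (Module.End ℂ (ℂ ⊗[ℝ] V)) μ) w =
      T.baseChange ℂ w - μ • w := by simp [Module.algebraMap_end_apply]
    rw [hN] at h1
    by_contra hne
    have hu : T.baseChange ℂ v - μ • v ≠ 0 := fun h => hne (sub_eq_zero.1 h)
    set u := T.baseChange ℂ v - μ • v with hudef
    -- By induction u = (T - μ)v is an eigenvector, so μ̄ = -μ. Moving T across the form gives B(u,
    -- ū) = -(μ̄ + μ) B(v, ū) = 0, hence u = 0.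
    have hμ := conj_eq_neg_of_skew T hs hp hT hu h1
    apply hu
    apply eq_zero_of_bilinBaseChange_conjC_self hs hp
    conv_lhs => rw [hudef]
    rw [map_sub, LinearMap.sub_apply, bilinBaseChange_skew T hT, ← hudef, baseChange_conjC, h1,
      conjC_smul, hμ]
    simp

end SkewHermitian

/-! ### Root spaces of a conjugation-stable Cartan subalgebra -/

section RootSpaces

variable {V : Type*} [LieRing V] [LieAlgebra ℝ V] {h : LieSubalgebra ℂ (ℂ ⊗[ℝ] V)}

theorem mem_realSubspace {a : V} : a ∈ realSubspace h ↔ mkC a 0 ∈ h := by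
  simp [realSubspace, mkC]

/-- A conjugation-stable subspace is the complexification of its real points: with z it contains (z
+ z̄)/2 and -i(z - z̄)/2. -/
theorem mkC_mem_iff (hconj : ∀ z ∈ h, conjC z ∈ h) {a b : V} :
    mkC a b ∈ h ↔ a ∈ realSubspace h ∧ b ∈ realSubspace h := by
  simp only [mem_realSubspace]
  constructor
  · intro hz
    have hz' := hconj _ hz
    rw [conjC_mkC] at hz'
    have h1 : mkC a 0 = (1 / 2 : ℂ) • (mkC a b + mkC a (-b)) := by
      rw [mkC_add, add_neg_cancel, show mkC (a + a) (0 : V) = (2 : ℂ) • mkC a 0 by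
        rw [two_smul, mkC_add, add_zero], smul_smul]
      norm_num
    have h2 : mkC b 0 = (-Complex.I / 2) • (mkC a b - mkC a (-b)) := by
      rw [sub_eq_add_neg, neg_mkC, neg_neg, mkC_add, add_neg_cancel,
        show mkC (0 : V) (b + b) = (2 * Complex.I) • mkC b 0 by
          rw [mul_smul, I_smul_mkC, two_smul, mkC_add, neg_zero, add_zero], smul_smul,
        show -Complex.I / 2 * (2 * Complex.I) = 1 by
          linear_combination -Complex.I_mul_I, one_smul]
    exact ⟨h1 ▸ h.smul_mem _ (h.add_mem hz hz'), h2 ▸ h.smul_mem _ (h.sub_mem hz hz')⟩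
  · rintro ⟨ha, hb⟩
    rw [mkC_eq_add_I_smul]
    exact h.add_mem ha (h.smul_mem _ hb)

variable {B : LinearMap.BilinForm ℝ V}

theorem bilinBaseChange_lie
    (hinv : ∀ x y z : V, B ⁅x, y⁆ z = -B y ⁅x, z⁆)
    (x y z : ℂ ⊗[ℝ] V) :
    B.baseChange ℂ ⁅x, y⁆ z = -B.baseChange ℂ y ⁅x, z⁆ := by
  obtain ⟨a, b, rfl⟩ := exists_mkC_eq x
  obtain ⟨c, d, rfl⟩ := exists_mkC_eq y
  obtain ⟨e, f, rfl⟩ := exists_mkC_eq z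
  simp only [lie_mkC, bilinBaseChange_mkC, map_add, map_sub, LinearMap.add_apply,
    LinearMap.sub_apply, hinv]
  push_cast
  ring

/-- For real a, this makes the results on complexified skew endomorphisms available for the adjoint
action on 𝔤^ℂ. -/
theorem lie_mkC_zero_eq_baseChange (a : V) (v : ℂ ⊗[ℝ] V) :
    ⁅mkC a 0, v⁆ = (LieAlgebra.ad ℝ V a).baseChange ℂ v := by
  obtain ⟨c, d, rfl⟩ := exists_mkC_eq v
  simp [lie_mkC]

variable [LieRing.IsNilpotent h] {α β : h → ℂ} {v w : ℂ ⊗[ℝ] V}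

/-- Root spaces are defined as generalized weight spaces, so only a power of ad a - α(a) is known to
kill v; semisimplicity of the skew map ad a reduces the exponent to one. -/
theorem lie_eq_of_mem_rootSpace_of_real
    (hs : ∀ x y, B x y = B y x) (hp : ∀ x, x ≠ 0 → 0 < B x x)
    (hinv : ∀ x y z : V, B ⁅x, y⁆ z = -B y ⁅x, z⁆)
    (hv : v ∈ LieAlgebra.rootSpace h α) (a : V)
    (ha : mkC a 0 ∈ h) : ⁅mkC a 0, v⁆ = α ⟨mkC a 0, ha⟩ • v := by
  obtain ⟨k, hk⟩ := (LieModule.mem_genWeightSpace _ _ _).1 hv ⟨mkC a 0, ha⟩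
  rw [lie_mkC_zero_eq_baseChange]
  refine eigenvector_of_pow_eq_zero _ hs hp (fun x y => hinv a x y) k v ?_
  have hT : (LieAlgebra.ad ℝ V a).baseChange ℂ =
      LieModule.toEnd ℂ h (ℂ ⊗[ℝ] V) ⟨mkC a 0, ha⟩ :=
    LinearMap.ext fun z => (lie_mkC_zero_eq_baseChange a z).symm
  rw [hT, Algebra.algebraMap_eq_smul_one]
  exact hk

/-- Root vectors are eigenvectors, not just generalized ones. -/
theorem lie_eq_of_mem_rootSpace
    (hs : ∀ x y, B x y = B y x) (hp : ∀ x, x ≠ 0 → 0 < B x x)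
    (hinv : ∀ x y z : V, B ⁅x, y⁆ z = -B y ⁅x, z⁆)
    (hv : v ∈ LieAlgebra.rootSpace h α) (hv0 : v ≠ 0) (a b : V) (hab : mkC a b ∈ h)
    (ha : mkC a 0 ∈ h) (hb : mkC b 0 ∈ h) :
    ⁅mkC a b, v⁆ = α ⟨mkC a b, hab⟩ • v ∧
      α ⟨mkC a b, hab⟩ = α ⟨mkC a 0, ha⟩ + Complex.I * α ⟨mkC b 0, hb⟩ := by
  have h1 : ⁅mkC a b, v⁆ = (α ⟨mkC a 0, ha⟩ + Complex.I * α ⟨mkC b 0, hb⟩) • v := by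
    rw [mkC_eq_add_I_smul, add_lie, smul_lieC, lie_eq_of_mem_rootSpace_of_real hs hp hinv hv a ha,
      lie_eq_of_mem_rootSpace_of_real hs hp hinv hv b hb, add_smul, smul_smul]
  obtain ⟨k, hk⟩ := (LieModule.mem_genWeightSpace _ _ _).1 hv ⟨mkC a b, hab⟩
  -- Here α is only a function on 𝔥, so its value at a + ib has to be found. The vector v is an
  -- eigenvector of ad(a + ib) for α(a) + iα(b), while a power of ad(a + ib) - α(a + ib) kills v ≠
  -- 0; so the two numbers agree.
  have h2 : α ⟨mkC a b, hab⟩ = α ⟨mkC a 0, ha⟩ + Complex.I * α ⟨mkC b 0, hb⟩ := by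
    set T := LieModule.toEnd ℂ h (ℂ ⊗[ℝ] V) ⟨mkC a b, hab⟩ - α ⟨mkC a b, hab⟩ • 1 with hT
    set c := α ⟨mkC a 0, ha⟩ + Complex.I * α ⟨mkC b 0, hb⟩ with hc
    have hTv : T v = (c - α ⟨mkC a b, hab⟩) • v := by
      rw [hT, LinearMap.sub_apply, sub_smul, ← h1]
      rfl
    have hpow (m : ℕ) : (T ^ m) v = (c - α ⟨mkC a b, hab⟩) ^ m • v := by
      induction m with
      | zero => simp
      | succ m ih => rw [pow_succ, Module.End.mul_apply, hTv, map_smul, ih, smul_smul, pow_succ']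
    rw [hpow] at hk
    have := (smul_eq_zero.1 hk).resolve_right hv0
    exact (sub_eq_zero.1 (eq_zero_of_pow_eq_zero this)).symm
  exact ⟨h2 ▸ h1, h2⟩

theorem lie_eq_smul_of_mem_rootSpace
    (hs : ∀ x y, B x y = B y x) (hp : ∀ x, x ≠ 0 → 0 < B x x)
    (hinv : ∀ x y z : V, B ⁅x, y⁆ z = -B y ⁅x, z⁆)
    (hconj : ∀ z ∈ h, conjC z ∈ h)
    (hv : v ∈ LieAlgebra.rootSpace h α) (x : h) : ⁅(x : ℂ ⊗[ℝ] V), v⁆ = α x • v := by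
  obtain ⟨x, hx⟩ := x
  by_cases hv0 : v = 0
  · rw [hv0, lieC_zero, smul_zero]
  obtain ⟨a, b, rfl⟩ := exists_mkC_eq x
  have hab := (mkC_mem_iff hconj).1 hx
  exact (lie_eq_of_mem_rootSpace hs hp hinv hv hv0 a b hx (mem_realSubspace.1 hab.1)
    (mem_realSubspace.1 hab.2)).1

/-- Conjugation maps `𝔤_α` to `𝔤_{-α}`. -/
theorem conjC_mem_rootSpace_neg
    (hs : ∀ x y, B x y = B y x) (hp : ∀ x, x ≠ 0 → 0 < B x x)
    (hinv : ∀ x y z : V, B ⁅x, y⁆ z = -B y ⁅x, z⁆)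
    (hconj : ∀ z ∈ h, conjC z ∈ h)
    (hv : v ∈ LieAlgebra.rootSpace h α) : conjC v ∈ LieAlgebra.rootSpace h (-α) := by
  by_cases hv0 : v = 0
  · simp [hv0]
  apply LieModule.weightSpace_le_genWeightSpace
  rw [LieModule.mem_weightSpace]
  rintro ⟨x, hx⟩
  obtain ⟨a, b, rfl⟩ := exists_mkC_eq x
  have hab := (mkC_mem_iff hconj).1 hx
  have ha := mem_realSubspace.1 hab.1
  have hb := mem_realSubspace.1 hab.2
  -- On real points α is purely imaginary, so conjugating the eigenvalue equation replaces α by -α.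
  have him (a : V) (ha : mkC a 0 ∈ h) : starRingEnd ℂ (α ⟨mkC a 0, ha⟩) = -α ⟨mkC a 0, ha⟩ := by
    apply conj_eq_neg_of_skew (LieAlgebra.ad ℝ V a) hs hp (fun x y => hinv a x y) hv0
    rw [← lie_mkC_zero_eq_baseChange, lie_eq_of_mem_rootSpace_of_real hs hp hinv hv a ha]
  have key (a : V) (ha : mkC a 0 ∈ h) : ⁅mkC a 0, conjC v⁆ = (-α ⟨mkC a 0, ha⟩) • conjC v := by
    rw [← him a ha, ← conjC_smul, ← lie_eq_of_mem_rootSpace_of_real hs hp hinv hv a ha, conjC_lie,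
      conjC_mkC, neg_zero]
  change ⁅mkC a b, conjC v⁆ = (-α ⟨mkC a b, hx⟩) • conjC v
  rw [(lie_eq_of_mem_rootSpace hs hp hinv hv hv0 a b hx ha hb).2, mkC_eq_add_I_smul a b,
    add_lie, smul_lieC, key a ha, key b hb, smul_smul, ← add_smul]
  congr 1
  ring

/-- Invariance of B under ad x gives (α(x) + β(x)) B(v, w) = 0 for every x in 𝔥. -/
theorem bilinBaseChange_rootSpace
    (hs : ∀ x y, B x y = B y x) (hp : ∀ x, x ≠ 0 → 0 < B x x)
    (hinv : ∀ x y z : V, B ⁅x, y⁆ z = -B y ⁅x, z⁆)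
    (hconj : ∀ z ∈ h, conjC z ∈ h)
    (hv : v ∈ LieAlgebra.rootSpace h α) (hw : w ∈ LieAlgebra.rootSpace h β) (hαβ : α + β ≠ 0) :
    B.baseChange ℂ v w = 0 := by
  obtain ⟨x, hx⟩ := Function.ne_iff.1 hαβ
  have h1 := bilinBaseChange_lie hinv (x : ℂ ⊗[ℝ] V) v w
  rw [lie_eq_smul_of_mem_rootSpace hs hp hinv hconj hv,
    lie_eq_smul_of_mem_rootSpace hs hp hinv hconj hw, map_smul, map_smul, LinearMap.smul_apply,
    smul_eq_mul, smul_eq_mul] at h1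
  have h2 : (α x + β x) * B.baseChange ℂ v w = 0 := by linear_combination h1
  exact (mul_eq_zero.1 h2).resolve_left (by simpa using hx)

end RootSpaces

/-! ### The subspaces 𝔤^{1,0} and 𝔤^{0,1} -/

section SamelsonStructure

variable {V : Type*} [LieRing V] [LieAlgebra ℝ V] {h : LieSubalgebra ℂ (ℂ ⊗[ℝ] V)}
  {B : LinearMap.BilinForm ℝ V} {P : Set (h → ℂ)} {Ih : Module.End ℝ (realSubspace h)}

theorem mem_h10_iff
    (hI : ∀ x, Ih (Ih x) = -x)
    {z : ℂ ⊗[ℝ] V} :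
    z ∈ h10 h Ih ↔ ∃ a : realSubspace h, z = mkC (a : V) (-Ih a : realSubspace h) := by
  constructor
  · rintro ⟨w, hw, rfl⟩
    obtain ⟨a, b, rfl⟩ := exists_mkC_eq w
    have := (mem_eigenspace_I_iff Ih hI a b).1 hw
    exact ⟨a, by rw [baseChange_mkC, this]; rfl⟩
  · rintro ⟨a, rfl⟩
    exact ⟨mkC a (-Ih a), (mem_eigenspace_I_iff Ih hI _ _).2 rfl, by rw [baseChange_mkC]; rfl⟩

theorem mem_h01_iff
    (hI : ∀ x, Ih (Ih x) = -x)
    {z : ℂ ⊗[ℝ] V} :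
    z ∈ h01 h Ih ↔ ∃ a : realSubspace h, z = mkC (a : V) (Ih a : realSubspace h) := by
  constructor
  · rintro ⟨w, hw, rfl⟩
    obtain ⟨a, b, rfl⟩ := exists_mkC_eq w
    have := (mem_eigenspace_neg_I_iff Ih hI a b).1 hw
    exact ⟨a, by rw [baseChange_mkC, this]; rfl⟩
  · rintro ⟨a, rfl⟩
    exact ⟨mkC a (Ih a), (mem_eigenspace_neg_I_iff Ih hI _ _).2 rfl, by rw [baseChange_mkC]; rfl⟩

theorem le_h10_sup_h01
    (hI : ∀ x, Ih (Ih x) = -x)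
    (hconj : ∀ z ∈ h, conjC z ∈ h) : h.toSubmodule ≤ h10 h Ih ⊔ h01 h Ih := by
  intro z hz
  obtain ⟨a, b, rfl⟩ := exists_mkC_eq z
  obtain ⟨ha, hb⟩ := (mkC_mem_iff hconj).1 hz
  lift a to realSubspace h using ha
  lift b to realSubspace h using hb
  rw [Submodule.mem_sup]
  -- Solving a + ib = (p - iIp) + (q + iIq) gives p = (a + Ib)/2 and q = (a - Ib)/2.
  refine ⟨_, (mem_h10_iff hI).2 ⟨(1 / 2 : ℝ) • (a + Ih b), rfl⟩, _,
    (mem_h01_iff hI).2 ⟨(1 / 2 : ℝ) • (a - Ih b), rfl⟩, ?_⟩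
  rw [mkC_add, mkC_inj, ← Submodule.coe_add, ← Submodule.coe_add, Subtype.coe_inj, Subtype.coe_inj]
  simp only [map_smul, map_add, map_sub, hI]
  constructor <;> module

theorem conjC_mem_h01
    (hI : ∀ x, Ih (Ih x) = -x)
    {z : ℂ ⊗[ℝ] V} (hz : z ∈ h10 h Ih) : conjC z ∈ h01 h Ih := by
  obtain ⟨a, rfl⟩ := (mem_h10_iff hI).1 hz
  rw [mem_h01_iff hI]
  exact ⟨a, by simp⟩

theorem conjC_mem_h10
    (hI : ∀ x, Ih (Ih x) = -x)
    {z : ℂ ⊗[ℝ] V} (hz : z ∈ h01 h Ih) : conjC z ∈ h10 h Ih := by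
  obtain ⟨a, rfl⟩ := (mem_h01_iff hI).1 hz
  rw [mem_h10_iff hI]
  exact ⟨a, by simp⟩

theorem h10_le
    (hI : ∀ x, Ih (Ih x) = -x)
    (hconj : ∀ z ∈ h, conjC z ∈ h) : h10 h Ih ≤ h.toSubmodule := by
  intro z hz
  obtain ⟨a, rfl⟩ := (mem_h10_iff hI).1 hz
  exact (mkC_mem_iff hconj).2 ⟨a.2, (-Ih a).2⟩

theorem h10_isotropic
    (hI : ∀ x, Ih (Ih x) = -x)
    (hIB : ∀ x y : realSubspace h, B (Ih x) (Ih y) = B x y)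
    {z w : ℂ ⊗[ℝ] V} (hz : z ∈ h10 h Ih) (hw : w ∈ h10 h Ih) : B.baseChange ℂ z w = 0 := by
  obtain ⟨a, rfl⟩ := (mem_h10_iff hI).1 hz
  obtain ⟨b, rfl⟩ := (mem_h10_iff hI).1 hw
  -- The real part of B(a - iIa, b - iIb) vanishes as I is an isometry; the imaginary part needs
  -- B(Ia, b) = -B(a, Ib), which is the isometry property at (a, Ib) with I² = -1.
  have h1 := hIB a (Ih b)
  rw [hI] at h1
  rw [bilinBaseChange_mkC]
  simp only [Submodule.coe_neg, map_neg, LinearMap.neg_apply, neg_neg, hIB] at h1 ⊢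
  rw [← h1]
  simp

variable [h.IsCartanSubalgebra]

/-- A single generating set allows isotropy, closure and conjugation to be checked by span induction
on generators. -/
theorem g10_eq_span : g10 h P Ih =
    Submodule.span ℂ {z | z ∈ h10 h Ih ∨ ∃ α ∈ P, z ∈ LieAlgebra.rootSpace h α} := by
  apply le_antisymm
  · refine sup_le (fun z hz => Submodule.subset_span (Or.inl hz)) (iSup₂_le fun α hα z hz =>
      Submodule.subset_span (Or.inr ⟨α, hα, hz⟩))
  · rw [Submodule.span_le]
    rintro z (hz | ⟨α, hα, hz⟩)
    · exact Submodule.mem_sup_left hz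
    · exact Submodule.mem_sup_right (Submodule.mem_iSup_of_mem α (Submodule.mem_iSup_of_mem hα hz))

theorem g01_eq_span : g01 h P Ih =
    Submodule.span ℂ {z | z ∈ h01 h Ih ∨ ∃ α ∈ P, z ∈ LieAlgebra.rootSpace h (-α)} := by
  apply le_antisymm
  · refine sup_le (fun z hz => Submodule.subset_span (Or.inl hz)) (iSup₂_le fun α hα z hz =>
      Submodule.subset_span (Or.inr ⟨α, hα, hz⟩))
  · rw [Submodule.span_le]
    rintro z (hz | ⟨α, hα, hz⟩)
    · exact Submodule.mem_sup_left hz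
    · exact Submodule.mem_sup_right (Submodule.mem_iSup_of_mem α (Submodule.mem_iSup_of_mem hα hz))

theorem conjC_mem_g01
    (hs : ∀ x y, B x y = B y x) (hp : ∀ x, x ≠ 0 → 0 < B x x)
    (hinv : ∀ x y z : V, B ⁅x, y⁆ z = -B y ⁅x, z⁆) (hI : ∀ x, Ih (Ih x) = -x)
    (hconj : ∀ z ∈ h, conjC z ∈ h) {z : ℂ ⊗[ℝ] V} (hz : z ∈ g10 h P Ih) :
    conjC z ∈ g01 h P Ih := by
  rw [g10_eq_span] at hz
  rw [g01_eq_span]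
  induction hz using Submodule.span_induction with
  | mem z hz =>
    apply Submodule.subset_span
    rcases hz with hz | ⟨α, hα, hz⟩
    · exact Or.inl (conjC_mem_h01 hI hz)
    · exact Or.inr ⟨α, hα, conjC_mem_rootSpace_neg hs hp hinv hconj hz⟩
  | zero => simp
  | add x y _ _ hx hy => rw [map_add]; exact Submodule.add_mem _ hx hy
  | smul c x _ hx => rw [conjC_smul]; exact Submodule.smul_mem _ _ hx

theorem conjC_mem_g10
    (hs : ∀ x y, B x y = B y x) (hp : ∀ x, x ≠ 0 → 0 < B x x)
    (hinv : ∀ x y z : V, B ⁅x, y⁆ z = -B y ⁅x, z⁆) (hI : ∀ x, Ih (Ih x) = -x)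
    (hconj : ∀ z ∈ h, conjC z ∈ h) {z : ℂ ⊗[ℝ] V} (hz : z ∈ g01 h P Ih) :
    conjC z ∈ g10 h P Ih := by
  rw [g01_eq_span] at hz
  rw [g10_eq_span]
  induction hz using Submodule.span_induction with
  | mem z hz =>
    apply Submodule.subset_span
    rcases hz with hz | ⟨α, hα, hz⟩
    · exact Or.inl (conjC_mem_h10 hI hz)
    · exact Or.inr ⟨α, hα, by simpa using conjC_mem_rootSpace_neg hs hp hinv hconj hz⟩
  | zero => simp
  | add x y _ _ hx hy => rw [map_add]; exact Submodule.add_mem _ hx hy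
  | smul c x _ hx => rw [conjC_smul]; exact Submodule.smul_mem _ _ hx

variable [FiniteDimensional ℝ V]

/-- A Cartan subalgebra is its own zero root space, so generators from 𝔥 can be treated as root
vectors of weight zero. -/
theorem mem_rootSpace_zero {z : ℂ ⊗[ℝ] V} (hz : z ∈ h) :
    z ∈ LieAlgebra.rootSpace h (0 : h → ℂ) := by
  rw [LieAlgebra.rootSpace_zero_eq]
  exact hz

/-- The generalized weight spaces span 𝔤^ℂ. The zero one is 𝔥 = 𝔥^{1,0} + 𝔥^{0,1}, and any nonzero
weight is a root lying in P or in -P. -/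
theorem g10_sup_g01
    (hI : ∀ x, Ih (Ih x) = -x)
    (hconj : ∀ z ∈ h, conjC z ∈ h) (hP : IsPositiveSystem h P) :
    g10 h P Ih ⊔ g01 h P Ih = ⊤ := by
  rw [eq_top_iff]
  have htop := LieModule.iSup_genWeightSpace_eq_top ℂ h (ℂ ⊗[ℝ] V)
  rw [← LieSubmodule.toSubmodule_inj, LieSubmodule.iSup_toSubmodule,
    LieSubmodule.top_toSubmodule] at htop
  rw [← htop]
  refine iSup_le fun α => ?_
  by_cases h0 : α = 0
  · subst h0
    intro z hz
    have hz' : z ∈ LieAlgebra.rootSpace h (0 : h → ℂ) := hz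
    rw [LieAlgebra.rootSpace_zero_eq] at hz'
    exact (sup_le_sup le_sup_left le_sup_left : h10 h Ih ⊔ h01 h Ih ≤ _)
      (le_h10_sup_h01 hI hconj hz')
  by_cases hb : LieAlgebra.rootSpace h α = ⊥
  · change (LieAlgebra.rootSpace h α).toSubmodule ≤ _
    rw [hb]
    simp
  rcases hP.mem_or_neg_mem α h0 hb with hα | hα
  · refine le_trans ?_ le_sup_left
    rw [g10_eq_span]
    exact fun z hz => Submodule.subset_span (Or.inr ⟨α, hα, hz⟩)
  · refine le_trans ?_ le_sup_right
    rw [g01_eq_span]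
    exact fun z hz => Submodule.subset_span (Or.inr ⟨-α, hα, by rw [neg_neg]; exact hz⟩)

/-- Among weights in P ∪ {0}, the only pair with sum zero is (0, 0); that pair is covered by the
isotropy of 𝔥^{1,0}. -/
theorem g10_isotropic
    (hs : ∀ x y, B x y = B y x) (hp : ∀ x, x ≠ 0 → 0 < B x x)
    (hinv : ∀ x y z : V, B ⁅x, y⁆ z = -B y ⁅x, z⁆) (hI : ∀ x, Ih (Ih x) = -x)
    (hconj : ∀ z ∈ h, conjC z ∈ h) (hP : IsPositiveSystem h P)
    (hIB : ∀ x y : realSubspace h, B (Ih x) (Ih y) = B x y)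
    {z w : ℂ ⊗[ℝ] V} (hz : z ∈ g10 h P Ih) (hw : w ∈ g10 h P Ih) : B.baseChange ℂ z w = 0 := by
  rw [g10_eq_span] at hz hw
  induction hz, hw using Submodule.span_induction₂ with
  | mem_mem x y hx hy =>
    rcases hx with hx | ⟨α, hα, hx⟩ <;> rcases hy with hy | ⟨β, hβ, hy⟩
    · exact h10_isotropic hI hIB hx hy
    · exact bilinBaseChange_rootSpace hs hp hinv hconj (mem_rootSpace_zero (h10_le hI hconj hx)) hy
        (by rw [zero_add]; exact (hP.isRoot β hβ).1)
    · exact bilinBaseChange_rootSpace hs hp hinv hconj hx (mem_rootSpace_zero (h10_le hI hconj hy))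
        (by rw [add_zero]; exact (hP.isRoot α hα).1)
    · refine bilinBaseChange_rootSpace hs hp hinv hconj hx hy fun h0 => hP.neg_notMem α hα ?_
      rwa [← eq_neg_of_add_eq_zero_right h0]
  | zero_left y hy => simp
  | zero_right x hx => simp
  | add_left x y z _ _ _ hx hy => rw [map_add, LinearMap.add_apply, hx, hy, add_zero]
  | add_right x y z _ _ _ hx hy => rw [map_add, hx, hy, add_zero]
  | smul_left r x y _ _ hx => rw [map_smul, LinearMap.smul_apply, hx, smul_zero]
  | smul_right r x y _ _ hx => rw [map_smul, hx, smul_zero]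

/-- 𝔥 is abelian and acts on root spaces by scalars, while [𝔤_α, 𝔤_β] ⊂ 𝔤_{α+β} with α + β again in
P whenever this space is nonzero. -/
theorem g10_lie_mem
    (hs : ∀ x y, B x y = B y x) (hp : ∀ x, x ≠ 0 → 0 < B x x)
    (hinv : ∀ x y z : V, B ⁅x, y⁆ z = -B y ⁅x, z⁆) (hI : ∀ x, Ih (Ih x) = -x)
    (hconj : ∀ z ∈ h, conjC z ∈ h) (hP : IsPositiveSystem h P)
    {z w : ℂ ⊗[ℝ] V} (hz : z ∈ g10 h P Ih) (hw : w ∈ g10 h P Ih) : ⁅z, w⁆ ∈ g10 h P Ih := by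
  rw [g10_eq_span] at hz hw
  induction hz, hw using Submodule.span_induction₂ with
  | mem_mem x y hx hy =>
    rw [g10_eq_span]
    rcases hx with hx | ⟨α, hα, hx⟩ <;> rcases hy with hy | ⟨β, hβ, hy⟩
    -- Elements of 𝔥 are true eigenvectors of weight zero, so brackets within 𝔥 vanish.
    · have := lie_eq_smul_of_mem_rootSpace hs hp hinv hconj
        (mem_rootSpace_zero (h10_le hI hconj hy)) ⟨x, h10_le hI hconj hx⟩
      simp only [Pi.zero_apply, zero_smul] at this
      rw [this]
      exact Submodule.zero_mem _
    · have := lie_eq_smul_of_mem_rootSpace hs hp hinv hconj hy ⟨x, h10_le hI hconj hx⟩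
      dsimp only at this
      rw [this]
      exact Submodule.smul_mem _ _ (Submodule.subset_span (Or.inr ⟨β, hβ, hy⟩))
    · have := lie_eq_smul_of_mem_rootSpace hs hp hinv hconj hx ⟨y, h10_le hI hconj hy⟩
      dsimp only at this
      rw [← lie_skew, this]
      exact Submodule.neg_mem _ (Submodule.smul_mem _ _ (Submodule.subset_span (Or.inr ⟨α, hα, hx⟩)))
    · have hm := LieAlgebra.lie_mem_genWeightSpace_of_mem_genWeightSpace hx hy
      by_cases hb : LieAlgebra.rootSpace h (α + β) = ⊥
      · have : ⁅x, y⁆ = 0 := by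
          rw [← LieSubmodule.mem_bot (R := ℂ) (L := h), ← hb]
          exact hm
        rw [this]
        exact Submodule.zero_mem _
      · refine Submodule.subset_span (Or.inr ⟨α + β, hP.add_mem α hα β hβ (fun h0 => ?_) hb, hm⟩)
        exact hP.neg_notMem α hα (by rwa [← eq_neg_of_add_eq_zero_right h0])
  | zero_left y hy => rw [zero_lieC]; exact Submodule.zero_mem _
  | zero_right x hx => rw [lieC_zero]; exact Submodule.zero_mem _
  | add_left x y z _ _ _ hx hy => rw [add_lie]; exact Submodule.add_mem _ hx hy
  | add_right x y z _ _ _ hx hy => rw [lieC_add]; exact Submodule.add_mem _ hx hy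
  | smul_left r x y _ _ hx => rw [smul_lieC]; exact Submodule.smul_mem _ _ hx
  | smul_right r x y _ _ hx => rw [lieC_smul]; exact Submodule.smul_mem _ _ hx

end SamelsonStructure

/-! ### Real complex structures as splittings V^ℂ = L ⊕ L̄ -/

section ComplexStructures

variable {V : Type*} [AddCommGroup V] [Module ℝ V]

/-- A complex subspace complementary to its conjugate is the `-i`-eigenspace of a real complex
structure. -/
theorem exists_complexStructure_of_isCompl {L : Submodule ℂ (ℂ ⊗[ℝ] V)}
    (hL : IsCompl L (L.map conjC)) :
    ∃ J : Module.End ℝ V, (∀ x, J (J x) = -x) ∧ ∀ a b, mkC a b ∈ L ↔ b = J a := by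
  -- If a = z + w with z in L and w in L̄, then z + w̄ lies in L and has the same real part a.
  have hex (a : V) : ∃ b, mkC a b ∈ L := by
    obtain ⟨z, hz, w, hw, hzw⟩ := Submodule.mem_sup.1
      (hL.codisjoint.eq_top ▸ Submodule.mem_top : mkC a 0 ∈ L ⊔ L.map conjC)
    rw [conjC_mem_map] at hw
    refine ⟨imC (z + conjC w), ?_⟩
    have hre : reC (z + conjC w) = a := by
      obtain ⟨p, q, rfl⟩ := exists_mkC_eq z
      obtain ⟨r, s, rfl⟩ := exists_mkC_eq w
      rw [mkC_add, mkC_inj] at hzw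
      rw [conjC_mkC, mkC_add, reC_mkC, hzw.1]
    have := L.add_mem hz hw
    rw [← mkC_reC_imC (z + conjC w), hre] at this
    exact this
  -- If ib lies in L, so does the real vector b, which then lies in L ∩ L̄ = 0.
  have huniq (b : V) (hb : mkC 0 b ∈ L) : b = 0 := by
    have h1 : mkC b 0 ∈ L := by
      have := L.smul_mem (-Complex.I) hb
      rwa [neg_I_smul_mkC, neg_zero] at this
    have h2 : mkC b 0 ∈ L.map conjC := by
      rw [conjC_mem_map, conjC_mkC, neg_zero]; exact h1
    have := Submodule.disjoint_def.1 hL.disjoint _ h1 h2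
    exact (mkC_eq_zero.1 this).1
  choose f hf using hex
  have heq {a b : V} (h : mkC a b ∈ L) : b = f a := by
    have := L.sub_mem h (hf a)
    rw [sub_eq_add_neg, neg_mkC, mkC_add, add_neg_cancel] at this
    rw [← sub_eq_zero, sub_eq_add_neg]
    exact huniq _ this
  refine ⟨{ toFun := f, map_add' := fun x y => ?_, map_smul' := fun c x => ?_ }, fun x => ?_,
    fun a b => ⟨heq, fun h => h ▸ hf a⟩⟩
  · refine (heq ?_).symm
    rw [← mkC_add]
    exact L.add_mem (hf x) (hf y)
  · refine (heq ?_).symm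
    have h1 : mkC (c • x) (c • f x) = (c : ℂ) • mkC x (f x) := by
      simp only [mkC, smul_add, TensorProduct.smul_tmul', TensorProduct.tmul_smul, smul_eq_mul,
        Complex.real_smul]
    rw [RingHom.id_apply, h1]
    exact L.smul_mem _ (hf x)
  · refine (heq ?_).symm
    have := L.smul_mem (-Complex.I) (hf x)
    rwa [neg_I_smul_mkC] at this

theorem isCompl_eigenspace_neg_I {J : Module.End ℝ V} (hJ : ∀ x, J (J x) = -x)
    {L : Submodule ℂ (ℂ ⊗[ℝ] V)} (hL : ∀ a b, mkC a b ∈ L ↔ b = J a) :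
    IsCompl L (L.map conjC) := by
  constructor
  · rw [Submodule.disjoint_def]
    intro z hz hz'
    obtain ⟨a, b, rfl⟩ := exists_mkC_eq z
    rw [conjC_mem_map, conjC_mkC, hL] at hz'
    rw [hL] at hz
    have hb : b = 0 := by
      have h2 : (2 : ℝ) • b = 0 := by
        rw [two_smul, ← sub_neg_eq_add, hz', ← hz, sub_self]
      exact (smul_eq_zero.1 h2).resolve_left two_ne_zero
    have ha : a = 0 := by rw [← neg_eq_zero, ← hJ, ← hz, hb, map_zero]
    rw [ha, hb, mkC_zero]
  · rw [codisjoint_iff, eq_top_iff]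
    intro z _
    obtain ⟨a, b, rfl⟩ := exists_mkC_eq z
    rw [Submodule.mem_sup]
    -- Solving a + ib = (p + iJp) + (q - iJq) gives p = (a - Jb)/2 and q = (a + Jb)/2.
    refine ⟨mkC ((1 / 2 : ℝ) • (a - J b)) (J ((1 / 2 : ℝ) • (a - J b))), (hL _ _).2 rfl,
      mkC ((1 / 2 : ℝ) • (a + J b)) (-J ((1 / 2 : ℝ) • (a + J b))), ?_, ?_⟩
    · rw [conjC_mem_map, conjC_mkC, hL, neg_neg]
    · rw [mkC_add, mkC_inj]
      simp only [map_smul, map_add, map_sub, hJ]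
      constructor <;> module

end ComplexStructures

/-! ### Integrable isometric complex structures on 𝔤 and on 𝔡 -/

section IntegrableStructures

/-- An isometric integrable complex structure on a real Lie algebra with a bilinear form. -/
structure IsIntegrableIsometry {D : Type*} [LieRing D] [LieAlgebra ℝ D]
    (Q : LinearMap.BilinForm ℝ D) (J : Module.End ℝ D) : Prop where
  sq : ∀ x, J (J x) = -x
  isometry : ∀ x y, Q (J x) (J y) = Q x y
  integrable : ∀ x y : D, ⁅x, J y⁆ + ⁅J x, y⁆ = J (⁅x, y⁆ - ⁅J x, J y⁆)

namespace IsIntegrableIsometry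

variable {D : Type*} [LieRing D] [LieAlgebra ℝ D] {Q : LinearMap.BilinForm ℝ D}
  {J J' : Module.End ℝ D}

theorem skew (h : IsIntegrableIsometry Q J) (x y : D) : Q (J x) y = -Q x (J y) := by
  rw [← h.isometry x (J y), h.sq, map_neg, neg_neg]

theorem neg (h : IsIntegrableIsometry Q J) : IsIntegrableIsometry Q (-J) where
  sq x := by simp [h.sq]
  isometry x y := by simp [h.isometry]
  integrable x y := by
    simp only [LinearMap.neg_apply, lie_neg, neg_lie, neg_neg, ← h.integrable]
    abel

theorem prodMap (h : IsIntegrableIsometry Q J) (h' : IsIntegrableIsometry Q J') :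
    IsIntegrableIsometry (doubleForm Q) (LinearMap.prodMap J J') where
  sq x := by
    ext
    · exact h.sq x.1
    · exact h'.sq x.2
  isometry x y := by simp [doubleForm, h.isometry, h'.isometry]
  integrable x y := by
    ext
    · exact h.integrable x.1 y.1
    · exact h'.integrable x.2 y.2

end IsIntegrableIsometry

variable {V : Type*} [LieRing V] [LieAlgebra ℝ V]

/-- For maximality, an isotropic U containing L is generated by L and U ∩ L̄. An element of U ∩ L̄
pairs to zero with L, hence vanishes because B_𝔡 is nondegenerate. -/
theorem IsIntegrableIsometry.isIsotropicSplittingSubalgebra {B : LinearMap.BilinForm ℝ V}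
    (hp : ∀ x, x ≠ 0 → 0 < B x x)
    {J : Module.End ℝ (V × V)} (h : IsIntegrableIsometry (doubleForm B) J)
    {L : Submodule ℂ (ℂ ⊗[ℝ] (V × V))} (hL : ∀ a b, mkC a b ∈ L ↔ b = J a) :
    IsIsotropicSplittingSubalgebra B L where
  isCompl_conj := isCompl_eigenspace_neg_I h.sq hL
  lie_mem z hz w hw := by
    obtain ⟨a, b, rfl⟩ := exists_mkC_eq z
    obtain ⟨c, d, rfl⟩ := exists_mkC_eq w
    rw [hL] at hz hw
    rw [lie_mkC, hL, hz, hw, h.integrable]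
  maximalIsotropic := by
    refine ⟨fun z hz w hw => ?_, fun U hU hLU z hz => ?_⟩
    · obtain ⟨a, b, rfl⟩ := exists_mkC_eq z
      obtain ⟨c, d, rfl⟩ := exists_mkC_eq w
      rw [hL] at hz hw
      rw [bilinBaseChange_mkC, hz, hw, h.isometry, h.skew]
      simp
    · obtain ⟨l, hl, m, hm, rfl⟩ := Submodule.mem_sup.1
        ((isCompl_eigenspace_neg_I h.sq hL).codisjoint.eq_top ▸ Submodule.mem_top :
          z ∈ L ⊔ L.map conjC)
      have hmU : m ∈ U := by simpa using U.sub_mem hz (hLU hl)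
      obtain ⟨y, y', rfl⟩ := exists_mkC_eq m
      rw [conjC_mem_map, conjC_mkC, hL] at hm
      -- The real part of the pairing of y - iJy with x + iJx is B_𝔡(y, x) + B_𝔡(Jy, Jx) = 2 B_𝔡(y,
      -- x).
      have key (x : V × V) : doubleForm B y x = 0 := by
        have h1 := hU _ hmU _ (hLU ((hL x (J x)).2 rfl))
        rw [bilinBaseChange_mkC, show y' = -J y by rw [← hm, neg_neg]] at h1
        have h2 := congrArg Complex.re h1
        simp [h.isometry] at h2
        exact h2
      have hy : y = 0 := by
        -- The sign change in the second factor turns B ⊕ (-B) into the positive form B ⊕ B.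
        have h1 := key (y.1, -y.2)
        have hn (x : V) : 0 ≤ B x x := by
          by_cases hx : x = 0
          · simp [hx]
          · exact (hp x hx).le
        have h0 (x : V) (hx : B x x = 0) : x = 0 := by
          by_contra hne
          exact (hp x hne).ne' hx
        simp only [doubleForm, LinearMap.sub_apply, LinearMap.compl₁₂_apply, LinearMap.fst_apply,
          LinearMap.snd_apply, map_neg, sub_neg_eq_add] at h1
        exact Prod.ext (h0 _ (by linarith [hn y.1, hn y.2])) (h0 _ (by linarith [hn y.1, hn y.2]))
      have hy' : y' = 0 := by rw [← neg_eq_zero, hm, hy, map_zero]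
      rw [hy, hy', mkC_zero, add_zero]
      exact hl

theorem mkC_mem_directSumC {A A' : Submodule ℂ (ℂ ⊗[ℝ] V)} {a b : V × V} :
    mkC a b ∈ directSumC A A' ↔ mkC a.1 b.1 ∈ A ∧ mkC a.2 b.2 ∈ A' := by
  simp [directSumC]

/-- The complex structure on `𝔤` with `i`-eigenspace `𝔤^{1,0}` and `-i`-eigenspace `𝔤^{0,1}`. -/
theorem exists_isIntegrableIsometry [FiniteDimensional ℝ V] {h : LieSubalgebra ℂ (ℂ ⊗[ℝ] V)}
    [h.IsCartanSubalgebra] {B : LinearMap.BilinForm ℝ V} (hs : ∀ x y, B x y = B y x)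
    (hp : ∀ x, x ≠ 0 → 0 < B x x) (hinv : ∀ x y z : V, B ⁅x, y⁆ z = -B y ⁅x, z⁆)
    {P : Set (h → ℂ)} {Ih : Module.End ℝ (realSubspace h)} (hI : ∀ x, Ih (Ih x) = -x)
    (hconj : ∀ z ∈ h, conjC z ∈ h) (hP : IsPositiveSystem h P)
    (hIB : ∀ x y : realSubspace h, B (Ih x) (Ih y) = B x y) :
    ∃ J : Module.End ℝ V, IsIntegrableIsometry B J ∧
      (∀ a b, mkC a b ∈ g10 h P Ih ↔ b = -J a) ∧ (∀ a b, mkC a b ∈ g01 h P Ih ↔ b = J a) := by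
  have hmap : (g01 h P Ih).map conjC = g10 h P Ih := by
    ext z
    rw [conjC_mem_map]
    exact ⟨fun hz => by simpa using conjC_mem_g10 hs hp hinv hI hconj hz,
      fun hz => conjC_mem_g01 hs hp hinv hI hconj hz⟩
  have hcompl : IsCompl (g01 h P Ih) ((g01 h P Ih).map conjC) := by
    rw [hmap]
    constructor
    · rw [Submodule.disjoint_def]
      intro z hz hz'
      -- For z in the intersection both z and z̄ lie in the isotropic space 𝔤^{1,0}, so B(z, z̄) =
      -- 0.
      exact eq_zero_of_bilinBaseChange_conjC_self hs hp
        (g10_isotropic hs hp hinv hI hconj hP hIB hz' (conjC_mem_g10 hs hp hinv hI hconj hz))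
    · rw [codisjoint_iff, sup_comm]
      exact g10_sup_g01 hI hconj hP
  obtain ⟨J, hJ, hJ'⟩ := exists_complexStructure_of_isCompl hcompl
  have h10' (a b : V) : mkC a b ∈ g10 h P Ih ↔ b = -J a := by
    rw [← hmap, conjC_mem_map, conjC_mkC, hJ', neg_eq_iff_eq_neg]
  refine ⟨J, ⟨hJ, fun x y => ?_, fun x y => ?_⟩, h10', hJ'⟩
  -- The real part of B(x - iJx, y - iJy) = 0 is the isometry property.
  · have h1 := g10_isotropic hs hp hinv hI hconj hP hIB ((h10' x _).2 rfl) ((h10' y _).2 rfl)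
    rw [bilinBaseChange_mkC] at h1
    have h2 := congrArg Complex.re h1
    simp at h2
    linarith
  · have h1 := g10_lie_mem hs hp hinv hI hconj hP ((h10' x _).2 rfl) ((h10' y _).2 rfl)
    rw [lie_mkC, h10'] at h1
    simp only [lie_neg, neg_lie, neg_neg] at h1
    rw [← neg_inj, ← h1]
    abel

end IntegrableStructures

/-! ### Derivatives between manifolds as endomorphisms of the model space -/

section ManifoldDerivative

variable {E : Type*} [NormedAddCommGroup E] [NormedSpace ℝ E]
  {M : Type*} [TopologicalSpace M] [ChartedSpace E M]
  {M' : Type*} [TopologicalSpace M'] [ChartedSpace E M']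
  {M'' : Type*} [TopologicalSpace M''] [ChartedSpace E M'']

variable (E) in
/-- The derivative of a map between manifolds modelled on `E`, as an endomorphism of `E`. -/
def dE (f : M → M') (x : M) : E →L[ℝ] E := mfderiv 𝓘(ℝ, E) 𝓘(ℝ, E) f x

/-- The base point of the outer derivative is a separate variable `y`, so that it can be taken in
simplified form, such as g in place of g * 1. -/
theorem dE_comp {g : M' → M''} {f : M → M'} {x : M} {y : M'} (hxy : f x = y)
    (hg : MDifferentiableAt 𝓘(ℝ, E) 𝓘(ℝ, E) g y) (hf : MDifferentiableAt 𝓘(ℝ, E) 𝓘(ℝ, E) f x) :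
    dE E (fun z => g (f z)) x = (dE E g y).comp (dE E f x) := by
  subst hxy
  exact mfderiv_comp x hg hf

theorem dE_id (x : M) : dE E (fun z : M => z) x = ContinuousLinearMap.id ℝ E :=
  mfderiv_id

theorem dE_congr {f g : M → M'} {x : M} (h : f =ᶠ[nhds x] g) : dE E f x = dE E g x :=
  h.mfderiv_eq

theorem dE_eq_fderiv (f : E → E) (x : E) : dE E f x = fderiv ℝ f x :=
  mfderiv_eq_fderiv

theorem inverse_of_comp_eq_id {f g : E →L[ℝ] E} (h : f.comp g = ContinuousLinearMap.id ℝ E)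
    (h' : g.comp f = ContinuousLinearMap.id ℝ E) : f.inverse = g :=
  ContinuousLinearMap.inverse_eq h h'

variable [IsManifold 𝓘(ℝ, E) ∞ M]

theorem mdifferentiableAt_chart {x₀ x : M} (hx : x ∈ (extChartAt 𝓘(ℝ, E) x₀).source) :
    MDifferentiableAt 𝓘(ℝ, E) 𝓘(ℝ, E) (extChartAt 𝓘(ℝ, E) x₀) x :=
  haveI : IsManifold 𝓘(ℝ, E) 1 M := IsManifold.of_le (n := ∞) (by simp)
  mdifferentiableAt_extChartAt (by simpa using hx)

theorem contMDiffAt_chart_symm {x₀ : M} {y : E} (hy : y ∈ (extChartAt 𝓘(ℝ, E) x₀).target) :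
    ContMDiffAt 𝓘(ℝ, E) 𝓘(ℝ, E) ∞ (extChartAt 𝓘(ℝ, E) x₀).symm y :=
  (contMDiffOn_extChartAt_symm x₀).contMDiffAt ((isOpen_extChartAt_target x₀).mem_nhds hy)

theorem mdifferentiableAt_chart_symm {x₀ : M} {y : E}
    (hy : y ∈ (extChartAt 𝓘(ℝ, E) x₀).target) :
    MDifferentiableAt 𝓘(ℝ, E) 𝓘(ℝ, E) (extChartAt 𝓘(ℝ, E) x₀).symm y :=
  (contMDiffAt_chart_symm hy).mdifferentiableAt (by simp)

theorem dE_chart_comp_symm {x₀ : M} {y : E} (hy : y ∈ (extChartAt 𝓘(ℝ, E) x₀).target) :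
    (dE E (extChartAt 𝓘(ℝ, E) x₀) ((extChartAt 𝓘(ℝ, E) x₀).symm y)).comp
      (dE E (extChartAt 𝓘(ℝ, E) x₀).symm y) = ContinuousLinearMap.id ℝ E := by
  rw [← dE_comp rfl (mdifferentiableAt_chart ((extChartAt 𝓘(ℝ, E) x₀).map_target hy))
    (mdifferentiableAt_chart_symm hy), ← dE_id (M := E) y]
  apply dE_congr
  filter_upwards [(isOpen_extChartAt_target x₀).mem_nhds hy] with z hz
  exact (extChartAt 𝓘(ℝ, E) x₀).right_inv hz

theorem dE_symm_comp_chart {x₀ : M} {y : E} (hy : y ∈ (extChartAt 𝓘(ℝ, E) x₀).target) :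
    (dE E (extChartAt 𝓘(ℝ, E) x₀).symm y).comp
      (dE E (extChartAt 𝓘(ℝ, E) x₀) ((extChartAt 𝓘(ℝ, E) x₀).symm y)) =
      ContinuousLinearMap.id ℝ E := by
  have hx := (extChartAt 𝓘(ℝ, E) x₀).map_target hy
  rw [← dE_comp ((extChartAt 𝓘(ℝ, E) x₀).right_inv hy) (mdifferentiableAt_chart_symm hy)
    (mdifferentiableAt_chart hx), ← dE_id (M := M) ((extChartAt 𝓘(ℝ, E) x₀).symm y)]
  apply dE_congr
  filter_upwards [(isOpen_extChartAt_source x₀).mem_nhds hx] with z hz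
  exact (extChartAt 𝓘(ℝ, E) x₀).left_inv hz

/-- The tangent space at x₀ is identified with the model space through the preferred chart at x₀;
this is why chart formulas simplify at the centre of the chart. -/
theorem dE_chart_self (x₀ : M) : dE E (extChartAt 𝓘(ℝ, E) x₀) x₀ = ContinuousLinearMap.id ℝ E :=
  haveI : IsManifold 𝓘(ℝ, E) 1 M := IsManifold.of_le (n := ∞) (by simp)
  mfderiv_extChartAt_self

theorem dE_chart_symm_self (x₀ : M) :
    dE E (extChartAt 𝓘(ℝ, E) x₀).symm (extChartAt 𝓘(ℝ, E) x₀ x₀) = ContinuousLinearMap.id ℝ E := by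
  have h := dE_symm_comp_chart (mem_extChartAt_target (I := 𝓘(ℝ, E)) x₀)
  rw [extChartAt_to_inv, dE_chart_self] at h
  exact h

theorem inverse_dE_chart_symm {x₀ : M} {y : E} (hy : y ∈ (extChartAt 𝓘(ℝ, E) x₀).target) :
    (dE E (extChartAt 𝓘(ℝ, E) x₀).symm y).inverse =
      dE E (extChartAt 𝓘(ℝ, E) x₀) ((extChartAt 𝓘(ℝ, E) x₀).symm y) :=
  inverse_of_comp_eq_id (dE_symm_comp_chart hy) (dE_chart_comp_symm hy)

end ManifoldDerivative

/-! ### Invariant fields, Maurer-Cartan forms and Ad on the model space -/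

section LieGroupDerivatives

variable {E : Type*} [NormedAddCommGroup E] [NormedSpace ℝ E]
  {G : Type*} [TopologicalSpace G] [ChartedSpace E G] [Group G]

variable (E)

/-- `leftField`, as an endomorphism of the model space. -/
def lfE (g : G) : E →L[ℝ] E := dE E (fun h : G => g * h) 1
/-- `rightField`, as an endomorphism of the model space. -/
def rfE (g : G) : E →L[ℝ] E := dE E (fun h : G => h * g) 1
/-- `thetaL`, as an endomorphism of the model space. -/
def thE (g : G) : E →L[ℝ] E := dE E (fun h : G => g⁻¹ * h) g
/-- `thetaR`, as an endomorphism of the model space. -/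
def trE (g : G) : E →L[ℝ] E := dE E (fun h : G => h * g⁻¹) g
/-- `adjointAction`, as an endomorphism of the model space. -/
def adE (g : G) : E →L[ℝ] E := dE E (fun h : G => g * h * g⁻¹) 1

variable {E}

theorem adE_one : adE E (1 : G) = ContinuousLinearMap.id ℝ E := by
  rw [adE]; simpa using dE_id (1 : G)

variable [LieGroup 𝓘(ℝ, E) ∞ G]

theorem mdiff_mul_left (g x : G) : MDifferentiableAt 𝓘(ℝ, E) 𝓘(ℝ, E) (fun h : G => g * h) x :=
  (contMDiff_mul_left (I := 𝓘(ℝ, E)) (n := ∞) (a := g)).mdifferentiableAt (by simp)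

theorem mdiff_mul_right (g x : G) : MDifferentiableAt 𝓘(ℝ, E) 𝓘(ℝ, E) (fun h : G => h * g) x :=
  (contMDiff_mul_right (I := 𝓘(ℝ, E)) (n := ∞) (a := g)).mdifferentiableAt (by simp)

theorem contMDiff_conj (g : G) : ContMDiff 𝓘(ℝ, E) 𝓘(ℝ, E) ∞ (fun h : G => g * h * g⁻¹) :=
  (contMDiff_const.mul contMDiff_id).mul contMDiff_const

theorem mdiff_conj (g x : G) : MDifferentiableAt 𝓘(ℝ, E) 𝓘(ℝ, E) (fun h : G => g * h * g⁻¹) x :=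
  (contMDiff_conj g).mdifferentiableAt (by simp)

theorem thE_comp_lfE (g : G) : (thE E g).comp (lfE E g) = ContinuousLinearMap.id ℝ E := by
  rw [thE, lfE, ← dE_comp (mul_one g) (mdiff_mul_left g⁻¹ g) (mdiff_mul_left g 1)]
  simpa using dE_id (1 : G)

theorem lfE_comp_thE (g : G) : (lfE E g).comp (thE E g) = ContinuousLinearMap.id ℝ E := by
  rw [thE, lfE, ← dE_comp (inv_mul_cancel g) (mdiff_mul_left g 1) (mdiff_mul_left g⁻¹ g)]
  simpa using dE_id g

theorem trE_comp_lfE (g : G) : (trE E g).comp (lfE E g) = adE E g := by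
  rw [trE, lfE, adE, ← dE_comp (mul_one g) (mdiff_mul_right g⁻¹ g) (mdiff_mul_left g 1)]

theorem thE_comp_rfE (g : G) : (thE E g).comp (rfE E g) = adE E g⁻¹ := by
  rw [thE, rfE, adE, ← dE_comp (f := fun h : G => h * g) (one_mul g) (mdiff_mul_left g⁻¹ g) (mdiff_mul_right g 1)]
  simp [mul_assoc]

theorem adE_mul (g k : G) : adE E (g * k) = (adE E g).comp (adE E k) := by
  rw [adE, adE, adE, ← dE_comp (by simp) (mdiff_conj g 1) (mdiff_conj k 1)]
  simp [mul_assoc]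

@[simp] theorem thE_lfE (g : G) (x : E) : thE E g (lfE E g x) = x :=
  DFunLike.congr_fun (thE_comp_lfE g) x

@[simp] theorem lfE_thE (g : G) (x : E) : lfE E g (thE E g x) = x :=
  DFunLike.congr_fun (lfE_comp_thE g) x

theorem thE_rfE (g : G) (x : E) : thE E g (rfE E g x) = adE E g⁻¹ x :=
  DFunLike.congr_fun (thE_comp_rfE g) x

/-- Since ξ^R = (Ad_{g⁻¹} ξ)^L at g, right-invariant objects can be expressed in the left
trivialization. -/
theorem rfE_eq (g : G) (x : E) : rfE E g x = lfE E g (adE E g⁻¹ x) := by rw [← thE_rfE, lfE_thE]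

theorem trE_eq (g : G) (x : E) : trE E g x = adE E g (thE E g x) := by
  rw [← trE_comp_lfE, ContinuousLinearMap.comp_apply, lfE_thE]

@[simp] theorem adE_inv_adE (g : G) (x : E) : adE E g⁻¹ (adE E g x) = x := by
  rw [← ContinuousLinearMap.comp_apply, ← adE_mul, inv_mul_cancel, adE_one]; rfl

@[simp] theorem adE_adE_inv (g : G) (x : E) : adE E g (adE E g⁻¹ x) = x := by
  rw [← ContinuousLinearMap.comp_apply, ← adE_mul, mul_inv_cancel, adE_one]; rfl

end LieGroupDerivatives

/-! ### The left Maurer-Cartan form Θ in a chart -/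

section ChartMaurerCartan

variable {E : Type*} [NormedAddCommGroup E] [NormedSpace ℝ E]
  {G : Type*} [TopologicalSpace G] [ChartedSpace E G] [Group G]

/-- The left Maurer-Cartan form in the chart at `x₀`. -/
def chartTheta (x₀ : G) (y : E) : E →L[ℝ] E :=
  (thE E ((extChartAt 𝓘(ℝ, E) x₀).symm y)).comp (dE E (extChartAt 𝓘(ℝ, E) x₀).symm y)

variable [LieGroup 𝓘(ℝ, E) ∞ G]

theorem chartTheta_self (x₀ : G) : chartTheta x₀ (extChartAt 𝓘(ℝ, E) x₀ x₀) = thE E x₀ := by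
  rw [chartTheta, dE_chart_symm_self, extChartAt_to_inv]
  rfl

/-- The left division map in the chart at `x₀` for the arguments and the chart at `1` for the
value. -/
def chartDiv (x₀ : G) (p : E × E) : E :=
  extChartAt 𝓘(ℝ, E) (1 : G)
    (((extChartAt 𝓘(ℝ, E) x₀).symm p.1)⁻¹ * (extChartAt 𝓘(ℝ, E) x₀).symm p.2)

theorem contDiffAt_chartDiv (x₀ : G) {y : E} (hy : y ∈ (extChartAt 𝓘(ℝ, E) x₀).target) :
    ContDiffAt ℝ ∞ (chartDiv x₀) (y, y) := by
  rw [← contMDiffAt_iff_contDiffAt]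
  have h1 : ContMDiffAt 𝓘(ℝ, E × E) 𝓘(ℝ, E) ∞
      (fun p : E × E => (extChartAt 𝓘(ℝ, E) x₀).symm p.1) (y, y) :=
    ContMDiffAt.comp (y, y) (contMDiffAt_chart_symm (M := G) hy) contDiffAt_fst.contMDiffAt
  have h2 : ContMDiffAt 𝓘(ℝ, E × E) 𝓘(ℝ, E) ∞
      (fun p : E × E => (extChartAt 𝓘(ℝ, E) x₀).symm p.2) (y, y) :=
    ContMDiffAt.comp (y, y) (contMDiffAt_chart_symm (M := G) hy) contDiffAt_snd.contMDiffAt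
  refine ContMDiffAt.comp_of_eq (y := (1 : G)) contMDiffAt_extChartAt (h1.inv.mul h2) ?_
  simp

/-- Presents Θ as a partial derivative, along the diagonal, of the smooth map (p, q) ↦ p⁻¹q;
smoothness of Θ follows. -/
theorem chartTheta_eq (x₀ : G) {y : E} (hy : y ∈ (extChartAt 𝓘(ℝ, E) x₀).target) :
    chartTheta x₀ y = (fderiv ℝ (chartDiv x₀) (y, y)).comp (ContinuousLinearMap.inr ℝ E E) := by
  have h1 : dE E (fun z => (((extChartAt 𝓘(ℝ, E) x₀).symm y)⁻¹ *
      (extChartAt 𝓘(ℝ, E) x₀).symm z)) y = chartTheta x₀ y :=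
    dE_comp rfl (mdiff_mul_left _ _) (mdifferentiableAt_chart_symm hy)
  have h2 : dE E (fun z => chartDiv x₀ (y, z)) y = chartTheta x₀ y := by
    rw [← h1]
    have := dE_comp (g := extChartAt 𝓘(ℝ, E) (1 : G)) (y := 1) (x := y)
      (f := fun z => (((extChartAt 𝓘(ℝ, E) x₀).symm y)⁻¹ * (extChartAt 𝓘(ℝ, E) x₀).symm z))
      (by simp) (mdifferentiableAt_chart (mem_extChartAt_source _))
      (MDifferentiableAt.comp y (mdiff_mul_left _ _) (mdifferentiableAt_chart_symm hy))
    rw [dE_chart_self, ContinuousLinearMap.id_comp] at this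
    exact this
  rw [← h2, dE_eq_fderiv]
  have h3 : HasFDerivAt (fun z : E => (y, z)) (ContinuousLinearMap.inr ℝ E E) y :=
    hasFDerivAt_prodMk_right y y
  exact (((contDiffAt_chartDiv x₀ hy).differentiableAt (by simp)).hasFDerivAt.comp y h3).fderiv

theorem contDiffAt_chartTheta (x₀ : G) {y : E} (hy : y ∈ (extChartAt 𝓘(ℝ, E) x₀).target) :
    ContDiffAt ℝ ∞ (chartTheta x₀) y := by
  have h1 : ContDiffAt ℝ ∞
      (fun y => (fderiv ℝ (chartDiv x₀) (y, y)).comp (ContinuousLinearMap.inr ℝ E E)) y := by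
    have h2 := (contDiffAt_chartDiv x₀ hy).fderiv_right (m := ∞) (by simp)
    have h3 : ContDiffAt ℝ ∞ (fun y : E => (y, y)) y := contDiffAt_id.prodMk contDiffAt_id
    exact (ContDiffAt.comp (f := fun y : E => (y, y)) y h2 h3).clm_comp contDiffAt_const
  refine h1.congr_of_eventuallyEq ?_
  filter_upwards [(isOpen_extChartAt_target x₀).mem_nhds hy] with z hz
  exact chartTheta_eq x₀ hz

/-- The inverse of the Maurer-Cartan form in the chart at `x₀`. -/
def chartThetaInv (x₀ : G) (y : E) : E →L[ℝ] E :=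
  (dE E (extChartAt 𝓘(ℝ, E) x₀) ((extChartAt 𝓘(ℝ, E) x₀).symm y)).comp
    (lfE E ((extChartAt 𝓘(ℝ, E) x₀).symm y))

theorem chartTheta_comp_inv (x₀ : G) {y : E} (hy : y ∈ (extChartAt 𝓘(ℝ, E) x₀).target) :
    (chartTheta x₀ y).comp (chartThetaInv x₀ y) = ContinuousLinearMap.id ℝ E := by
  rw [chartTheta, chartThetaInv, ContinuousLinearMap.comp_assoc,
    ← ContinuousLinearMap.comp_assoc (dE E _ _), dE_symm_comp_chart hy, ContinuousLinearMap.id_comp,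
    thE_comp_lfE]

theorem chartThetaInv_comp (x₀ : G) {y : E} (hy : y ∈ (extChartAt 𝓘(ℝ, E) x₀).target) :
    (chartThetaInv x₀ y).comp (chartTheta x₀ y) = ContinuousLinearMap.id ℝ E := by
  rw [chartTheta, chartThetaInv, ContinuousLinearMap.comp_assoc,
    ← ContinuousLinearMap.comp_assoc (lfE E _), lfE_comp_thE, ContinuousLinearMap.id_comp,
    dE_chart_comp_symm hy]

/-- Inversion is smooth at invertible operators on a complete space. -/
theorem contDiffAt_chartThetaInv [CompleteSpace E] (x₀ : G) {y : E}
    (hy : y ∈ (extChartAt 𝓘(ℝ, E) x₀).target) :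
    ContDiffAt ℝ ∞ (chartThetaInv x₀) y := by
  let e : E ≃L[ℝ] E := ContinuousLinearEquiv.equivOfInverse (chartTheta x₀ y) (chartThetaInv x₀ y)
    (fun v => DFunLike.congr_fun (chartThetaInv_comp x₀ hy) v)
    (fun v => DFunLike.congr_fun (chartTheta_comp_inv x₀ hy) v)
  have h1 : ContDiffAt ℝ ∞ (fun y => (chartTheta x₀ y).inverse) y :=
    ContDiffAt.comp (g := ContinuousLinearMap.inverse) y
      (contDiffAt_map_inverse (n := ∞) e) (contDiffAt_chartTheta x₀ hy)
  refine h1.congr_of_eventuallyEq ?_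
  filter_upwards [(isOpen_extChartAt_target x₀).mem_nhds hy] with z hz
  exact (inverse_of_comp_eq_id (chartTheta_comp_inv x₀ hz) (chartThetaInv_comp x₀ hz)).symm

theorem hasFDerivAt_chartTheta (x₀ : G) {y : E} (hy : y ∈ (extChartAt 𝓘(ℝ, E) x₀).target) :
    HasFDerivAt (chartTheta x₀) (fderiv ℝ (chartTheta x₀) y) y :=
  ((contDiffAt_chartTheta x₀ hy).differentiableAt (by simp)).hasFDerivAt

theorem differentiableAt_chartThetaInv [CompleteSpace E] (x₀ : G) {y : E}
    (hy : y ∈ (extChartAt 𝓘(ℝ, E) x₀).target) :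
    DifferentiableAt ℝ (chartThetaInv x₀) y :=
  (contDiffAt_chartThetaInv x₀ hy).differentiableAt (by simp)

theorem mpullback_chart_symm (x₀ : G) {y : E} (hy : y ∈ (extChartAt 𝓘(ℝ, E) x₀).target)
    (V : G → E) :
    VectorField.mpullback 𝓘(ℝ, E) 𝓘(ℝ, E) (extChartAt 𝓘(ℝ, E) x₀).symm V y =
      chartThetaInv x₀ y (thE E ((extChartAt 𝓘(ℝ, E) x₀).symm y)
        (V ((extChartAt 𝓘(ℝ, E) x₀).symm y))) := by
  change (dE E (extChartAt 𝓘(ℝ, E) x₀).symm y).inverse (V ((extChartAt 𝓘(ℝ, E) x₀).symm y)) = _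
  rw [chartThetaInv, ContinuousLinearMap.comp_apply, lfE_thE, inverse_dE_chart_symm hy]

/-- The derivative of a vector field `Θ⁻¹ U` in a chart. -/
theorem chartTheta_fderiv_inv_apply [CompleteSpace E] (x₀ : G) {y : E}
    (hy : y ∈ (extChartAt 𝓘(ℝ, E) x₀).target)
    {U : E → E} (hU : DifferentiableAt ℝ U y) (w : E) :
    chartTheta x₀ y (fderiv ℝ (fun z => chartThetaInv x₀ z (U z)) y w) =
      fderiv ℝ U y w - fderiv ℝ (chartTheta x₀) y w (chartThetaInv x₀ y (U y)) := by
  have hX : DifferentiableAt ℝ (fun z => chartThetaInv x₀ z (U z)) y :=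
    (differentiableAt_chartThetaInv x₀ hy).clm_apply hU
  have h1 := (hasFDerivAt_chartTheta x₀ hy).clm_apply hX.hasFDerivAt
  -- The formula is the derivative of the identity Θ(Θ⁻¹U) = U.
  have h2 : (fun z => chartTheta x₀ z (chartThetaInv x₀ z (U z))) =ᶠ[nhds y] U := by
    filter_upwards [(isOpen_extChartAt_target x₀).mem_nhds hy] with z hz
    exact DFunLike.congr_fun (chartTheta_comp_inv x₀ hz) (U z)
  have h3 := DFunLike.congr_fun ((hU.hasFDerivAt.congr_of_eventuallyEq h2).unique h1) w
  rw [h3]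
  simp

theorem mlieBracket_eq_lieBracket (V W : E → E) (y : E) :
    VectorField.mlieBracket 𝓘(ℝ, E) V W y = VectorField.lieBracket ℝ V W y := by
  rw [← VectorField.lieBracketWithin_univ]
  exact congrFun (VectorField.mlieBracketWithin_eq_lieBracketWithin (s := Set.univ)) y

end ChartMaurerCartan

/-! ### The Maurer-Cartan equation -/

section MaurerCartanEquation

variable {E : Type*} [NormedAddCommGroup E] [NormedSpace ℝ E] [FiniteDimensional ℝ E]
  [CompleteSpace E]
  {G : Type*} [TopologicalSpace G] [ChartedSpace E G] [Group G] [LieGroup 𝓘(ℝ, E) ∞ G]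

variable (E G) in
/-- The bracket of `𝔤`, as a continuous bilinear map on the model space. -/
def lieE : E →L[ℝ] E →L[ℝ] E :=
  LinearMap.toContinuousBilinearMap (𝕜 := ℝ) (E := E) (F := E) (G := E)
    (bracketMap (E := E) (G := G))

/-- The bracket of 𝔤 is that of left-invariant fields, and Lie brackets commute with pullback by the
inverse chart. -/
theorem lieBracket_chart_leftField (x₀ : G) {y : E} (hy : y ∈ (extChartAt 𝓘(ℝ, E) x₀).target)
    (ζ η : E) :
    VectorField.lieBracket ℝ (fun z => chartThetaInv x₀ z ζ) (fun z => chartThetaInv x₀ z η) y =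
      chartThetaInv x₀ y (lieE E G ζ η) := by
  have hpb (v : LieAlg E G) {z : E} (hz : z ∈ (extChartAt 𝓘(ℝ, E) x₀).target) :
      VectorField.mpullback 𝓘(ℝ, E) 𝓘(ℝ, E) (extChartAt 𝓘(ℝ, E) x₀).symm
        (mulInvariantVectorField v) z = chartThetaInv x₀ z v := by
    refine (mpullback_chart_symm x₀ hz (mulInvariantVectorField v)).trans ?_
    exact congrArg (chartThetaInv x₀ z) (thE_lfE _ _)
  have hpe (v : LieAlg E G) : VectorField.mpullback 𝓘(ℝ, E) 𝓘(ℝ, E) (extChartAt 𝓘(ℝ, E) x₀).symm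
        (mulInvariantVectorField v) =ᶠ[nhds y] fun z => chartThetaInv x₀ z v := by
    filter_upwards [(isOpen_extChartAt_target x₀).mem_nhds hy] with z hz
    exact hpb v hz
  have h1 := VectorField.mpullback_mlieBracket (I := 𝓘(ℝ, E)) (I' := 𝓘(ℝ, E))
    (f := (extChartAt 𝓘(ℝ, E) x₀).symm) (x₀ := y) (n := ∞)
    (mdifferentiableAt_mulInvariantVectorField (I := 𝓘(ℝ, E)) (G := G) ζ)
    (mdifferentiableAt_mulInvariantVectorField (I := 𝓘(ℝ, E)) (G := G) η)
    (contMDiffAt_chart_symm hy) (by simpa using (inferInstance : ENat.LEInfty 2).out)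
  have h0 := mulInvariantVector_mlieBracket (I := 𝓘(ℝ, E)) (G := G) ζ η
  have h3 := (congrFun (congrArg (VectorField.mpullback 𝓘(ℝ, E) 𝓘(ℝ, E)
    (extChartAt 𝓘(ℝ, E) x₀).symm) h0) y).symm.trans (hpb _ hy)
  have h2 : VectorField.mlieBracket 𝓘(ℝ, E)
      (VectorField.mpullback 𝓘(ℝ, E) 𝓘(ℝ, E) (extChartAt 𝓘(ℝ, E) x₀).symm
        (mulInvariantVectorField (G := G) ζ))
      (VectorField.mpullback 𝓘(ℝ, E) 𝓘(ℝ, E) (extChartAt 𝓘(ℝ, E) x₀).symm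
        (mulInvariantVectorField (G := G) η)) y =
      VectorField.lieBracket ℝ (fun z => chartThetaInv x₀ z ζ)
        (fun z => chartThetaInv x₀ z η) y := by
    refine (mlieBracket_eq_lieBracket _ _ y).trans ?_
    exact (hpe ζ).lieBracket_vectorField_eq (hpe η)
  exact h2.symm.trans (h1.symm.trans h3)

/-- The Maurer-Cartan equation in a chart. -/
theorem maurerCartan (x₀ : G) {y : E} (hy : y ∈ (extChartAt 𝓘(ℝ, E) x₀).target) (v w : E) :
    fderiv ℝ (chartTheta x₀) y v w - fderiv ℝ (chartTheta x₀) y w v =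
      -lieE E G (chartTheta x₀ y v) (chartTheta x₀ y w) := by
  -- The vectors v and w are extended to left-invariant fields; their components Θv, Θw are
  -- constant, so only derivatives of Θ survive in the bracket.
  have h := congrArg (chartTheta x₀ y)
    (lieBracket_chart_leftField x₀ hy (chartTheta x₀ y v) (chartTheta x₀ y w))
  have hinv (u : E) : chartThetaInv x₀ y (chartTheta x₀ y u) = u :=
    DFunLike.congr_fun (chartThetaInv_comp x₀ hy) u
  have hinv' (u : E) : chartTheta x₀ y (chartThetaInv x₀ y u) = u :=
    DFunLike.congr_fun (chartTheta_comp_inv x₀ hy) u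
  rw [VectorField.lieBracket, map_sub, hinv',
    chartTheta_fderiv_inv_apply x₀ hy (differentiableAt_const _),
    chartTheta_fderiv_inv_apply x₀ hy (differentiableAt_const _), hinv, hinv] at h
  rw [← h]
  simp only [fderiv_fun_const, Pi.zero_apply, zero_apply]
  abel

/-- The Lie bracket of vector fields `Θ⁻¹ U`, `Θ⁻¹ W` in a chart. -/
theorem chartTheta_lieBracket (x₀ : G) {y : E} (hy : y ∈ (extChartAt 𝓘(ℝ, E) x₀).target)
    {U W : E → E} (hU : DifferentiableAt ℝ U y) (hW : DifferentiableAt ℝ W y) :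
    chartTheta x₀ y (VectorField.lieBracket ℝ (fun z => chartThetaInv x₀ z (U z))
      (fun z => chartThetaInv x₀ z (W z)) y) =
    lieE E G (U y) (W y) + fderiv ℝ W y (chartThetaInv x₀ y (U y))
      - fderiv ℝ U y (chartThetaInv x₀ y (W y)) := by
  have hinv' (u : E) : chartTheta x₀ y (chartThetaInv x₀ y u) = u :=
    DFunLike.congr_fun (chartTheta_comp_inv x₀ hy) u
  have h := maurerCartan x₀ hy (chartThetaInv x₀ y (U y)) (chartThetaInv x₀ y (W y))
  rw [hinv', hinv'] at h
  rw [VectorField.lieBracket, map_sub, chartTheta_fderiv_inv_apply x₀ hy hU,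
    chartTheta_fderiv_inv_apply x₀ hy hW, ← neg_neg (lieE E G (U y) (W y)), ← h]
  abel

end MaurerCartanEquation

/-! ### Smoothness of vector-valued functions, tested in charts -/

section ChartSmoothness

variable {E : Type*} [NormedAddCommGroup E] [NormedSpace ℝ E]
  {M : Type*} [TopologicalSpace M] [ChartedSpace E M]
  {F : Type*} [NormedAddCommGroup F] [NormedSpace ℝ F]

theorem contMDiffAt_of_contDiffAt_chart {f : M → F} {x₀ : M}
    (h : ContDiffAt ℝ ∞ (fun y => f ((extChartAt 𝓘(ℝ, E) x₀).symm y)) (extChartAt 𝓘(ℝ, E) x₀ x₀)) :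
    ContMDiffAt 𝓘(ℝ, E) 𝓘(ℝ, F) ∞ f x₀ := by
  have h1 : ContMDiffAt 𝓘(ℝ, E) 𝓘(ℝ, F) ∞
      (fun x => f ((extChartAt 𝓘(ℝ, E) x₀).symm (extChartAt 𝓘(ℝ, E) x₀ x))) x₀ :=
    ContMDiffAt.comp (g := fun y => f ((extChartAt 𝓘(ℝ, E) x₀).symm y)) x₀ h.contMDiffAt
      contMDiffAt_extChartAt
  refine h1.congr_of_eventuallyEq ?_
  filter_upwards [(isOpen_extChartAt_source (I := 𝓘(ℝ, E)) x₀).mem_nhds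
    (mem_extChartAt_source x₀)] with z hz
  rw [(extChartAt 𝓘(ℝ, E) x₀).left_inv hz]

theorem contDiffAt_chart_of_contMDiffAt [IsManifold 𝓘(ℝ, E) ∞ M] {f : M → F} {x₀ : M} {y : E}
    (hy : y ∈ (extChartAt 𝓘(ℝ, E) x₀).target)
    (h : ContMDiffAt 𝓘(ℝ, E) 𝓘(ℝ, F) ∞ f ((extChartAt 𝓘(ℝ, E) x₀).symm y)) :
    ContDiffAt ℝ ∞ (fun y => f ((extChartAt 𝓘(ℝ, E) x₀).symm y)) y := by
  rw [← contMDiffAt_iff_contDiffAt]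
  exact ContMDiffAt.comp y h (contMDiffAt_chart_symm hy)

end ChartSmoothness

/-! ### Smoothness of g ↦ Ad_g -/

section AdjointSmooth

variable {E : Type*} [NormedAddCommGroup E] [NormedSpace ℝ E]
  {G : Type*} [TopologicalSpace G] [ChartedSpace E G] [Group G]

/-- Conjugation, in the chart at `x₀` for the conjugating element and in the chart at `1` for the
conjugated one. -/
def chartConj (x₀ : G) (p : E × E) : E :=
  extChartAt 𝓘(ℝ, E) (1 : G) ((extChartAt 𝓘(ℝ, E) x₀).symm p.1 *
    (extChartAt 𝓘(ℝ, E) (1 : G)).symm p.2 * ((extChartAt 𝓘(ℝ, E) x₀).symm p.1)⁻¹)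

variable [LieGroup 𝓘(ℝ, E) ∞ G]

theorem contDiffAt_chartConj (x₀ : G) {y : E} (hy : y ∈ (extChartAt 𝓘(ℝ, E) x₀).target) :
    ContDiffAt ℝ ∞ (chartConj x₀) (y, extChartAt 𝓘(ℝ, E) (1 : G) 1) := by
  rw [← contMDiffAt_iff_contDiffAt]
  have h1 : ContMDiffAt 𝓘(ℝ, E × E) 𝓘(ℝ, E) ∞
      (fun p : E × E => (extChartAt 𝓘(ℝ, E) x₀).symm p.1)
      (y, extChartAt 𝓘(ℝ, E) (1 : G) 1) :=
    ContMDiffAt.comp (y, extChartAt 𝓘(ℝ, E) (1 : G) 1) (contMDiffAt_chart_symm (M := G) hy)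
      contDiffAt_fst.contMDiffAt
  have h2 : ContMDiffAt 𝓘(ℝ, E × E) 𝓘(ℝ, E) ∞
      (fun p : E × E => (extChartAt 𝓘(ℝ, E) (1 : G)).symm p.2)
      (y, extChartAt 𝓘(ℝ, E) (1 : G) 1) :=
    ContMDiffAt.comp (y, extChartAt 𝓘(ℝ, E) (1 : G) 1)
      (contMDiffAt_chart_symm (M := G) (mem_extChartAt_target (1 : G))) contDiffAt_snd.contMDiffAt
  refine ContMDiffAt.comp_of_eq (y := (1 : G)) contMDiffAt_extChartAt ((h1.mul h2).mul h1.inv) ?_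
  simp

/-- Presents Ad as a partial derivative of the smooth map (g, h) ↦ ghg⁻¹ at h = 1. -/
theorem adE_chart_eq (x₀ : G) {y : E} (hy : y ∈ (extChartAt 𝓘(ℝ, E) x₀).target) :
    adE E ((extChartAt 𝓘(ℝ, E) x₀).symm y) =
      (fderiv ℝ (chartConj x₀) (y, extChartAt 𝓘(ℝ, E) (1 : G) 1)).comp
        (ContinuousLinearMap.inr ℝ E E) := by
  set g := (extChartAt 𝓘(ℝ, E) x₀).symm y with hg
  have hsymm := mdifferentiableAt_chart_symm (M := G) (mem_extChartAt_target (I := 𝓘(ℝ, E)) (1 : G))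
  have h1 : dE E (fun z => g * (extChartAt 𝓘(ℝ, E) (1 : G)).symm z * g⁻¹)
      (extChartAt 𝓘(ℝ, E) (1 : G) 1) = adE E g := by
    rw [dE_comp (g := fun h => g * h * g⁻¹) (y := 1) (extChartAt_to_inv _) (mdiff_conj g 1) hsymm,
      dE_chart_symm_self]
    rfl
  have h2 : dE E (fun z => chartConj x₀ (y, z)) (extChartAt 𝓘(ℝ, E) (1 : G) 1) = adE E g := by
    rw [← h1]
    have := dE_comp (g := extChartAt 𝓘(ℝ, E) (1 : G)) (y := 1)
      (x := extChartAt 𝓘(ℝ, E) (1 : G) 1)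
      (f := fun z => g * (extChartAt 𝓘(ℝ, E) (1 : G)).symm z * g⁻¹)
      (by simp) (mdifferentiableAt_chart (mem_extChartAt_source _))
      (MDifferentiableAt.comp _ (mdiff_conj g _) hsymm)
    rw [dE_chart_self, ContinuousLinearMap.id_comp] at this
    exact this
  rw [← h2, dE_eq_fderiv]
  have h3 : HasFDerivAt (fun z : E => (y, z)) (ContinuousLinearMap.inr ℝ E E)
    (extChartAt 𝓘(ℝ, E) (1 : G) 1) := hasFDerivAt_prodMk_right _ _
  exact (((contDiffAt_chartConj x₀ hy).differentiableAt (by simp)).hasFDerivAt.comp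
    (extChartAt 𝓘(ℝ, E) (1 : G) 1) h3).fderiv

theorem contMDiff_adE : ContMDiff 𝓘(ℝ, E) 𝓘(ℝ, E →L[ℝ] E) ∞ (fun g : G => adE E g) := by
  intro x₀
  apply contMDiffAt_of_contDiffAt_chart
  have hy := mem_extChartAt_target (I := 𝓘(ℝ, E)) x₀
  have h1 : ContDiffAt ℝ ∞
      (fun y => (fderiv ℝ (chartConj x₀) (y, extChartAt 𝓘(ℝ, E) (1 : G) 1)).comp
        (ContinuousLinearMap.inr ℝ E E)) (extChartAt 𝓘(ℝ, E) x₀ x₀) := by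
    have h2 := (contDiffAt_chartConj x₀ hy).fderiv_right (m := ∞) (by simp)
    have h3 : ContDiffAt ℝ ∞ (fun y : E => (y, extChartAt 𝓘(ℝ, E) (1 : G) 1))
      (extChartAt 𝓘(ℝ, E) x₀ x₀) := contDiffAt_id.prodMk contDiffAt_const
    exact (ContDiffAt.comp (f := fun y : E => (y, extChartAt 𝓘(ℝ, E) (1 : G) 1)) _ h2 h3).clm_comp
      contDiffAt_const
  refine h1.congr_of_eventuallyEq ?_
  filter_upwards [(isOpen_extChartAt_target x₀).mem_nhds hy] with z hz
  exact adE_chart_eq x₀ hz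

theorem contMDiff_adE_inv : ContMDiff 𝓘(ℝ, E) 𝓘(ℝ, E →L[ℝ] E) ∞ (fun g : G => adE E g⁻¹) :=
  contMDiff_adE.comp (contMDiff_inv 𝓘(ℝ, E) ∞)

theorem contMDiff_adE_inv_apply (x : E) :
    ContMDiff 𝓘(ℝ, E) 𝓘(ℝ, E) ∞ (fun g : G => adE E g⁻¹ x) :=
  contMDiff_adE_inv.clm_apply contMDiff_const

end AdjointSmooth

/-! ### The derivative of Ad_{g⁻¹} -/

section AdjointDerivative

variable {E : Type*} [NormedAddCommGroup E] [NormedSpace ℝ E]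
  {G : Type*} [TopologicalSpace G] [ChartedSpace E G] [Group G]

variable (E G) in
/-- The multiplication in the chart at `1`. -/
def chartMul (p : E × E) : E :=
  extChartAt 𝓘(ℝ, E) (1 : G)
    ((extChartAt 𝓘(ℝ, E) (1 : G)).symm p.1 * (extChartAt 𝓘(ℝ, E) (1 : G)).symm p.2)

theorem thE_one : thE E (1 : G) = ContinuousLinearMap.id ℝ E := by
  rw [thE]; simpa using dE_id (1 : G)

variable [LieGroup 𝓘(ℝ, E) ∞ G]

theorem contDiffAt_chartMul : ContDiffAt ℝ ∞ (chartMul E G)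
    (extChartAt 𝓘(ℝ, E) (1 : G) 1, extChartAt 𝓘(ℝ, E) (1 : G) 1) := by
  rw [← contMDiffAt_iff_contDiffAt]
  have hs := contMDiffAt_chart_symm (M := G) (mem_extChartAt_target (I := 𝓘(ℝ, E)) (1 : G))
  have h1 : ContMDiffAt 𝓘(ℝ, E × E) 𝓘(ℝ, E) ∞
      (fun p : E × E => (extChartAt 𝓘(ℝ, E) (1 : G)).symm p.1)
      (extChartAt 𝓘(ℝ, E) (1 : G) 1, extChartAt 𝓘(ℝ, E) (1 : G) 1) :=
    ContMDiffAt.comp (_, _) hs contDiffAt_fst.contMDiffAt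
  have h2 : ContMDiffAt 𝓘(ℝ, E × E) 𝓘(ℝ, E) ∞
      (fun p : E × E => (extChartAt 𝓘(ℝ, E) (1 : G)).symm p.2)
      (extChartAt 𝓘(ℝ, E) (1 : G) 1, extChartAt 𝓘(ℝ, E) (1 : G) 1) :=
    ContMDiffAt.comp (_, _) hs contDiffAt_snd.contMDiffAt
  refine ContMDiffAt.comp_of_eq (y := (1 : G)) contMDiffAt_extChartAt (h1.mul h2) ?_
  simp

theorem eventually_differentiableAt_chartMul :
    ∀ᶠ p in nhds (extChartAt 𝓘(ℝ, E) (1 : G) 1, extChartAt 𝓘(ℝ, E) (1 : G) 1),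
      DifferentiableAt ℝ (chartMul E G) p := by
  have h : ContDiffAt ℝ 1 (chartMul E G)
    (extChartAt 𝓘(ℝ, E) (1 : G) 1, extChartAt 𝓘(ℝ, E) (1 : G) 1) :=
    contDiffAt_chartMul.of_le (by simp)
  filter_upwards [h.eventually (by simp)] with p hp
  exact hp.differentiableAt (by simp)

/-- Left-invariant fields are derivatives of the multiplication in its second argument at 1. -/
theorem chartThetaInv_eq_fderiv_chartMul (ζ : E) :
    ∀ᶠ y in nhds (extChartAt 𝓘(ℝ, E) (1 : G) 1), chartThetaInv (1 : G) y ζ =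
      fderiv ℝ (chartMul E G) (y, extChartAt 𝓘(ℝ, E) (1 : G) 1) (0, ζ) := by
  set p₀ := extChartAt 𝓘(ℝ, E) (1 : G) 1 with hp₀
  have hc : ContinuousAt (fun y : E => (y, p₀)) p₀ := by fun_prop
  filter_upwards [hc.eventually (eventually_differentiableAt_chartMul (G := G)),
    (isOpen_extChartAt_target (I := 𝓘(ℝ, E)) (1 : G)).mem_nhds (mem_extChartAt_target (1 : G))]
    with y hd hy
  set g := (extChartAt 𝓘(ℝ, E) (1 : G)).symm y with hg
  have hsymm := mdifferentiableAt_chart_symm (M := G) (mem_extChartAt_target (I := 𝓘(ℝ, E)) (1 : G))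
  have hgs : g ∈ (extChartAt 𝓘(ℝ, E) (1 : G)).source := (extChartAt 𝓘(ℝ, E) (1 : G)).map_target hy
  have h1 : dE E (fun z => g * (extChartAt 𝓘(ℝ, E) (1 : G)).symm z) p₀ = lfE E g := by
    rw [dE_comp (g := fun h => g * h) (y := 1) (extChartAt_to_inv _) (mdiff_mul_left g 1) hsymm,
      dE_chart_symm_self]
    rfl
  have h2 : dE E (fun z => chartMul E G (y, z)) p₀ = chartThetaInv (1 : G) y := by
    rw [chartThetaInv, ← hg, ← h1]
    exact dE_comp (g := extChartAt 𝓘(ℝ, E) (1 : G)) (y := g)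
      (f := fun z => g * (extChartAt 𝓘(ℝ, E) (1 : G)).symm z)
      (by simp [hp₀]) (mdifferentiableAt_chart hgs)
      (MDifferentiableAt.comp _ (mdiff_mul_left g _) hsymm)
  have h3 : HasFDerivAt (fun z : E => (y, z)) (ContinuousLinearMap.inr ℝ E E) p₀ :=
    hasFDerivAt_prodMk_right _ _
  rw [← h2, dE_eq_fderiv]
  exact DFunLike.congr_fun (HasFDerivAt.comp p₀ hd.hasFDerivAt h3).fderiv ζ

/-- Right-invariant fields have left components Ad_{g⁻¹}x and are derivatives of the multiplication
in its first argument at 1. -/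
theorem chartThetaInv_adE_eq_fderiv_chartMul (x : E) :
    ∀ᶠ y in nhds (extChartAt 𝓘(ℝ, E) (1 : G) 1),
      chartThetaInv (1 : G) y (adE E ((extChartAt 𝓘(ℝ, E) (1 : G)).symm y)⁻¹ x) =
      fderiv ℝ (chartMul E G) (extChartAt 𝓘(ℝ, E) (1 : G) 1, y) (x, 0) := by
  set p₀ := extChartAt 𝓘(ℝ, E) (1 : G) 1 with hp₀
  have hc : ContinuousAt (fun y : E => (p₀, y)) p₀ := by fun_prop
  filter_upwards [hc.eventually (eventually_differentiableAt_chartMul (G := G)),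
    (isOpen_extChartAt_target (I := 𝓘(ℝ, E)) (1 : G)).mem_nhds (mem_extChartAt_target (1 : G))]
    with y hd hy
  set g := (extChartAt 𝓘(ℝ, E) (1 : G)).symm y with hg
  have hsymm := mdifferentiableAt_chart_symm (M := G) (mem_extChartAt_target (I := 𝓘(ℝ, E)) (1 : G))
  have hgs : g ∈ (extChartAt 𝓘(ℝ, E) (1 : G)).source := (extChartAt 𝓘(ℝ, E) (1 : G)).map_target hy
  have h1 : dE E (fun z => (extChartAt 𝓘(ℝ, E) (1 : G)).symm z * g) p₀ = rfE E g := by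
    rw [dE_comp (g := fun h => h * g) (y := 1) (extChartAt_to_inv _) (mdiff_mul_right g 1) hsymm,
      dE_chart_symm_self]
    rfl
  have h2 : dE E (fun z => chartMul E G (z, y)) p₀ =
      (dE E (extChartAt 𝓘(ℝ, E) (1 : G)) g).comp (rfE E g) := by
    rw [← h1]
    exact dE_comp (g := extChartAt 𝓘(ℝ, E) (1 : G)) (y := g)
      (f := fun z => (extChartAt 𝓘(ℝ, E) (1 : G)).symm z * g)
      (by simp [hp₀]) (mdifferentiableAt_chart hgs)
      (MDifferentiableAt.comp _ (mdiff_mul_right g _) hsymm)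
  have h3 : HasFDerivAt (fun z : E => (z, y)) (ContinuousLinearMap.inl ℝ E E) p₀ :=
    hasFDerivAt_prodMk_left _ _
  rw [chartThetaInv, ← hg, ContinuousLinearMap.comp_apply, ← rfE_eq,
    ← ContinuousLinearMap.comp_apply, ← h2, dE_eq_fderiv]
  exact DFunLike.congr_fun (HasFDerivAt.comp p₀ hd.hasFDerivAt h3).fderiv x

/-- Left- and right-invariant vector fields commute, at the identity. -/
theorem lieBracket_left_right (ζ x : E) :
    VectorField.lieBracket ℝ (fun y => chartThetaInv (1 : G) y ζ)
      (fun y => chartThetaInv (1 : G) y (adE E ((extChartAt 𝓘(ℝ, E) (1 : G)).symm y)⁻¹ x))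
      (extChartAt 𝓘(ℝ, E) (1 : G) 1) = 0 := by
  have hl := chartThetaInv_eq_fderiv_chartMul (G := G) ζ
  have hr := chartThetaInv_adE_eq_fderiv_chartMul (G := G) x
  rw [Filter.EventuallyEq.lieBracket_vectorField_eq hl hr, VectorField.lieBracket]
  have hl0 := hl.self_of_nhds
  have hr0 := hr.self_of_nhds
  set p₀ := extChartAt 𝓘(ℝ, E) (1 : G) 1 with hp₀
  have hinv : chartThetaInv (1 : G) p₀ = ContinuousLinearMap.id ℝ E := by
    have := chartTheta_comp_inv (1 : G) (mem_extChartAt_target (I := 𝓘(ℝ, E)) (1 : G))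
    rw [chartTheta_self, thE_one, ContinuousLinearMap.id_comp] at this
    exact this
  rw [hinv] at hl0 hr0
  rw [show (extChartAt 𝓘(ℝ, E) (1 : G)).symm p₀ = 1 from extChartAt_to_inv _, inv_one, adE_one]
    at hr0
  rw [← hl0, ← hr0]
  have hK : ContDiffAt ℝ ∞ (fderiv ℝ (chartMul E G)) (p₀, p₀) :=
    (contDiffAt_chartMul (E := E) (G := G)).fderiv_right (m := ∞) (by simp)
  have hKd := (hK.differentiableAt (by simp)).hasFDerivAt
  have h1 : HasFDerivAt (fun z : E => (z, p₀)) (ContinuousLinearMap.inl ℝ E E) p₀ :=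
    hasFDerivAt_prodMk_left _ _
  have h2 : HasFDerivAt (fun z : E => (p₀, z)) (ContinuousLinearMap.inr ℝ E E) p₀ :=
    hasFDerivAt_prodMk_right _ _
  have h1' := (HasFDerivAt.comp (f := fun z : E => (z, p₀)) p₀ hKd h1).clm_apply (hasFDerivAt_const ((0, ζ) : E × E) p₀)
  have h2' := (HasFDerivAt.comp (f := fun z : E => (p₀, z)) p₀ hKd h2).clm_apply (hasFDerivAt_const ((x, 0) : E × E) p₀)
  have h1'' := DFunLike.congr_fun h1'.fderiv x
  have h2'' := DFunLike.congr_fun h2'.fderiv ζ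
  -- Both terms of the bracket are the mixed second derivative of the multiplication in the
  -- directions (x, 0) and (0, ζ), so symmetry of second derivatives cancels them.
  have hsymm : IsSymmSndFDerivAt ℝ (chartMul E G) (p₀, p₀) :=
    contDiffAt_chartMul.isSymmSndFDerivAt
      (by simpa using (inferInstance : ENat.LEInfty 2).out)
  simp only [Function.comp_def] at h1'' h2''
  simp only [ContinuousLinearMap.id_apply]
  rw [h1'', h2'', sub_eq_zero]
  simpa using hsymm.eq (0, ζ) (x, 0)

variable [FiniteDimensional ℝ E] [CompleteSpace E]

/-- The field with constant left components ζ commutes with x^R, whose left components are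
Ad_{g⁻¹}x. The bracket formula at 1 reads 0 = [ζ, x] + D(Ad_{g⁻¹}x)(ζ). -/
theorem dE_adE_inv_apply_one (ζ x : E) :
    dE E (fun g : G => adE E g⁻¹ x) 1 ζ = -lieE E G ζ x := by
  set p₀ := extChartAt 𝓘(ℝ, E) (1 : G) 1 with hp₀
  have hmem := mem_extChartAt_target (I := 𝓘(ℝ, E)) (1 : G)
  have hd : ContDiffAt ℝ ∞ (fun y => adE E ((extChartAt 𝓘(ℝ, E) (1 : G)).symm y)⁻¹ x) p₀ :=
    contDiffAt_chart_of_contMDiffAt (f := fun g : G => adE E g⁻¹ x) hmem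
      (contMDiff_adE_inv_apply x).contMDiffAt
  have h := chartTheta_lieBracket (1 : G) hmem (U := fun _ => ζ) (differentiableAt_const _)
    (hd.differentiableAt (by simp))
  have hinv : chartThetaInv (1 : G) p₀ = ContinuousLinearMap.id ℝ E := by
    have := chartTheta_comp_inv (1 : G) hmem
    rw [chartTheta_self, thE_one, ContinuousLinearMap.id_comp] at this
    exact this
  rw [lieBracket_left_right, map_zero, extChartAt_to_inv, inv_one, adE_one, hinv] at h
  simp only [ContinuousLinearMap.id_apply, fderiv_fun_const, Pi.zero_apply, zero_apply,
    sub_zero] at h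
  rw [eq_neg_iff_add_eq_zero, add_comm, h, ← dE_eq_fderiv,
    dE_comp (g := fun g : G => adE E g⁻¹ x) (y := 1) (extChartAt_to_inv _)
      ((contMDiff_adE_inv_apply x).mdifferentiableAt (by simp))
      (mdifferentiableAt_chart_symm hmem), dE_chart_symm_self]
  rfl

/-- Reduces to the identity by Ad_{h⁻¹}x = Ad_{(g⁻¹h)⁻¹}(Ad_{g⁻¹}x). -/
theorem dE_adE_inv_apply (g : G) (w x : E) :
    dE E (fun g : G => adE E g⁻¹ x) g w = -lieE E G (thE E g w) (adE E g⁻¹ x) := by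
  rw [← dE_adE_inv_apply_one, ← ContinuousLinearMap.comp_apply, thE,
    ← dE_comp (f := fun h : G => g⁻¹ * h) (inv_mul_cancel g)
      ((contMDiff_adE_inv_apply _).mdifferentiableAt (by simp)) (mdiff_mul_left g⁻¹ g)]
  congr 2
  ext h
  rw [← ContinuousLinearMap.comp_apply, ← adE_mul]
  simp

/-- The derivative of `Ad_{g⁻¹}` in a chart. -/
theorem hasFDerivAt_adE_inv_chart (x₀ : G) {y : E} (hy : y ∈ (extChartAt 𝓘(ℝ, E) x₀).target)
    (x : E) :
    HasFDerivAt (fun y => adE E ((extChartAt 𝓘(ℝ, E) x₀).symm y)⁻¹ x)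
      (-((lieE E G).flip (adE E ((extChartAt 𝓘(ℝ, E) x₀).symm y)⁻¹ x)).comp (chartTheta x₀ y)) y := by
  have hd : ContDiffAt ℝ ∞ (fun y => adE E ((extChartAt 𝓘(ℝ, E) x₀).symm y)⁻¹ x) y :=
    contDiffAt_chart_of_contMDiffAt (f := fun g : G => adE E g⁻¹ x) hy
      (contMDiff_adE_inv_apply x).contMDiffAt
  convert (hd.differentiableAt (by simp)).hasFDerivAt using 1
  rw [← dE_eq_fderiv, dE_comp (g := fun g : G => adE E g⁻¹ x) rfl
      ((contMDiff_adE_inv_apply x).mdifferentiableAt (by simp))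
      (mdifferentiableAt_chart_symm hy)]
  ext w
  rw [ContinuousLinearMap.comp_apply, dE_adE_inv_apply]
  rfl

end AdjointDerivative

/-! ### Invariance of the bracket and of B; the Cartan three-form -/

section InvariantForm

variable {E : Type*} [NormedAddCommGroup E] [NormedSpace ℝ E]
  {G : Type*} [TopologicalSpace G] [ChartedSpace E G] [Group G]

theorem lfE_one : lfE E (1 : G) = ContinuousLinearMap.id ℝ E := by
  rw [lfE]; simpa using dE_id (1 : G)

variable [LieGroup 𝓘(ℝ, E) ∞ G]

theorem dE_conj_lfE (g h : G) (x : E) :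
    dE E (fun k : G => g * k * g⁻¹) h (lfE E h x) = lfE E (g * h * g⁻¹) (adE E g x) := by
  rw [lfE, lfE, adE, ← ContinuousLinearMap.comp_apply, ← ContinuousLinearMap.comp_apply,
    ← dE_comp (mul_one h) (mdiff_conj g h) (mdiff_mul_left h 1),
    ← dE_comp (by simp) (mdiff_mul_left (g * h * g⁻¹) 1) (mdiff_conj g 1)]
  congr 2
  ext k
  group

theorem inverse_dE_conj (g h : G) : (dE E (fun k : G => g * k * g⁻¹) h).inverse =
    dE E (fun k : G => g⁻¹ * k * g⁻¹⁻¹) (g * h * g⁻¹) := by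
  apply inverse_of_comp_eq_id
  · rw [← dE_comp (by group) (mdiff_conj g h) (mdiff_conj g⁻¹ _), ← dE_id (M := G)]
    congr 2
    ext k
    group
  · rw [← dE_comp (f := fun k : G => g * k * g⁻¹) (y := g * h * g⁻¹) rfl (mdiff_conj g⁻¹ _) (mdiff_conj g h), ← dE_id (M := G)]
    congr 2
    ext k
    group

/-- Conjugation by g pulls left-invariant fields back to left-invariant fields; with naturality of
the Lie bracket this makes Ad_g an automorphism of 𝔤. -/
theorem mpullback_conj (g : G) (x : E) :
    VectorField.mpullback 𝓘(ℝ, E) 𝓘(ℝ, E) (fun k : G => g * k * g⁻¹)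
      (mulInvariantVectorField (I := 𝓘(ℝ, E)) (G := G) (adE E g x)) =
      mulInvariantVectorField (I := 𝓘(ℝ, E)) (G := G) x := by
  ext h
  change (dE E (fun k : G => g * k * g⁻¹) h).inverse (lfE E (g * h * g⁻¹) (adE E g x)) = lfE E h x
  rw [← dE_conj_lfE, inverse_dE_conj, ← ContinuousLinearMap.comp_apply,
    ← dE_comp (f := fun k : G => g * k * g⁻¹) (y := g * h * g⁻¹) rfl (mdiff_conj g⁻¹ _) (mdiff_conj g h)]
  have : (fun z : G => g⁻¹ * (g * z * g⁻¹) * g⁻¹⁻¹) = fun z => z := by ext; group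
  rw [this, dE_id]
  rfl

variable [FiniteDimensional ℝ E] [CompleteSpace E]

/-- The adjoint action preserves the bracket. -/
theorem adE_lieE (g : G) (x y : E) :
    adE E g (lieE E G x y) = lieE E G (adE E g x) (adE E g y) := by
  have h1 := VectorField.mpullback_mlieBracket (I := 𝓘(ℝ, E)) (I' := 𝓘(ℝ, E))
    (f := fun k : G => g * k * g⁻¹) (x₀ := 1) (n := ∞)
    (mdifferentiableAt_mulInvariantVectorField (I := 𝓘(ℝ, E)) (G := G) (adE E g x))
    (mdifferentiableAt_mulInvariantVectorField (I := 𝓘(ℝ, E)) (G := G) (adE E g y))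
    (contMDiff_conj g).contMDiffAt (by simpa using (inferInstance : ENat.LEInfty 2).out)
  have h0 := mulInvariantVector_mlieBracket (I := 𝓘(ℝ, E)) (G := G) (adE E g x) (adE E g y)
  have hz : lieE E G (adE E g x) (adE E g y) =
      adE E g (adE E g⁻¹ (lieE E G (adE E g x) (adE E g y))) := (adE_adE_inv _ _).symm
  have h2 : VectorField.mpullback 𝓘(ℝ, E) 𝓘(ℝ, E) (fun k : G => g * k * g⁻¹)
      (VectorField.mlieBracket 𝓘(ℝ, E)
        (mulInvariantVectorField (I := 𝓘(ℝ, E)) (G := G) (adE E g x))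
        (mulInvariantVectorField (I := 𝓘(ℝ, E)) (G := G) (adE E g y))) 1 =
      adE E g⁻¹ (lieE E G (adE E g x) (adE E g y)) := by
    refine (congrFun (congrArg (VectorField.mpullback 𝓘(ℝ, E) 𝓘(ℝ, E)
      (fun k : G => g * k * g⁻¹)) h0) 1).symm.trans ?_
    refine (congrFun (congrArg (fun v : E => VectorField.mpullback 𝓘(ℝ, E) 𝓘(ℝ, E)
      (fun k : G => g * k * g⁻¹) (mulInvariantVectorField (I := 𝓘(ℝ, E)) (G := G) v)) hz) 1).trans ?_
    refine (congrFun (mpullback_conj g (adE E g⁻¹ (lieE E G (adE E g x) (adE E g y)))) 1).trans ?_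
    change lfE E (1 : G) _ = _
    rw [lfE_one]
    rfl
  have h3 : lieE E G x y = adE E g⁻¹ (lieE E G (adE E g x) (adE E g y)) := by
    refine Eq.trans ?_ (h1.symm.trans h2)
    rw [mpullback_conj, mpullback_conj]
    rfl
  rw [h3, adE_adE_inv]

/-- The bilinear form `B`, as a continuous bilinear form on the model space. -/
def bE (B : LinearMap.BilinForm ℝ (LieAlg E G)) : E →L[ℝ] E →L[ℝ] ℝ :=
  LinearMap.toContinuousBilinearMap (𝕜 := ℝ) (E := E) (F := E) (G := ℝ) B

variable {B : LinearMap.BilinForm ℝ (LieAlg E G)}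

theorem bE_symm (hB : IsBiinvariantMetric B) (x y : E) : bE B x y = bE B y x := hB.symm x y

theorem bE_adE (hB : IsBiinvariantMetric B) (g : G) (x y : E) :
    bE B (adE E g x) (adE E g y) = bE B x y := hB.invariant g x y

theorem bE_adE_left (hB : IsBiinvariantMetric B) (g : G) (x y : E) :
    bE B (adE E g x) y = bE B x (adE E g⁻¹ y) := by
  rw [← bE_adE hB g x, adE_adE_inv]

/-- A bi-invariant metric is `ad`-invariant. -/
theorem bE_lieE (hB : IsBiinvariantMetric B) (x y z : E) :
    bE B (lieE E G x y) z = -bE B y (lieE E G x z) := by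
  have hy := mem_extChartAt_target (I := 𝓘(ℝ, E)) (1 : G)
  have h1 := ((hasFDerivAt_const (bE B) _).clm_apply (hasFDerivAt_adE_inv_chart (1 : G) hy y)).clm_apply
    (hasFDerivAt_adE_inv_chart (1 : G) hy z)
  -- B(Ad_{g⁻¹}y, Ad_{g⁻¹}z) is constant in g; its derivative at 1 along x is -B([x, y], z) - B(y,
  -- [x, z]).
  have h2 : (fun w => bE B (adE E ((extChartAt 𝓘(ℝ, E) (1 : G)).symm w)⁻¹ y)
      (adE E ((extChartAt 𝓘(ℝ, E) (1 : G)).symm w)⁻¹ z)) = fun _ => bE B y z := by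
    ext w
    rw [bE_adE hB]
  rw [h2] at h1
  have h3 := DFunLike.congr_fun (h1.unique (hasFDerivAt_const _ _)) x
  rw [chartTheta_self, extChartAt_to_inv, inv_one, adE_one, thE_one] at h3
  simp at h3
  linarith

theorem B_lie (hB : IsBiinvariantMetric B) (x y z : LieAlg E G) : B ⁅x, y⁆ z = -B y ⁅x, z⁆ :=
  bE_lieE hB x y z

theorem lieE_skew (x y : E) : lieE E G x y = -lieE E G y x :=
  (lie_skew (L := LieAlg E G) x y).symm

theorem lieE_jacobi (x y z : E) :
    lieE E G x (lieE E G y z) = lieE E G (lieE E G x y) z + lieE E G y (lieE E G x z) :=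
  leibniz_lie (L₁ := LieAlg E G) (L₂ := LieAlg E G) (M := LieAlg E G) x y z

/-- By ad-invariance (x, y, z) ↦ B(x, [y, z]) is already alternating, so the signed sum over
permutations multiplies it by 3! and cancels the factor 1/6. -/
theorem cartanThreeForm_apply (hB : IsBiinvariantMetric B) (g : G) (m : Fin 3 → E) :
    cartanThreeForm B g m =
      bE B (lieE E G (thE E g (m 0)) (thE E g (m 1))) (thE E g (m 2)) := by
  let A : LieAlg E G [⋀^Fin 3]→ₗ[ℝ] ℝ :=
    { (trilinearBracketForm B).toMultilinearMap with
      map_eq_zero_of_eq' := by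
        intro v i j hv hij
        change B (v 0) ⁅v 1, v 2⁆ = 0
        have key : B (v 0) ⁅v 1, v 2⁆ = B ⁅v 0, v 1⁆ (v 2) := by
          rw [← lie_skew (v 0) (v 1), map_neg, LinearMap.neg_apply, B_lie hB, neg_neg]
        fin_cases i <;> fin_cases j <;> simp at hv hij
        · rw [key, hv, lie_self, map_zero, LinearMap.zero_apply]
        · rw [hv, hB.symm, ← lie_skew, map_neg, LinearMap.neg_apply, B_lie hB, lie_self]
          simp
        · rw [key, hv, lie_self, map_zero, LinearMap.zero_apply]
        · rw [hv, lie_self, map_zero]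
        · rw [← hv, hB.symm, ← lie_skew, map_neg, LinearMap.neg_apply, B_lie hB, lie_self]
          simp
        · rw [hv, lie_self, map_zero] }
  have hA (v : Fin 3 → LieAlg E G) : A v = B ⁅v 0, v 1⁆ (v 2) := by
    change B (v 0) ⁅v 1, v 2⁆ = B ⁅v 0, v 1⁆ (v 2)
    rw [← lie_skew (v 0) (v 1), map_neg, LinearMap.neg_apply, B_lie hB, neg_neg]
  have h1 (v : Fin 3 → LieAlg E G) :
      ContinuousMultilinearMap.alternatization (trilinearBracketForm B) v = 6 * A v := by
    rw [ContinuousMultilinearMap.alternatization_apply_apply]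
    have h2 (σ : Equiv.Perm (Fin 3)) :
        Equiv.Perm.sign σ • trilinearBracketForm B (v ∘ σ) = A v := by
      have : trilinearBracketForm B (v ∘ σ) = A (v ∘ σ) := rfl
      rw [this, AlternatingMap.map_perm, smul_smul]
      simp
    simp only [h2]
    simp [Fintype.card_perm]
    norm_num [Nat.factorial]
  have h3 : cartanThreeForm B g m = (1 / 6 : ℝ) *
    ContinuousMultilinearMap.alternatization (trilinearBracketForm B) (fun i => thetaL g (m i)) := rfl
  rw [h3, h1, hA]
  change (1 / 6 : ℝ) * (6 * bE B (lieE E G (thE E g (m 0)) (thE E g (m 1))) (thE E g (m 2))) = _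
  ring

end InvariantForm

/-! ### Bracket, Lie derivative and contraction in left components -/

section LeftTrivialization

variable {E : Type*} [NormedAddCommGroup E] [NormedSpace ℝ E] [FiniteDimensional ℝ E]
  [CompleteSpace E]
  {G : Type*} [TopologicalSpace G] [ChartedSpace E G] [Group G] [LieGroup 𝓘(ℝ, E) ∞ G]
  {B : LinearMap.BilinForm ℝ (LieAlg E G)}

/-- The left-trivialized vector field with components `U`. -/
def leftVec (U : G → E) (g : G) : TangentSpace 𝓘(ℝ, E) g := leftField g (U g)

/-- The left-trivialized one-form `B(θ^L, Q)`. -/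
def leftForm (B : LinearMap.BilinForm ℝ (LieAlg E G)) (Q : G → E) (g : G) :
    TangentSpace 𝓘(ℝ, E) g →L[ℝ] ℝ :=
  ((bE B).flip (Q g)).comp (thE E g)

theorem chartThetaInv_self (x₀ : G) :
    chartThetaInv x₀ (extChartAt 𝓘(ℝ, E) x₀ x₀) = lfE E x₀ := by
  rw [chartThetaInv, extChartAt_to_inv, dE_chart_self]
  rfl

/-- A function on `G`, written in the chart at `x₀`. -/
def inChartAt {F : Type*} (x₀ : G) (U : G → F) (y : E) : F := U ((extChartAt 𝓘(ℝ, E) x₀).symm y)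

theorem inChartAt_self {F : Type*} (x₀ : G) (U : G → F) :
    inChartAt x₀ U (extChartAt 𝓘(ℝ, E) x₀ x₀) = U x₀ := by
  rw [inChartAt, extChartAt_to_inv]

theorem mpullback_leftVec (x₀ : G) (U : G → E) :
    VectorField.mpullback 𝓘(ℝ, E) 𝓘(ℝ, E) (extChartAt 𝓘(ℝ, E) x₀).symm (leftVec U)
      =ᶠ[nhds (extChartAt 𝓘(ℝ, E) x₀ x₀)] fun y => chartThetaInv x₀ y (inChartAt x₀ U y) := by
  filter_upwards [(isOpen_extChartAt_target x₀).mem_nhds (mem_extChartAt_target x₀)] with z hz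
  refine (mpullback_chart_symm x₀ hz (leftVec U)).trans ?_
  exact congrArg (chartThetaInv x₀ z) (thE_lfE _ _)

theorem mlieBracket_eq_lieBracket_chart {V W : ∀ x : G, TangentSpace 𝓘(ℝ, E) x} {X Y : E → E}
    (x₀ : G)
    (hX : VectorField.mpullback 𝓘(ℝ, E) 𝓘(ℝ, E) (extChartAt 𝓘(ℝ, E) x₀).symm V
      =ᶠ[nhds (extChartAt 𝓘(ℝ, E) x₀ x₀)] X)
    (hY : VectorField.mpullback 𝓘(ℝ, E) 𝓘(ℝ, E) (extChartAt 𝓘(ℝ, E) x₀).symm W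
      =ᶠ[nhds (extChartAt 𝓘(ℝ, E) x₀ x₀)] Y) :
    VectorField.mlieBracket 𝓘(ℝ, E) V W x₀ =
      VectorField.lieBracket ℝ X Y (extChartAt 𝓘(ℝ, E) x₀ x₀) := by
  -- The definition of the bracket refers to sets that are the whole model space because there is no
  -- boundary; they are kept as variables until they can be replaced.
  have key (S : Set E) (hS : S = Set.univ) (A C : E → E)
      (hA : A = VectorField.mpullbackWithin 𝓘(ℝ, E) 𝓘(ℝ, E) (extChartAt 𝓘(ℝ, E) x₀).symm V S)
      (hC : C = VectorField.mpullbackWithin 𝓘(ℝ, E) 𝓘(ℝ, E) (extChartAt 𝓘(ℝ, E) x₀).symm W S)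
      (T : Set E) (hT : T = Set.univ) :
      (dE E (extChartAt 𝓘(ℝ, E) x₀) x₀).inverse
        (VectorField.lieBracketWithin ℝ A C T (extChartAt 𝓘(ℝ, E) x₀ x₀)) =
      VectorField.lieBracket ℝ X Y (extChartAt 𝓘(ℝ, E) x₀ x₀) := by
    subst hS hT
    rw [dE_chart_self, ContinuousLinearMap.inverse_id, VectorField.lieBracketWithin_univ]
    have hA' : A =ᶠ[nhds (extChartAt 𝓘(ℝ, E) x₀ x₀)] X := by
      rw [hA]; exact (VectorField.mpullbackWithin_univ (I := 𝓘(ℝ, E)) (I' := 𝓘(ℝ, E))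
        (f := (extChartAt 𝓘(ℝ, E) x₀).symm) (V := V)).eventuallyEq.trans hX
    have hC' : C =ᶠ[nhds (extChartAt 𝓘(ℝ, E) x₀ x₀)] Y := by
      rw [hC]; exact (VectorField.mpullbackWithin_univ (I := 𝓘(ℝ, E)) (I' := 𝓘(ℝ, E))
        (f := (extChartAt 𝓘(ℝ, E) x₀).symm) (V := W)).eventuallyEq.trans hY
    exact hA'.lieBracket_vectorField_eq hC'
  rw [← VectorField.mlieBracketWithin_univ, VectorField.mlieBracketWithin_apply]
  exact key (Set.range 𝓘(ℝ, E)) (by simp) _ _ rfl rfl _ (by simp)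

theorem mlieBracket_leftVec (x₀ : G) {U W : G → E}
    (hU : DifferentiableAt ℝ (inChartAt x₀ U) (extChartAt 𝓘(ℝ, E) x₀ x₀))
    (hW : DifferentiableAt ℝ (inChartAt x₀ W) (extChartAt 𝓘(ℝ, E) x₀ x₀)) :
    VectorField.mlieBracket 𝓘(ℝ, E) (leftVec U) (leftVec W) x₀ =
      lfE E x₀ (lieE E G (U x₀) (W x₀)
        + fderiv ℝ (inChartAt x₀ W) (extChartAt 𝓘(ℝ, E) x₀ x₀) (lfE E x₀ (U x₀))
        - fderiv ℝ (inChartAt x₀ U) (extChartAt 𝓘(ℝ, E) x₀ x₀) (lfE E x₀ (W x₀))) := by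
  have h1 := mlieBracket_eq_lieBracket_chart x₀ (mpullback_leftVec x₀ U) (mpullback_leftVec x₀ W)
  have h2 := chartTheta_lieBracket x₀ (mem_extChartAt_target x₀) hU hW
  rw [chartThetaInv_self, inChartAt_self, inChartAt_self, chartTheta_self] at h2
  rw [← h2, lfE_thE]
  exact h1

/-- In the chart the one-form is B(Θ·, Q). The derivatives of Θ coming from the form and from the
field combine, by Maurer-Cartan, to -[U, θ^L(v)]. -/
theorem lieDerivOneForm_left (x₀ : G) {U Q : G → E}
    (hU : DifferentiableAt ℝ (inChartAt x₀ U) (extChartAt 𝓘(ℝ, E) x₀ x₀))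
    (hQ : DifferentiableAt ℝ (inChartAt x₀ Q) (extChartAt 𝓘(ℝ, E) x₀ x₀)) (v : E) :
    lieDerivOneForm (leftVec U) (leftForm B Q) x₀ v =
      bE B (thE E x₀ v)
        (fderiv ℝ (inChartAt x₀ Q) (extChartAt 𝓘(ℝ, E) x₀ x₀) (lfE E x₀ (U x₀)))
      + bE B (fderiv ℝ (inChartAt x₀ U) (extChartAt 𝓘(ℝ, E) x₀ x₀) v
        - lieE E G (U x₀) (thE E x₀ v)) (Q x₀) := by
  have hmem := mem_extChartAt_target (I := 𝓘(ℝ, E)) x₀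
  have key (X : E → E) (hX : X =ᶠ[nhds (extChartAt 𝓘(ℝ, E) x₀ x₀)]
        fun y => chartThetaInv x₀ y (inChartAt x₀ U y)) :
      fderiv ℝ (fun y => ((bE B).flip (inChartAt x₀ Q y)).comp (chartTheta x₀ y))
        (extChartAt 𝓘(ℝ, E) x₀ x₀) (X (extChartAt 𝓘(ℝ, E) x₀ x₀))
        (dE E (extChartAt 𝓘(ℝ, E) x₀) x₀ v)
      + bE B (chartTheta x₀ (extChartAt 𝓘(ℝ, E) x₀ x₀)
          (fderiv ℝ X (extChartAt 𝓘(ℝ, E) x₀ x₀) (dE E (extChartAt 𝓘(ℝ, E) x₀) x₀ v)))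
        (inChartAt x₀ Q (extChartAt 𝓘(ℝ, E) x₀ x₀)) =
      bE B (thE E x₀ v)
        (fderiv ℝ (inChartAt x₀ Q) (extChartAt 𝓘(ℝ, E) x₀ x₀) (lfE E x₀ (U x₀)))
      + bE B (fderiv ℝ (inChartAt x₀ U) (extChartAt 𝓘(ℝ, E) x₀ x₀) v
        - lieE E G (U x₀) (thE E x₀ v)) (Q x₀) := by
    have hη : HasFDerivAt (fun y => ((bE B).flip (inChartAt x₀ Q y)).comp (chartTheta x₀ y))
        _ (extChartAt 𝓘(ℝ, E) x₀ x₀) :=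
      (((bE B).flip.hasFDerivAt.comp (extChartAt 𝓘(ℝ, E) x₀ x₀) hQ.hasFDerivAt).clm_comp
        (hasFDerivAt_chartTheta x₀ hmem))
    have hmc := maurerCartan x₀ hmem (lfE E x₀ (U x₀)) v
    rw [chartTheta_self, thE_lfE] at hmc
    have h3 := chartTheta_fderiv_inv_apply x₀ hmem hU v
    rw [chartThetaInv_self, inChartAt_self] at h3
    have hX0 : X (extChartAt 𝓘(ℝ, E) x₀ x₀) = lfE E x₀ (U x₀) := by
      refine hX.self_of_nhds.trans ?_
      beta_reduce
      rw [chartThetaInv_self, inChartAt_self]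
    rw [hX.fderiv_eq, hX0, dE_chart_self, ContinuousLinearMap.id_apply, h3, hη.fderiv,
      inChartAt_self, sub_eq_add_neg _ (lieE E G _ _), ← hmc]
    simp only [add_apply, ContinuousLinearMap.comp_apply, Function.comp_apply,
      ContinuousLinearMap.compL_apply, ContinuousLinearMap.flip_apply, map_add, map_sub,
      sub_apply, chartTheta_self, inChartAt_self]
    ring
  exact key _ (mpullback_leftVec x₀ U)

theorem dFun_apply (x₀ : G) {f : G → ℝ}
    (hf : MDifferentiableAt 𝓘(ℝ, E) 𝓘(ℝ, ℝ) f x₀) (v : E) :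
    dFun (E := E) f x₀ v = fderiv ℝ (inChartAt x₀ f) (extChartAt 𝓘(ℝ, E) x₀ x₀) v := by
  rw [dFun, hf.mfderiv]
  simp only [writtenInExtChartAt, modelWithCornersSelf_coe, Set.range_id, fderivWithin_univ]
  rfl

theorem contractTwo_cartanThreeForm (hB : IsBiinvariantMetric B) (g : G) (u v w : E) :
    contractTwo (cartanThreeForm B) g u v w =
      bE B (lieE E G (thE E g u) (thE E g v)) (thE E g w) := by
  have h := cartanThreeForm_apply hB g (Function.update ![u, v, 0] 2 w)
  exact h

end LeftTrivialization

/-! ### The Courant bracket in the left trivialization -/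

section CourantBracket

variable {E : Type*} [NormedAddCommGroup E] [NormedSpace ℝ E] [FiniteDimensional ℝ E]
  [CompleteSpace E]
  {G : Type*} [TopologicalSpace G] [ChartedSpace E G] [Group G] [LieGroup 𝓘(ℝ, E) ∞ G]
  {B : LinearMap.BilinForm ℝ (LieAlg E G)}

/-- The derivative at `x₀` of a function on `G`, computed in the chart at `x₀`. -/
def chartDeriv {F : Type*} [NormedAddCommGroup F] [NormedSpace ℝ F] (x₀ : G) (U : G → F) :
    E →L[ℝ] F :=
  fderiv ℝ (inChartAt x₀ U) (extChartAt 𝓘(ℝ, E) x₀ x₀)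

variable {F : Type*} [NormedAddCommGroup F] [NormedSpace ℝ F]

theorem hasFDerivAt_inChartAt {x₀ : G} {U : G → F} (hU : ContMDiff 𝓘(ℝ, E) 𝓘(ℝ, F) ∞ U) :
    HasFDerivAt (inChartAt (E := E) x₀ U) (chartDeriv x₀ U) (extChartAt 𝓘(ℝ, E) x₀ x₀) :=
  ((contDiffAt_chart_of_contMDiffAt (mem_extChartAt_target x₀)
    (hU _)).differentiableAt (by simp)).hasFDerivAt

/-- The Courant bracket in the left trivialization. -/
theorem courant_left (hB : IsBiinvariantMetric B) (x₀ : G) {U W P Q : G → E}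
    (hU : ContMDiff 𝓘(ℝ, E) 𝓘(ℝ, E) ∞ U) (hW : ContMDiff 𝓘(ℝ, E) 𝓘(ℝ, E) ∞ W)
    (hP : ContMDiff 𝓘(ℝ, E) 𝓘(ℝ, E) ∞ P) (hQ : ContMDiff 𝓘(ℝ, E) 𝓘(ℝ, E) ∞ Q) (v : E) :
    (courant (cartanThreeForm B) (fun g => (leftVec U g, leftForm B P g))
      (fun g => (leftVec W g, leftForm B Q g)) x₀).2 v =
    bE B (thE E x₀ v) (chartDeriv x₀ Q (lfE E x₀ (U x₀)))
      + bE B (chartDeriv x₀ U v - lieE E G (U x₀) (thE E x₀ v)) (Q x₀)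
    - (bE B (thE E x₀ v) (chartDeriv x₀ P (lfE E x₀ (W x₀)))
      + bE B (chartDeriv x₀ W v - lieE E G (W x₀) (thE E x₀ v)) (P x₀))
    - (1 / 2) * (bE B (chartDeriv x₀ U v) (Q x₀) + bE B (U x₀) (chartDeriv x₀ Q v)
      - (bE B (chartDeriv x₀ W v) (P x₀) + bE B (W x₀) (chartDeriv x₀ P v)))
    - bE B (lieE E G (U x₀) (W x₀)) (thE E x₀ v) := by
  have h1 := lieDerivOneForm_left (B := B) x₀ (hasFDerivAt_inChartAt (x₀ := x₀) hU).differentiableAt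
    (hasFDerivAt_inChartAt (x₀ := x₀) hQ).differentiableAt v
  have h2 := lieDerivOneForm_left (B := B) x₀ (hasFDerivAt_inChartAt (x₀ := x₀) hW).differentiableAt
    (hasFDerivAt_inChartAt (x₀ := x₀) hP).differentiableAt v
  have hfun : (fun y : G => leftForm B Q y (leftVec U y) - leftForm B P y (leftVec W y)) =
      fun y => bE B (U y) (Q y) - bE B (W y) (P y) := by
    funext y
    exact congrArg₂ (fun s t => bE B s (Q y) - bE B t (P y)) (thE_lfE y (U y)) (thE_lfE y (W y))
  have hsm : ContMDiff 𝓘(ℝ, E) 𝓘(ℝ, ℝ) ∞ (fun y => bE B (U y) (Q y) - bE B (W y) (P y)) :=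
    ((contMDiff_const.clm_apply hU).clm_apply hQ).sub ((contMDiff_const.clm_apply hW).clm_apply hP)
  have h3 : dFun (E := E)
      (fun y : G => leftForm B Q y (leftVec U y) - leftForm B P y (leftVec W y)) x₀ v =
      bE B (chartDeriv x₀ U v) (Q x₀) + bE B (U x₀) (chartDeriv x₀ Q v)
      - (bE B (chartDeriv x₀ W v) (P x₀) + bE B (W x₀) (chartDeriv x₀ P v)) := by
    rw [hfun, dFun_apply x₀ (hsm.mdifferentiableAt (by simp))]
    have h := (((hasFDerivAt_const (bE B) _).clm_apply (hasFDerivAt_inChartAt (x₀ := x₀) hU)).clm_apply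
      (hasFDerivAt_inChartAt (x₀ := x₀) hQ)).sub
      (((hasFDerivAt_const (bE B) _).clm_apply (hasFDerivAt_inChartAt (x₀ := x₀) hW)).clm_apply
      (hasFDerivAt_inChartAt (x₀ := x₀) hP))
    refine (DFunLike.congr_fun h.fderiv v).trans ?_
    rw [inChartAt_self, inChartAt_self, inChartAt_self, inChartAt_self]
    simp
    ring
  have h4 := contractTwo_cartanThreeForm hB x₀ (lfE E x₀ (U x₀)) (lfE E x₀ (W x₀)) v
  rw [thE_lfE, thE_lfE] at h4
  have key (a b c d a' b' c' d' : ℝ) (ha : a = a') (hb : b = b') (hc : c = c') (hd : d = d') :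
      a - b - (1 / 2 : ℝ) * c - d = a' - b' - (1 / 2) * c' - d' := by
    rw [ha, hb, hc, hd]
  exact key _ _ _ _ _ _ _ _ h1 h2 h3 h4

theorem contMDiff_adE_inv_clm_apply {U : G → E} (hU : ContMDiff 𝓘(ℝ, E) 𝓘(ℝ, E) ∞ U) :
    ContMDiff 𝓘(ℝ, E) 𝓘(ℝ, E) ∞ (fun g => adE E g⁻¹ (U g)) :=
  contMDiff_adE_inv.clm_apply hU

/-- The product rule, with the derivative of Ad_{g⁻¹} supplying the bracket term. -/
theorem chartDeriv_adE_inv {x₀ : G} {U : G → E} (hU : ContMDiff 𝓘(ℝ, E) 𝓘(ℝ, E) ∞ U) (v : E) :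
    chartDeriv x₀ (fun g => adE E g⁻¹ (U g)) v =
      adE E x₀⁻¹ (chartDeriv x₀ U v) - lieE E G (thE E x₀ v) (adE E x₀⁻¹ (U x₀)) := by
  have hA := hasFDerivAt_inChartAt (x₀ := x₀) (contMDiff_adE_inv (E := E) (G := G))
  have h1 := (hA.clm_apply (hasFDerivAt_inChartAt (x₀ := x₀) hU)).fderiv
  have h2 (x : E) : chartDeriv x₀ (fun g => adE E g⁻¹) v x =
      - lieE E G (thE E x₀ v) (adE E x₀⁻¹ x) := by
    have h3 := hasFDerivAt_adE_inv_chart x₀ (mem_extChartAt_target x₀) x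
    have h4 := hA.clm_apply (hasFDerivAt_const x (extChartAt 𝓘(ℝ, E) x₀ x₀))
    have h5 := DFunLike.congr_fun (h4.unique h3) v
    rw [chartTheta_self, extChartAt_to_inv] at h5
    simpa using h5
  refine (DFunLike.congr_fun h1 v).trans ?_
  rw [inChartAt_self, inChartAt_self]
  simp [h2]
  abel

theorem chartDeriv_add {x₀ : G} {U W : G → F} (hU : ContMDiff 𝓘(ℝ, E) 𝓘(ℝ, F) ∞ U)
    (hW : ContMDiff 𝓘(ℝ, E) 𝓘(ℝ, F) ∞ W) :
    chartDeriv (E := E) x₀ (fun g => U g + W g) = chartDeriv x₀ U + chartDeriv x₀ W :=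
  ((hasFDerivAt_inChartAt hU).add (hasFDerivAt_inChartAt hW)).fderiv

theorem chartDeriv_sub {x₀ : G} {U W : G → F} (hU : ContMDiff 𝓘(ℝ, E) 𝓘(ℝ, F) ∞ U)
    (hW : ContMDiff 𝓘(ℝ, E) 𝓘(ℝ, F) ∞ W) :
    chartDeriv (E := E) x₀ (fun g => U g - W g) = chartDeriv x₀ U - chartDeriv x₀ W :=
  ((hasFDerivAt_inChartAt hU).sub (hasFDerivAt_inChartAt hW)).fderiv

end CourantBracket

/-! ### Courant brackets of sections s(a) -/

section CourantSMap

variable {E : Type*} [NormedAddCommGroup E] [NormedSpace ℝ E] [FiniteDimensional ℝ E]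
  [CompleteSpace E]
  {G : Type*} [TopologicalSpace G] [ChartedSpace E G] [Group G] [LieGroup 𝓘(ℝ, E) ∞ G]
  {B : LinearMap.BilinForm ℝ (LieAlg E G)}

/-- `sMap`, on the model space. -/
def sE (B : LinearMap.BilinForm ℝ (LieAlg E G)) (g : G) : E × E →ₗ[ℝ] E × (E →L[ℝ] ℝ) := sMap B g

theorem sE_snd_apply (hB : IsBiinvariantMetric B) (g : G) (a : E × E) (v : E) :
    (sE B g a).2 v = bE B (thE E g v) (a.1 + adE E g⁻¹ a.2) := by
  have h : (sE B g a).2 v = bE B (thE E g v) a.1 + bE B (trE E g v) a.2 := rfl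
  rw [h, trE_eq, bE_adE_left hB, map_add]

theorem sE_fst (g : G) (a : E × E) :
    (sE B g a).1 = lfE E g (a.1 - adE E g⁻¹ a.2) := by
  have h : (sE B g a).1 = lfE E g a.1 - rfE E g a.2 := rfl
  rw [h, rfE_eq, ← map_sub]

/-- Records the left components of s(a₁, a₂): a₁ - Ad_{g⁻¹}a₂ for the vector and a₁ + Ad_{g⁻¹}a₂ for
the form. -/
theorem sE_eq_left (hB : IsBiinvariantMetric B) (a : G → E × E) :
    (fun g => sE B g (a g)) = fun g => (leftVec (fun g => (a g).1 - adE E g⁻¹ (a g).2) g,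
      leftForm B (fun g => (a g).1 + adE E g⁻¹ (a g).2) g) := by
  funext g
  refine Prod.ext (sE_fst g (a g)) ?_
  exact ContinuousLinearMap.ext fun v => sE_snd_apply hB g (a g) v

variable {F : Type*} [NormedAddCommGroup F] [NormedSpace ℝ F] {F' : Type*} [NormedAddCommGroup F']
  [NormedSpace ℝ F']

theorem chartDeriv_clm_comp (x₀ : G) (L : F →L[ℝ] F') {a : G → F}
    (ha : ContMDiff 𝓘(ℝ, E) 𝓘(ℝ, F) ∞ a) :
    chartDeriv (E := E) x₀ (fun g => L (a g)) = L.comp (chartDeriv x₀ a) :=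
  (L.hasFDerivAt.comp _ (hasFDerivAt_inChartAt ha)).fderiv

theorem chartDeriv_fst (x₀ : G) {a : G → E × E} (ha : ContMDiff 𝓘(ℝ, E) 𝓘(ℝ, E × E) ∞ a) (v : E) :
    chartDeriv x₀ (fun g => (a g).1) v = (chartDeriv x₀ a v).1 :=
  DFunLike.congr_fun (chartDeriv_clm_comp x₀ (ContinuousLinearMap.fst ℝ E E) ha) v

theorem chartDeriv_snd (x₀ : G) {a : G → E × E} (ha : ContMDiff 𝓘(ℝ, E) 𝓘(ℝ, E × E) ∞ a) (v : E) :
    chartDeriv x₀ (fun g => (a g).2) v = (chartDeriv x₀ a v).2 :=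
  DFunLike.congr_fun (chartDeriv_clm_comp x₀ (ContinuousLinearMap.snd ℝ E E) ha) v

theorem contMDiff_clm_comp (L : F →L[ℝ] F') {a : G → F} (ha : ContMDiff 𝓘(ℝ, E) 𝓘(ℝ, F) ∞ a) :
    ContMDiff 𝓘(ℝ, E) 𝓘(ℝ, F') ∞ (fun g => L (a g)) :=
  L.contMDiff.comp ha

theorem contMDiff_fst_comp {a : G → E × E} (ha : ContMDiff 𝓘(ℝ, E) 𝓘(ℝ, E × E) ∞ a) :
    ContMDiff 𝓘(ℝ, E) 𝓘(ℝ, E) ∞ (fun g => (a g).1) :=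
  contMDiff_clm_comp (ContinuousLinearMap.fst ℝ E E) ha

theorem contMDiff_snd_comp {a : G → E × E} (ha : ContMDiff 𝓘(ℝ, E) 𝓘(ℝ, E × E) ∞ a) :
    ContMDiff 𝓘(ℝ, E) 𝓘(ℝ, E) ∞ (fun g => (a g).2) :=
  contMDiff_clm_comp (ContinuousLinearMap.snd ℝ E E) ha

/-- The bracket of the Lie algebroid `𝔡 × G` of the action of `𝔡` on `G`, for sections with values
`a`, `b` and derivatives `Da`, `Db` at `g`. -/
def algebroidBracket (B : LinearMap.BilinForm ℝ (LieAlg E G)) (g : G) (a b : E × E)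
    (Da Db : E →L[ℝ] E × E) : E × E :=
  (lieE E G a.1 b.1, lieE E G a.2 b.2) + Db (sE B g a).1 - Da (sE B g b).1

/-- The form `doubleForm B`, on the model space. -/
def dbE (B : LinearMap.BilinForm ℝ (LieAlg E G)) : E × E →ₗ[ℝ] E × E →ₗ[ℝ] ℝ := doubleForm B

/-- The one-form measuring the failure of the `C^∞`-linear extension of `s` to be a morphism of
brackets. -/
def bracketDefect (B : LinearMap.BilinForm ℝ (LieAlg E G)) (a b : E × E)
    (Da Db : E →L[ℝ] E × E) : E →L[ℝ] ℝ :=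
  LinearMap.toContinuousLinearMap
    (((dbE B).flip b).comp Da.toLinearMap - (dbE B a).comp Db.toLinearMap)

theorem bracketDefect_apply (a b : E × E) (Da Db : E →L[ℝ] E × E) (v : E) :
    bracketDefect B a b Da Db v = dbE B (Da v) b - dbE B a (Db v) := rfl

theorem dbE_apply (a b : E × E) : dbE B a b = bE B a.1 b.1 - bE B a.2 b.2 := rfl

theorem bE_lieE_left_swap (hB : IsBiinvariantMetric B) (x y z : E) :
    bE B (lieE E G x z) y = bE B (lieE E G y x) z := by
  rw [bE_lieE hB, bE_symm hB, lieE_skew y x, (bE B).map_neg₂]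

/-- For constant a, b this says that s intertwines the bracket of 𝔡 with the Courant bracket; the
twist by H supplies the B([U, W], ·) term that this needs. Variable coefficients add derivatives
along the vector parts, and a one-form reflecting that the skew bracket obeys the Leibniz rule only
up to the pairing. -/
theorem courant_sE (hB : IsBiinvariantMetric B) (x₀ : G) {a b : G → E × E}
    (ha : ContMDiff 𝓘(ℝ, E) 𝓘(ℝ, E × E) ∞ a) (hb : ContMDiff 𝓘(ℝ, E) 𝓘(ℝ, E × E) ∞ b) :
    courant (cartanThreeForm B) (fun g => sE B g (a g)) (fun g => sE B g (b g)) x₀ =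
      sE B x₀ (algebroidBracket B x₀ (a x₀) (b x₀) (chartDeriv x₀ a) (chartDeriv x₀ b))
        + (0, bracketDefect B (a x₀) (b x₀) (chartDeriv x₀ a) (chartDeriv x₀ b)) := by
  have hc := contMDiff_adE_inv_clm_apply (contMDiff_snd_comp ha)
  have hd := contMDiff_adE_inv_clm_apply (contMDiff_snd_comp hb)
  have hU := (contMDiff_fst_comp ha).sub hc
  have hP : ContMDiff 𝓘(ℝ, E) 𝓘(ℝ, E) ∞ fun g => (a g).1 + adE E g⁻¹ (a g).2 :=
    (contMDiff_fst_comp ha).add hc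
  have hW := (contMDiff_fst_comp hb).sub hd
  have hQ : ContMDiff 𝓘(ℝ, E) 𝓘(ℝ, E) ∞ fun g => (b g).1 + adE E g⁻¹ (b g).2 :=
    (contMDiff_fst_comp hb).add hd
  have hcour := congrFun (congrArg₂ (courant (cartanThreeForm B)) (sE_eq_left hB a)
    (sE_eq_left hB b)) x₀
  refine hcour.trans ?_
  refine Prod.ext ?_ (ContinuousLinearMap.ext fun v : E => ?_)
  · refine (mlieBracket_leftVec x₀ (hasFDerivAt_inChartAt (x₀ := x₀) hU).differentiableAt
      (hasFDerivAt_inChartAt (x₀ := x₀) hW).differentiableAt).trans ?_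
    refine Eq.trans ?_ (add_zero (sE B x₀ (algebroidBracket B x₀ (a x₀) (b x₀)
      (chartDeriv x₀ a) (chartDeriv x₀ b))).1).symm
    rw [sE_fst]
    refine congrArg (lfE E x₀) ?_
    change lieE E G _ _ + chartDeriv x₀ _ _ - chartDeriv x₀ _ _ = _
    simp only [algebroidBracket, sE_fst]
    rw [chartDeriv_sub (contMDiff_fst_comp hb) hd, chartDeriv_sub (contMDiff_fst_comp ha) hc]
    simp only [sub_apply, chartDeriv_adE_inv (contMDiff_snd_comp ha),
      chartDeriv_adE_inv (contMDiff_snd_comp hb), thE_lfE, chartDeriv_fst x₀ ha,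
      chartDeriv_snd x₀ ha, chartDeriv_fst x₀ hb, chartDeriv_snd x₀ hb, Prod.fst_add, Prod.snd_add,
      Prod.fst_sub, Prod.snd_sub, map_add, map_sub, adE_lieE]
    -- With c = Ad_{g⁻¹}a₂ and d = Ad_{g⁻¹}b₂, the derivatives of Ad_{g⁻¹} cancel the mixed brackets
    -- in [a₁ - c, b₁ - d] and leave [a₁, b₁] - [c, d].
    rw [lieE_skew (b x₀).1 (adE E x₀⁻¹ (a x₀).2),
      lieE_skew (adE E x₀⁻¹ (b x₀).2) (adE E x₀⁻¹ (a x₀).2)]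
    abel
  · refine (courant_left hB x₀ hU hW hP hQ v).trans ?_
    refine Eq.trans ?_ (congrArg₂ (· + ·) (sE_snd_apply hB x₀ (algebroidBracket B x₀ (a x₀) (b x₀)
      (chartDeriv x₀ a) (chartDeriv x₀ b)) v) (bracketDefect_apply (B := B) (a x₀) (b x₀)
      (chartDeriv x₀ a) (chartDeriv x₀ b) v)).symm
    rw [chartDeriv_sub (contMDiff_fst_comp hb) hd, chartDeriv_sub (contMDiff_fst_comp ha) hc,
      chartDeriv_add (contMDiff_fst_comp hb) hd, chartDeriv_add (contMDiff_fst_comp ha) hc]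
    have hA (x y : E) : bE B x y = bE B (adE E x₀⁻¹ x) (adE E x₀⁻¹ y) := (bE_adE hB _ _ _).symm
    simp only [algebroidBracket, sE_fst, dbE_apply, hA (chartDeriv x₀ a v).2, hA (a x₀).2]
    simp only [add_apply, sub_apply, chartDeriv_adE_inv (contMDiff_snd_comp ha),
      chartDeriv_adE_inv (contMDiff_snd_comp hb), thE_lfE, chartDeriv_fst x₀ ha,
      chartDeriv_snd x₀ ha, chartDeriv_fst x₀ hb, chartDeriv_snd x₀ hb, Prod.fst_add, Prod.snd_add,
      Prod.fst_sub, Prod.snd_sub]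
    generalize (lfE E x₀ ((a x₀).1 - adE E x₀⁻¹ (a x₀).2)) = u
    generalize (lfE E x₀ ((b x₀).1 - adE E x₀⁻¹ (b x₀).2)) = w
    simp only [map_add, map_sub, adE_lieE]
    generalize thE E x₀ v = ζ
    generalize chartDeriv x₀ a v = α
    generalize chartDeriv x₀ b v = β
    generalize chartDeriv x₀ a w = α'
    generalize chartDeriv x₀ b u = β'
    generalize hc' : adE E x₀⁻¹ (a x₀).2 = c
    generalize hd' : adE E x₀⁻¹ (b x₀).2 = d
    generalize (a x₀).1 = a
    generalize (b x₀).1 = b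
    simp only [map_sub, sub_apply]
    generalize adE E x₀⁻¹ α.2 = α₂
    generalize adE E x₀⁻¹ β.2 = β₂
    generalize adE E x₀⁻¹ α'.2 = α'₂
    generalize adE E x₀⁻¹ β'.2 = β'₂
    -- Each trilinear term is brought to the form B([·, ·], ζ) in a fixed order, after which the
    -- identity is linear in such terms.
    have hneg (x y : E) : bE B (lieE E G x y) ζ = -bE B (lieE E G y x) ζ := by
      rw [lieE_skew x y, (bE B).map_neg₂]
    have r1 (x y : E) : bE B ζ (lieE E G x y) = bE B (lieE E G x y) ζ := bE_symm hB _ _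
    have r2 (x z : E) : bE B (lieE E G x ζ) z = bE B (lieE E G z x) ζ := bE_lieE_left_swap hB x z ζ
    have r3 (x z : E) : bE B (lieE E G ζ x) z = bE B (lieE E G x z) ζ := by
      rw [bE_lieE_left_swap hB, bE_lieE_left_swap hB]
    have r4 (x z : E) : bE B z (lieE E G ζ x) = bE B (lieE E G x z) ζ := by rw [bE_symm hB, r3]
    simp only [r1, r2, r3, r4]
    simp only [hneg b a, hneg d c, hneg d a, hneg b c]
    simp only [bE_symm hB b α.1, bE_symm hB b α₂, bE_symm hB d α.1, bE_symm hB d α₂,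
      bE_symm hB a β.1, bE_symm hB a β₂, bE_symm hB c β.1, bE_symm hB c β₂]
    ring

end CourantSMap

/-! ### Smoothness of sections of TG ⊕ T^*G in left components -/

section SmoothSections

variable {E : Type*} [NormedAddCommGroup E] [NormedSpace ℝ E] [FiniteDimensional ℝ E]
  [CompleteSpace E]
  {G : Type*} [TopologicalSpace G] [ChartedSpace E G] [Group G] [LieGroup 𝓘(ℝ, E) ∞ G]
  {B : LinearMap.BilinForm ℝ (LieAlg E G)}

theorem eventually_mem_chart_source (x₀ : G) :
    ∀ᶠ x in nhds x₀, x ∈ (extChartAt 𝓘(ℝ, E) x₀).source :=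
  (isOpen_extChartAt_source x₀).mem_nhds (mem_extChartAt_source x₀)

/-- Over the chart domain the bundle trivialization is the derivative of the chart; the cotangent
version uses the derivative of the inverse chart. -/
theorem contMDiffAt_tangent_iff_chart (V : G → E) (x₀ : G) :
    ContMDiffAt 𝓘(ℝ, E) 𝓘(ℝ, E).tangent ∞ (fun x => (⟨x, V x⟩ : TangentBundle 𝓘(ℝ, E) G)) x₀ ↔
      ContMDiffAt 𝓘(ℝ, E) 𝓘(ℝ, E) ∞ (fun x => dE E (extChartAt 𝓘(ℝ, E) x₀) x (V x)) x₀ := by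
  refine (contMDiffAt_section (F := E) (E := TangentSpace 𝓘(ℝ, E)) (s := V) x₀).trans ?_
  refine Filter.EventuallyEq.contMDiffAt_iff ?_
  filter_upwards [eventually_mem_chart_source (E := E) x₀] with x hx
  have hx' : x ∈ (chartAt E x₀).source := by simpa using hx
  have h := TangentBundle.continuousLinearMapAt_trivializationAt (I := 𝓘(ℝ, E)) hx'
  have h' (v : TangentSpace 𝓘(ℝ, E) x) :
      (trivializationAt E (TangentSpace 𝓘(ℝ, E)) x₀ ⟨x, v⟩).2 =
      (trivializationAt E (TangentSpace 𝓘(ℝ, E)) x₀).continuousLinearMapAt ℝ x v := by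
    rw [Trivialization.continuousLinearMapAt_apply, Trivialization.coe_linearMapAt_of_mem]
    simpa using hx'
  exact (h' (V x)).trans (DFunLike.congr_fun h (V x))

theorem contMDiffAt_cotangent_iff_chart (α : G → E →L[ℝ] ℝ) (x₀ : G) :
    ContMDiffAt 𝓘(ℝ, E) (𝓘(ℝ, E).prod 𝓘(ℝ, E →L[ℝ] ℝ)) ∞
    (fun x => TotalSpace.mk' (E →L[ℝ] ℝ)
      (E := fun y : G => TangentSpace 𝓘(ℝ, E) y →L[ℝ] Trivial G ℝ y) x (α x)) x₀ ↔
      ContMDiffAt 𝓘(ℝ, E) 𝓘(ℝ, E →L[ℝ] ℝ) ∞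
        (fun x => (α x).comp (dE E (extChartAt 𝓘(ℝ, E) x₀).symm (extChartAt 𝓘(ℝ, E) x₀ x))) x₀ := by
  refine (contMDiffAt_hom_bundle _).trans ?_
  refine (and_iff_right contMDiffAt_id).trans ?_
  refine Filter.EventuallyEq.contMDiffAt_iff ?_
  filter_upwards [eventually_mem_chart_source (E := E) x₀] with x hx
  have hx' : x ∈ (chartAt E x₀).source := by simpa using hx
  have h := TangentBundle.symmL_trivializationAt (I := 𝓘(ℝ, E)) hx'
  have h2 : mfderivWithin 𝓘(ℝ, E) 𝓘(ℝ, E) (extChartAt 𝓘(ℝ, E) x₀).symm (Set.range 𝓘(ℝ, E))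
      (extChartAt 𝓘(ℝ, E) x₀ x) = dE E (extChartAt 𝓘(ℝ, E) x₀).symm (extChartAt 𝓘(ℝ, E) x₀ x) := by
    rw [dE, modelWithCornersSelf_coe, Set.range_id, mfderivWithin_univ]
  refine ContinuousLinearMap.ext fun w => ?_
  have h3 : (trivializationAt ℝ (Trivial G ℝ) x₀).continuousLinearMapAt ℝ x =
      ContinuousLinearMap.id ℝ ℝ := Trivial.continuousLinearMapAt_trivialization ℝ G ℝ x
  refine (DFunLike.congr_fun h3 (α x ((trivializationAt E (TangentSpace 𝓘(ℝ, E)) x₀).symmL ℝ x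
    w))).trans ?_
  exact congrArg (α x) (DFunLike.congr_fun (h.trans h2) w)

theorem contMDiffAt_chartTheta_comp (x₀ : G) :
    ContMDiffAt 𝓘(ℝ, E) 𝓘(ℝ, E →L[ℝ] E) ∞
      (fun x : G => chartTheta x₀ (extChartAt 𝓘(ℝ, E) x₀ x)) x₀ :=
  ContMDiffAt.comp x₀ (contDiffAt_chartTheta x₀ (mem_extChartAt_target x₀)).contMDiffAt
    contMDiffAt_extChartAt

theorem contMDiffAt_chartThetaInv_comp (x₀ : G) :
    ContMDiffAt 𝓘(ℝ, E) 𝓘(ℝ, E →L[ℝ] E) ∞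
      (fun x : G => chartThetaInv x₀ (extChartAt 𝓘(ℝ, E) x₀ x)) x₀ :=
  ContMDiffAt.comp x₀ (contDiffAt_chartThetaInv x₀ (mem_extChartAt_target x₀)).contMDiffAt
    contMDiffAt_extChartAt

/-- A vector field is smooth if and only if its components in the left trivialization are. -/
theorem contMDiff_tangent_iff (V : G → E) :
    ContMDiff 𝓘(ℝ, E) 𝓘(ℝ, E).tangent ∞ (fun x => (⟨x, V x⟩ : TangentBundle 𝓘(ℝ, E) G)) ↔
      ContMDiff 𝓘(ℝ, E) 𝓘(ℝ, E) ∞ (fun x => thE E x (V x)) := by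
  refine forall_congr' fun x₀ => ?_
  rw [contMDiffAt_tangent_iff_chart]
  constructor
  · intro h
    refine ((contMDiffAt_chartTheta_comp x₀).clm_apply h).congr_of_eventuallyEq ?_
    filter_upwards [eventually_mem_chart_source (E := E) x₀] with x hx
    have h1 := dE_symm_comp_chart ((extChartAt 𝓘(ℝ, E) x₀).map_source hx)
    rw [(extChartAt 𝓘(ℝ, E) x₀).left_inv hx] at h1
    rw [chartTheta, (extChartAt 𝓘(ℝ, E) x₀).left_inv hx, ContinuousLinearMap.comp_apply,
      ← ContinuousLinearMap.comp_apply (dE E _ _), h1]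
    rfl
  · intro h
    refine ((contMDiffAt_chartThetaInv_comp x₀).clm_apply h).congr_of_eventuallyEq ?_
    filter_upwards [eventually_mem_chart_source (E := E) x₀] with x hx
    rw [chartThetaInv, (extChartAt 𝓘(ℝ, E) x₀).left_inv hx, ContinuousLinearMap.comp_apply, lfE_thE]

/-- A one-form is smooth if and only if its components in the left trivialization are. -/
theorem contMDiff_cotangent_iff (α : G → E →L[ℝ] ℝ) :
    ContMDiff 𝓘(ℝ, E) (𝓘(ℝ, E).prod 𝓘(ℝ, E →L[ℝ] ℝ)) ∞
    (fun x => TotalSpace.mk' (E →L[ℝ] ℝ)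
      (E := fun y : G => TangentSpace 𝓘(ℝ, E) y →L[ℝ] Trivial G ℝ y) x (α x)) ↔
      ContMDiff 𝓘(ℝ, E) 𝓘(ℝ, E →L[ℝ] ℝ) ∞ (fun x => (α x).comp (lfE E x)) := by
  refine forall_congr' fun x₀ => ?_
  rw [contMDiffAt_cotangent_iff_chart]
  constructor
  · intro h
    refine (h.clm_comp (contMDiffAt_chartThetaInv_comp x₀)).congr_of_eventuallyEq ?_
    filter_upwards [eventually_mem_chart_source (E := E) x₀] with x hx
    have h1 := dE_symm_comp_chart ((extChartAt 𝓘(ℝ, E) x₀).map_source hx)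
    rw [(extChartAt 𝓘(ℝ, E) x₀).left_inv hx] at h1
    rw [chartThetaInv, (extChartAt 𝓘(ℝ, E) x₀).left_inv hx, ContinuousLinearMap.comp_assoc,
      ← ContinuousLinearMap.comp_assoc (dE E _ _), h1, ContinuousLinearMap.id_comp]
  · intro h
    refine (h.clm_comp (contMDiffAt_chartTheta_comp x₀)).congr_of_eventuallyEq ?_
    filter_upwards [eventually_mem_chart_source (E := E) x₀] with x hx
    rw [chartTheta, (extChartAt 𝓘(ℝ, E) x₀).left_inv hx, ContinuousLinearMap.comp_assoc,
      ← ContinuousLinearMap.comp_assoc (lfE E x), lfE_comp_thE, ContinuousLinearMap.id_comp]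

theorem isSmoothGenSection_iff (e : G → E × (E →L[ℝ] ℝ)) :
    IsSmoothGenSection (E := E) (M := G) e ↔
      ContMDiff 𝓘(ℝ, E) 𝓘(ℝ, E) ∞ (fun x => thE E x (e x).1) ∧
      ContMDiff 𝓘(ℝ, E) 𝓘(ℝ, E →L[ℝ] ℝ) ∞ (fun x => (e x).2.comp (lfE E x)) :=
  and_congr (contMDiff_tangent_iff fun x => (e x).1) (contMDiff_cotangent_iff fun x => (e x).2)

end SmoothSections

/-! ### The map s as a smooth fibrewise isometry -/

section SMapEquiv

variable {E : Type*} [NormedAddCommGroup E] [NormedSpace ℝ E] [FiniteDimensional ℝ E]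
  [CompleteSpace E]
  {G : Type*} [TopologicalSpace G] [ChartedSpace E G] [Group G] [LieGroup 𝓘(ℝ, E) ∞ G]
  {B : LinearMap.BilinForm ℝ (LieAlg E G)}

theorem bE_flip_injective (hB : IsBiinvariantMetric B) : Function.Injective (bE B).flip := by
  refine (injective_iff_map_eq_zero (bE B).flip).mpr fun x hx => ?_
  by_contra h
  have h1 : 0 < bE B x x := hB.pos x h
  have h2 : bE B x x = 0 := DFunLike.congr_fun hx x
  linarith

/-- The isomorphism `E ≃ E^*` given by a bi-invariant metric. -/
def flatE (hB : IsBiinvariantMetric B) : E ≃L[ℝ] (E →L[ℝ] ℝ) :=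
  (LinearEquiv.ofInjectiveOfFinrankEq (bE B).flip.toLinearMap (bE_flip_injective hB) (by
    rw [← (LinearMap.toContinuousLinearMap (𝕜 := ℝ) (E := E) (F' := ℝ)).finrank_eq]
    exact Subspace.dual_finrank_eq.symm)).toContinuousLinearEquiv

theorem flatE_apply (hB : IsBiinvariantMetric B) (x y : E) : flatE hB x y = bE B y x := rfl

theorem bE_flatE_symm (hB : IsBiinvariantMetric B) (α : E →L[ℝ] ℝ) (y : E) :
    bE B y ((flatE hB).symm α) = α y := by
  rw [← flatE_apply hB, ContinuousLinearEquiv.apply_symm_apply]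

/-- The inverse of `sE`. -/
def sInvE (hB : IsBiinvariantMetric B) (g : G) (e : E × (E →L[ℝ] ℝ)) : E × E :=
  ((1 / 2 : ℝ) • ((flatE hB).symm (e.2.comp (lfE E g)) + thE E g e.1),
    adE E g ((1 / 2 : ℝ) • ((flatE hB).symm (e.2.comp (lfE E g)) - thE E g e.1)))

theorem sE_sInvE (hB : IsBiinvariantMetric B) (g : G) (e : E × (E →L[ℝ] ℝ)) :
    sE B g (sInvE hB g e) = e := by
  refine Prod.ext ?_ (ContinuousLinearMap.ext fun v => ?_)
  · rw [sE_fst, sInvE]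
    dsimp only
    rw [adE_inv_adE, ← smul_sub, add_sub_sub_cancel, ← two_smul ℝ, smul_smul]
    norm_num
  · rw [sE_snd_apply hB, sInvE]
    dsimp only
    rw [adE_inv_adE, ← smul_add, add_add_sub_cancel, ← two_smul ℝ, smul_smul]
    norm_num
    rw [bE_flatE_symm, ContinuousLinearMap.comp_apply, lfE_thE]

theorem sInvE_sE (hB : IsBiinvariantMetric B) (g : G) (a : E × E) :
    sInvE hB g (sE B g a) = a := by
  have h1 : thE E g (sE B g a).1 = a.1 - adE E g⁻¹ a.2 := by rw [sE_fst, thE_lfE]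
  have h2 : (flatE hB).symm ((sE B g a).2.comp (lfE E g)) = a.1 + adE E g⁻¹ a.2 := by
    rw [ContinuousLinearEquiv.symm_apply_eq]
    refine ContinuousLinearMap.ext fun v => ?_
    rw [ContinuousLinearMap.comp_apply, sE_snd_apply hB, thE_lfE, flatE_apply]
  rw [sInvE, h1, h2]
  refine Prod.ext ?_ ?_
  · dsimp only
    rw [add_add_sub_cancel, ← two_smul ℝ, smul_smul]
    norm_num
  · dsimp only
    rw [add_sub_sub_cancel, ← two_smul ℝ, smul_smul]
    norm_num

/-- The pairing of `TG ⊕ T^*G`, on the model space. -/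
def pairE (g : G) : E × (E →L[ℝ] ℝ) →ₗ[ℝ] E × (E →L[ℝ] ℝ) →ₗ[ℝ] ℝ := genPairing (E := E) g

theorem pairE_apply (g : G) (e f : E × (E →L[ℝ] ℝ)) :
    pairE g e f = (1 / 2 : ℝ) * (e.2 f.1 + f.2 e.1) := rfl

/-- With c = Ad_{g⁻¹}a₂ and d = Ad_{g⁻¹}b₂, half of B(b₁ - d, a₁ + c) + B(a₁ - c, b₁ + d) is B(a₁,
b₁) - B(c, d), and Ad preserves B. -/
theorem pairE_sE (hB : IsBiinvariantMetric B) (g : G) (a b : E × E) :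
    pairE g (sE B g a) (sE B g b) = dbE B a b := by
  rw [pairE_apply, sE_snd_apply hB, sE_snd_apply hB, sE_fst, sE_fst, thE_lfE, thE_lfE, dbE_apply,
    ← bE_adE hB g⁻¹ a.2 b.2]
  simp only [map_add, map_sub, sub_apply]
  rw [bE_symm hB b.1 a.1, bE_symm hB b.1, bE_symm hB (adE E g⁻¹ b.2) a.1,
    bE_symm hB (adE E g⁻¹ b.2) (adE E g⁻¹ a.2)]
  ring

theorem contMDiff_sInvE (hB : IsBiinvariantMetric B) {e : G → E × (E →L[ℝ] ℝ)}
    (he : IsSmoothGenSection (E := E) (M := G) e) :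
    ContMDiff 𝓘(ℝ, E) 𝓘(ℝ, E × E) ∞ (fun g => sInvE hB g (e g)) := by
  obtain ⟨h1, h2⟩ := (isSmoothGenSection_iff e).mp he
  have h3 := contMDiff_clm_comp ((flatE hB).symm : (E →L[ℝ] ℝ) →L[ℝ] E) h2
  refine ContMDiff.prodMk_space ?_ ?_
  · exact contMDiff_clm_comp ((1 / 2 : ℝ) • ContinuousLinearMap.id ℝ E) (h3.add h1)
  · exact contMDiff_adE.clm_apply
      (contMDiff_clm_comp ((1 / 2 : ℝ) • ContinuousLinearMap.id ℝ E) (h3.sub h1))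

theorem isSmoothGenSection_sE (hB : IsBiinvariantMetric B) {a : G → E × E}
    (ha : ContMDiff 𝓘(ℝ, E) 𝓘(ℝ, E × E) ∞ a) :
    IsSmoothGenSection (E := E) (M := G) (fun g => sE B g (a g)) := by
  have hc := contMDiff_adE_inv_clm_apply (contMDiff_snd_comp ha)
  refine (isSmoothGenSection_iff (fun g => sE B g (a g))).mpr ⟨?_, ?_⟩
  · simp only [sE_fst, thE_lfE]
    exact (contMDiff_fst_comp ha).sub hc
  · have h : (fun g => (sE B g (a g)).2.comp (lfE E g)) =
        fun g => (bE B).flip ((a g).1 + adE E g⁻¹ (a g).2) := by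
      funext g
      refine ContinuousLinearMap.ext fun v => ?_
      rw [ContinuousLinearMap.comp_apply, sE_snd_apply hB, thE_lfE]
      rfl
    rw [h]
    exact contMDiff_clm_comp (bE B).flip ((contMDiff_fst_comp ha).add hc)

end SMapEquiv

/-! ### Generalized complex and Kähler structures induced from 𝔡 -/

section InducedField

variable {E : Type*} [NormedAddCommGroup E] [NormedSpace ℝ E] [FiniteDimensional ℝ E]
  [CompleteSpace E]
  {G : Type*} [TopologicalSpace G] [ChartedSpace E G] [Group G] [LieGroup 𝓘(ℝ, E) ∞ G]
  {B : LinearMap.BilinForm ℝ (LieAlg E G)}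

/-- An endomorphism of `𝔡`, on the model space. -/
def endE (J : Module.End ℝ (LieAlg E G × LieAlg E G)) : E × E →L[ℝ] E × E :=
  LinearMap.toContinuousLinearMap (E := E × E) (F' := E × E) J

theorem endE_sq {J : Module.End ℝ (LieAlg E G × LieAlg E G)}
    (hJ : IsIntegrableIsometry (doubleForm B) J) (x : E × E) : endE J (endE J x) = -x := hJ.sq x

theorem dbE_endE {J : Module.End ℝ (LieAlg E G × LieAlg E G)}
    (hJ : IsIntegrableIsometry (doubleForm B) J) (x y : E × E) :
    dbE B (endE J x) (endE J y) = dbE B x y := hJ.isometry x y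

theorem dbE_endE_left {J : Module.End ℝ (LieAlg E G × LieAlg E G)}
    (hJ : IsIntegrableIsometry (doubleForm B) J) (x y : E × E) :
    dbE B (endE J x) y = -dbE B x (endE J y) := hJ.skew x y

theorem endE_integrable {J : Module.End ℝ (LieAlg E G × LieAlg E G)}
    (hJ : IsIntegrableIsometry (doubleForm B) J) (x y : E × E) :
    ((lieE E G x.1 (endE J y).1, lieE E G x.2 (endE J y).2) : E × E)
      + (lieE E G (endE J x).1 y.1, lieE E G (endE J x).2 y.2) =
    endE J ((lieE E G x.1 y.1, lieE E G x.2 y.2)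
      - (lieE E G (endE J x).1 (endE J y).1, lieE E G (endE J x).2 (endE J y).2)) :=
  hJ.integrable x y

/-- The constant endomorphism J commutes with the derivative terms, so integrability passes from 𝔡
to 𝔡-valued functions. -/
theorem algebroidBracket_endE {J : Module.End ℝ (LieAlg E G × LieAlg E G)}
    (hJ : IsIntegrableIsometry (doubleForm B) J) (g : G) (a b : E × E)
    (Da Db : E →L[ℝ] E × E) :
    algebroidBracket B g a (endE J b) Da ((endE J).comp Db)
      + algebroidBracket B g (endE J a) b ((endE J).comp Da) Db =
    endE J (algebroidBracket B g a b Da Db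
      - algebroidBracket B g (endE J a) (endE J b) ((endE J).comp Da) ((endE J).comp Db)) := by
  have h := endE_integrable hJ a b
  rw [map_sub] at h
  simp only [algebroidBracket, map_sub, map_add, ContinuousLinearMap.comp_apply, endE_sq hJ]
  rw [← sub_eq_zero] at h ⊢
  rw [← h]
  abel

/-- Real part of the defect for a + iJa and b + iJb. Together with the imaginary part it expresses
that L is isotropic, also against derivatives of its sections. -/
theorem bracketDefect_endE_re {J : Module.End ℝ (LieAlg E G × LieAlg E G)}
    (hJ : IsIntegrableIsometry (doubleForm B) J) (a b : E × E) (Da Db : E →L[ℝ] E × E) :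
    bracketDefect B a b Da Db
      - bracketDefect B (endE J a) (endE J b) ((endE J).comp Da) ((endE J).comp Db) = 0 := by
  refine ContinuousLinearMap.ext fun v => ?_
  rw [sub_apply, bracketDefect_apply, bracketDefect_apply, ContinuousLinearMap.comp_apply,
    ContinuousLinearMap.comp_apply, dbE_endE hJ, dbE_endE hJ, sub_self, zero_apply]

theorem bracketDefect_endE_im {J : Module.End ℝ (LieAlg E G × LieAlg E G)}
    (hJ : IsIntegrableIsometry (doubleForm B) J) (a b : E × E) (Da Db : E →L[ℝ] E × E) :
    bracketDefect B a (endE J b) Da ((endE J).comp Db)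
      + bracketDefect B (endE J a) b ((endE J).comp Da) Db = 0 := by
  refine ContinuousLinearMap.ext fun v => ?_
  rw [add_apply, bracketDefect_apply, bracketDefect_apply, ContinuousLinearMap.comp_apply,
    ContinuousLinearMap.comp_apply, dbE_endE_left hJ, dbE_endE_left hJ, zero_apply]
  ring

theorem sE_add_defect {g : G} {a b : E × E} {α β : E →L[ℝ] ℝ} (h : α + β = 0) :
    (sE B g a + (0, α)) + (sE B g b + (0, β)) = sE B g (a + b) := by
  have h' : ((0 : E), α) + (0, β) = 0 := Prod.ext (add_zero _) h
  rw [add_add_add_comm, h', ← map_add, add_zero]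

theorem sE_sub_defect {g : G} {a b : E × E} {α β : E →L[ℝ] ℝ} (h : α - β = 0) :
    (sE B g a + (0, α)) - (sE B g b + (0, β)) = sE B g (a - b) := by
  have h' : ((0 : E), α) - (0, β) = 0 := Prod.ext (sub_zero _) h
  rw [add_sub_add_comm, h', ← map_sub, add_zero]

/-- `sMap`, as a linear equivalence. -/
def sMapEquiv (hB : IsBiinvariantMetric B) (g : G) :
    (LieAlg E G × LieAlg E G) ≃ₗ[ℝ] GenTangent E g :=
  { sMap B g with
    invFun := sInvE (E := E) hB g
    left_inv := sInvE_sE (E := E) hB g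
    right_inv := sE_sInvE (E := E) hB g }

theorem sMapEquiv_apply (hB : IsBiinvariantMetric B) (g : G) (a : LieAlg E G × LieAlg E G) :
    sMapEquiv hB g a = sMap B g a := rfl

theorem genPairing_sMapEquiv (hB : IsBiinvariantMetric B) (g : G)
    (a b : LieAlg E G × LieAlg E G) :
    genPairing g (sMapEquiv hB g a) (sMapEquiv hB g b) = doubleForm B a b := pairE_sE hB g a b

/-- The field of endomorphisms of `TG ⊕ T^*G` corresponding to an endomorphism of `𝔡`. -/
def inducedField (hB : IsBiinvariantMetric B) (J : Module.End ℝ (LieAlg E G × LieAlg E G)) :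
    GenEndField E G := fun g => (sMapEquiv hB g).conj J

theorem inducedField_sMapEquiv (hB : IsBiinvariantMetric B)
    (J : Module.End ℝ (LieAlg E G × LieAlg E G)) (g : G) (a : LieAlg E G × LieAlg E G) :
    inducedField hB J g (sMapEquiv hB g a) = sMapEquiv hB g (J a) := by
  simp [inducedField, LinearEquiv.conj_apply]

theorem inducedField_sq (hB : IsBiinvariantMetric B)
    {J : Module.End ℝ (LieAlg E G × LieAlg E G)} (hJ : IsIntegrableIsometry (doubleForm B) J)
    (g : G) (e : GenTangent E g) : inducedField hB J g (inducedField hB J g e) = -e := by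
  obtain ⟨a, rfl⟩ := (sMapEquiv hB g).surjective e
  rw [inducedField_sMapEquiv, inducedField_sMapEquiv, hJ.sq, map_neg]

theorem smooth_inducedField (hB : IsBiinvariantMetric B)
    (J : Module.End ℝ (LieAlg E G × LieAlg E G)) (e : GenSection E G)
    (he : IsSmoothGenSection e) : IsSmoothGenSection fun x => inducedField hB J x (e x) :=
  isSmoothGenSection_sE hB (contMDiff_clm_comp (endE J) (contMDiff_sInvE hB he))

theorem isAlmostGeneralizedComplex_inducedField (hB : IsBiinvariantMetric B)
    {J : Module.End ℝ (LieAlg E G × LieAlg E G)} (hJ : IsIntegrableIsometry (doubleForm B) J)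
    (hdet : LinearMap.det J = 1) : IsAlmostGeneralizedComplex (inducedField hB J) where
  smooth := smooth_inducedField hB J
  orthogonal g e f := by
    obtain ⟨a, rfl⟩ := (sMapEquiv hB g).surjective e
    obtain ⟨b, rfl⟩ := (sMapEquiv hB g).surjective f
    rw [inducedField_sMapEquiv, inducedField_sMapEquiv, genPairing_sMapEquiv,
      genPairing_sMapEquiv, hJ.isometry]
  det_eq_one g := by
    rw [inducedField, LinearEquiv.conj_apply]
    exact (LinearMap.det_conj J (sMapEquiv hB g)).trans hdet
  sq_eq_neg_one := inducedField_sq hB hJ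

theorem mem_negIEigenspace_inducedField (hB : IsBiinvariantMetric B)
    {J : Module.End ℝ (LieAlg E G × LieAlg E G)} (hJ : IsIntegrableIsometry (doubleForm B) J)
    (g : G) (e f : GenTangent E g) :
    mkC e f ∈ negIEigenspace (inducedField hB J) g ↔ f = inducedField hB J g e :=
  mem_eigenspace_neg_I_iff _ (inducedField_sq hB hJ g) e f

/-- The complexified isomorphism s carries the graph of J to that of sJs⁻¹. Uniqueness holds because
the eigenspace contains x + iJx for each real x, which fixes the value at x. -/
theorem isInducedBy_iff (hB : IsBiinvariantMetric B)
    {J : Module.End ℝ (LieAlg E G × LieAlg E G)} (hJ : IsIntegrableIsometry (doubleForm B) J)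
    {L : Submodule ℂ (ℂ ⊗[ℝ] (LieAlg E G × LieAlg E G))}
    (hL : ∀ a b, mkC a b ∈ L ↔ b = J a) (K : GenEndField E G) :
    IsInducedBy B L K ↔ K = inducedField hB J := by
  have h (g : G) : negIEigenspace (inducedField hB J) g = L.map ((sMap B g).baseChange ℂ) := by
    ext z
    obtain ⟨e, f, rfl⟩ := exists_mkC_eq z
    obtain ⟨a, rfl⟩ := (sMapEquiv hB g).surjective e
    obtain ⟨b, rfl⟩ := (sMapEquiv hB g).surjective f
    rw [mem_negIEigenspace_inducedField hB hJ, inducedField_sMapEquiv,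
      (sMapEquiv hB g).injective.eq_iff, ← hL, Submodule.mem_map]
    constructor
    · intro hab
      exact ⟨mkC a b, hab, by rw [baseChange_mkC]; rfl⟩
    · rintro ⟨w, hw, hwz⟩
      obtain ⟨c, d, rfl⟩ := exists_mkC_eq w
      rw [baseChange_mkC, mkC_inj, ← sMapEquiv_apply hB, ← sMapEquiv_apply hB,
        (sMapEquiv hB g).injective.eq_iff, (sMapEquiv hB g).injective.eq_iff] at hwz
      rwa [← hwz.1, ← hwz.2]
  constructor
  · intro hK
    funext g
    exact end_eq_of_eigenspace_neg_I_eq (inducedField_sq hB hJ g) ((hK g).trans (h g).symm)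
  · rintro rfl
    exact h

theorem courantC_mem_negIEigenspace (hB : IsBiinvariantMetric B)
    {J : Module.End ℝ (LieAlg E G × LieAlg E G)} (hJ : IsIntegrableIsometry (doubleForm B) J)
    (e f : GenSectionC E G) (he : IsSmoothGenSectionC e) (hf : IsSmoothGenSectionC f)
    (heJ : ∀ x, e x ∈ negIEigenspace (inducedField hB J) x)
    (hfJ : ∀ x, f x ∈ negIEigenspace (inducedField hB J) x) (x : G) :
    courantC (cartanThreeForm B) e f x ∈ negIEigenspace (inducedField hB J) x := by
  -- Smooth sections of the eigenbundle are exactly of the form s(a) + i s(Ja) with a smooth,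
  -- obtained by applying s⁻¹ to the real part.
  have key (e : GenSectionC E G) (he : IsSmoothGenSectionC e)
      (heJ : ∀ x, e x ∈ negIEigenspace (inducedField hB J) x) :
      ∃ a : G → E × E, ContMDiff 𝓘(ℝ, E) 𝓘(ℝ, E × E) ∞ a ∧
        (fun y => reC (e y)) = (fun y => sE B y (a y)) ∧
        (fun y => imC (e y)) = (fun y => sE B y (endE J (a y))) := by
    refine ⟨fun y => sInvE hB y (reC (e y)), contMDiff_sInvE hB he.1, ?_, ?_⟩
    · funext y
      exact (sE_sInvE hB y (reC (e y))).symm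
    · funext y
      have h := heJ y
      rw [← mkC_reC_imC (e y), mem_negIEigenspace_inducedField hB hJ] at h
      exact h
  obtain ⟨a, ha, hae, hae'⟩ := key e he heJ
  obtain ⟨b, hb, hbf, hbf'⟩ := key f hf hfJ
  have ha' := contMDiff_clm_comp (endE J) ha
  have hb' := contMDiff_clm_comp (endE J) hb
  rw [courantC, hae, hae', hbf, hbf', courant_sE hB x ha hb, courant_sE hB x ha' hb',
    courant_sE hB x ha hb', courant_sE hB x ha' hb, mem_negIEigenspace_inducedField hB hJ,
    chartDeriv_clm_comp x (endE J) ha, chartDeriv_clm_comp x (endE J) hb]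
  refine (sE_add_defect (E := E) (bracketDefect_endE_im hJ _ _ _ _)).trans ?_
  refine Eq.trans ?_ (congrArg (inducedField hB J x)
    (sE_sub_defect (E := E) (bracketDefect_endE_re hJ _ _ _ _))).symm
  rw [algebroidBracket_endE hJ]
  exact (inducedField_sMapEquiv hB J x _).symm

theorem isTwistedGeneralizedComplex_inducedField (hB : IsBiinvariantMetric B)
    {J : Module.End ℝ (LieAlg E G × LieAlg E G)} (hJ : IsIntegrableIsometry (doubleForm B) J)
    (hdet : LinearMap.det J = 1) (hH : (cartanThreeForm B).IsSmoothClosed) :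
    IsTwistedGeneralizedComplex (cartanThreeForm B) (inducedField hB J) where
  toIsAlmostGeneralizedComplex := isAlmostGeneralizedComplex_inducedField hB hJ hdet
  smooth_closed := hH
  involutive := courantC_mem_negIEigenspace hB hJ

theorem det_mul_det_eq_one {V : Type*} [AddCommGroup V] [Module ℝ V] {I : Module.End ℝ V}
    (hI : ∀ x, I (I x) = -x) (hd : Even (Module.finrank ℝ V)) :
    LinearMap.det I * LinearMap.det I = 1 := by
  have h : I * I = (-1 : ℝ) • (1 : Module.End ℝ V) := by
    ext x; simp [hI]
  rw [← map_mul, h, LinearMap.det_smul, hd.neg_one_pow]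
  simp

theorem isTwistedGeneralizedKahler_inducedField (hB : IsBiinvariantMetric B)
    {I : Module.End ℝ (LieAlg E G)} (hI : IsIntegrableIsometry B I)
    (hd : Even (Module.finrank ℝ E)) (hH : (cartanThreeForm B).IsSmoothClosed) :
    IsTwistedGeneralizedKahler (cartanThreeForm B)
      (inducedField hB (LinearMap.prodMap (-I) (-I))) (inducedField hB (LinearMap.prodMap (-I) I)) := by
  have hsq : LinearMap.det I * LinearMap.det I = 1 := det_mul_det_eq_one hI.sq hd
  have hneg : LinearMap.det (-I) = LinearMap.det I := by
    rw [← neg_one_smul ℝ I, LinearMap.det_smul,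
      show Module.finrank ℝ (LieAlg E G) = Module.finrank ℝ E from rfl, hd.neg_one_pow, one_mul]
  -- On 𝔡 the product of (-I, -I) and (-I, I) is (-1, 1).
  have hmul (g : G) (a : LieAlg E G × LieAlg E G) :
      -inducedField hB (LinearMap.prodMap (-I) (-I)) g
        (inducedField hB (LinearMap.prodMap (-I) I) g (sMapEquiv hB g a)) =
      sMapEquiv hB g (a.1, -a.2) := by
    rw [inducedField_sMapEquiv, inducedField_sMapEquiv, ← map_neg]
    congr 1
    refine Prod.ext ?_ ?_
    · simp [hI.sq]
    · simp [hI.sq]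
  refine ⟨isTwistedGeneralizedComplex_inducedField hB (hI.neg.prodMap hI.neg) ?_ hH,
    isTwistedGeneralizedComplex_inducedField hB (hI.neg.prodMap hI) ?_ hH, ?_, ?_, ?_⟩
  · rw [LinearMap.det_prodMap, hneg, hsq]
  · rw [LinearMap.det_prodMap, hneg, hsq]
  · intro g e
    obtain ⟨a, rfl⟩ := (sMapEquiv hB g).surjective e
    rw [inducedField_sMapEquiv, inducedField_sMapEquiv, inducedField_sMapEquiv,
      inducedField_sMapEquiv]
    congr 1
    refine Prod.ext ?_ ?_ <;> simp
  · intro g e f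
    obtain ⟨a, rfl⟩ := (sMapEquiv hB g).surjective e
    obtain ⟨b, rfl⟩ := (sMapEquiv hB g).surjective f
    rw [hmul, hmul, genPairing_sMapEquiv, genPairing_sMapEquiv]
    simp [doubleForm, hB.symm a.1, hB.symm a.2]
  · intro g e he
    obtain ⟨a, rfl⟩ := (sMapEquiv hB g).surjective e
    rw [hmul, genPairing_sMapEquiv]
    have hn (x : LieAlg E G) : 0 ≤ B x x := by
      by_cases hx : x = 0
      · simp [hx]
      · exact (hB.pos x hx).le
    have h1 : doubleForm B (a.1, -a.2) a = B a.1 a.1 + B a.2 a.2 := by simp [doubleForm]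
    rw [h1]
    by_cases h2 : a.1 = 0
    · have h3 : a.2 ≠ 0 := fun h3 => he (by rw [show a = 0 from Prod.ext h2 h3, map_zero])
      linarith [hn a.1, hB.pos _ h3]
    · linarith [hn a.2, hB.pos _ h2]

end InducedField

/-! ### Smooth families of alternating forms -/

section AlternatingSmooth

variable {E : Type*} [NormedAddCommGroup E] [NormedSpace ℝ E] [FiniteDimensional ℝ E]

theorem finiteDimensional_continuousMultilinearMap (n : ℕ) :
    FiniteDimensional ℝ (ContinuousMultilinearMap ℝ (fun _ : Fin n => E) ℝ) :=
  FiniteDimensional.of_injective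
    ({ toFun := ContinuousMultilinearMap.toMultilinearMap
       map_add' := fun _ _ => rfl
       map_smul' := fun _ _ => rfl } : ContinuousMultilinearMap ℝ (fun _ : Fin n => E) ℝ →ₗ[ℝ]
      MultilinearMap ℝ (fun _ : Fin n => E) ℝ)
    ContinuousMultilinearMap.toMultilinearMap_injective

/-- A form with values in continuous alternating maps is smooth if the underlying multilinear maps
are. -/
theorem contDiffAt_of_toContinuousMultilinearMap {F : Type*} [NormedAddCommGroup F]
    [NormedSpace ℝ F] {n : ℕ} {η : F → E [⋀^Fin n]→L[ℝ] ℝ} {y : F}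
    (h : ContDiffAt ℝ ∞ (fun y => (η y).toContinuousMultilinearMap) y) : ContDiffAt ℝ ∞ η y := by
  have := finiteDimensional_continuousMultilinearMap (E := E) n
  -- In finite dimension the inclusion of alternating into multilinear maps has a linear left
  -- inverse, which is automatically continuous.
  obtain ⟨L, hL⟩ := LinearMap.exists_leftInverse_of_injective
    (ContinuousAlternatingMap.toContinuousMultilinearMapLinear (R := ℝ) (A := ℝ) (M := E) (N := ℝ)
      (ι := Fin n))
    (LinearMap.ker_eq_bot.mpr ContinuousAlternatingMap.toContinuousMultilinearMap_injective)
  have h1 := (LinearMap.toContinuousLinearMap L).contDiff.contDiffAt.comp y h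
  refine h1.congr_of_eventuallyEq (Filter.Eventually.of_forall fun z => ?_)
  exact (DFunLike.congr_fun hL (η z)).symm

/-- The pullback is multilinear in the linear maps placed in the separate slots, evaluated on the
diagonal. -/
theorem contDiffAt_compContinuousLinearMap {F : Type*} [NormedAddCommGroup F]
    [NormedSpace ℝ F] {n : ℕ} (A : E [⋀^Fin n]→L[ℝ] ℝ) {f : F → E →L[ℝ] E} {y : F}
    (hf : ContDiffAt ℝ ∞ f y) : ContDiffAt ℝ ∞ (fun y => A.compContinuousLinearMap (f y)) y := by
  apply contDiffAt_of_toContinuousMultilinearMap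
  have h := (ContinuousMultilinearMap.compContinuousLinearMapLRight
    (E := fun _ : Fin n => E) A.toContinuousMultilinearMap).contDiff (n := ∞)
  exact h.contDiffAt.comp y (contDiffAt_pi.mpr fun _ => hf)

end AlternatingSmooth

/-! ### Smoothness and closedness of the Cartan three-form -/

section CartanForm

variable {E : Type*} [NormedAddCommGroup E] [NormedSpace ℝ E] [FiniteDimensional ℝ E]
  [CompleteSpace E]
  {G : Type*} [TopologicalSpace G] [ChartedSpace E G] [Group G] [LieGroup 𝓘(ℝ, E) ∞ G]
  {B : LinearMap.BilinForm ℝ (LieAlg E G)}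

/-- The Cartan three-form at the identity, on the model space. -/
def cartanE (B : LinearMap.BilinForm ℝ (LieAlg E G)) : E [⋀^Fin 3]→L[ℝ] ℝ := cartanThreeForm B 1

theorem cartanE_apply (hB : IsBiinvariantMetric B) (m : Fin 3 → E) :
    cartanE B m = bE B (lieE E G (m 0) (m 1)) (m 2) := by
  refine (cartanThreeForm_apply hB 1 m).trans ?_
  rw [thE_one]
  rfl

/-- In a chart H is a constant form on 𝔤 pulled back by Θ, so only Θ has to be differentiated. -/
theorem cartanThreeForm_inChart (hB : IsBiinvariantMetric B) (x₀ : G) :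
    (cartanThreeForm B).inChart x₀ = fun y => (cartanE B).compContinuousLinearMap (chartTheta x₀ y) := by
  funext y
  refine ContinuousAlternatingMap.ext fun m => ?_
  refine (cartanThreeForm_apply hB _ _).trans ?_
  refine Eq.trans ?_ (cartanE_apply hB _).symm
  rfl

theorem bE_lieE_assoc (hB : IsBiinvariantMetric B) (x y z : E) :
    bE B (lieE E G x y) z = bE B x (lieE E G y z) := by
  rw [lieE_skew x y, (bE B).map_neg₂, bE_lieE hB, neg_neg]

/-- The Jacobi identity, contracted with an invariant form. -/
theorem bE_lieE_lieE_cyclic (hB : IsBiinvariantMetric B) (x y z w : E) :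
    bE B (lieE E G x y) (lieE E G z w) - bE B (lieE E G x z) (lieE E G y w)
      + bE B (lieE E G x w) (lieE E G y z) = 0 := by
  rw [bE_lieE_assoc hB, bE_lieE_assoc hB, bE_lieE_assoc hB, lieE_jacobi y z w,
    lieE_skew w (lieE E G y z), map_add, map_neg]
  ring

/-- The alternating sum antisymmetrizes the derivative of Θ, which Maurer-Cartan turns into
brackets; the resulting quadrilinear expression vanishes by Jacobi and invariance. -/
theorem extDeriv_cartanThreeForm_inChart (hB : IsBiinvariantMetric B) (x₀ : G) {y : E}
    (hy : y ∈ (extChartAt 𝓘(ℝ, E) x₀).target) :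
    extDeriv ((cartanThreeForm B).inChart x₀) y = 0 := by
  rw [cartanThreeForm_inChart hB]
  refine ContinuousAlternatingMap.ext fun v => ?_
  have hd := contDiffAt_compContinuousLinearMap (cartanE B) (contDiffAt_chartTheta x₀ hy)
  rw [extDeriv_apply (hd.differentiableAt (by simp))]
  have hΘ := hasFDerivAt_chartTheta x₀ hy
  have hder (a b c w : E) :
      fderiv ℝ (fun z => bE B (lieE E G (chartTheta x₀ z a) (chartTheta x₀ z b))
        (chartTheta x₀ z c)) y w =
      bE B (lieE E G (fderiv ℝ (chartTheta x₀) y w a) (chartTheta x₀ y b)) (chartTheta x₀ y c)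
      + bE B (lieE E G (chartTheta x₀ y a) (fderiv ℝ (chartTheta x₀) y w b)) (chartTheta x₀ y c)
      + bE B (lieE E G (chartTheta x₀ y a) (chartTheta x₀ y b))
        (fderiv ℝ (chartTheta x₀) y w c) := by
    have hap (a : E) : HasFDerivAt (fun z => chartTheta x₀ z a)
        ((ContinuousLinearMap.apply ℝ E a).comp (fderiv ℝ (chartTheta x₀) y)) y :=
      (ContinuousLinearMap.apply ℝ E a).hasFDerivAt.comp y hΘ
    have h := (bE B).hasFDerivAt_of_bilinear
      ((lieE E G).hasFDerivAt_of_bilinear (hap a) (hap b)) (hap c)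
    refine (DFunLike.congr_fun h.fderiv w).trans ?_
    change bE B (lieE E G (chartTheta x₀ y a) (chartTheta x₀ y b))
        (fderiv ℝ (chartTheta x₀) y w c)
      + bE B (lieE E G (chartTheta x₀ y a) (fderiv ℝ (chartTheta x₀) y w b)
        + lieE E G (fderiv ℝ (chartTheta x₀) y w a) (chartTheta x₀ y b)) (chartTheta x₀ y c) = _
    rw [(bE B).map_add₂]
    ring
  have hder' (m : Fin 3 → E) (w : E) :
      fderiv ℝ (fun z => (cartanE B).compContinuousLinearMap (chartTheta x₀ z) m) y w =
      bE B (lieE E G (fderiv ℝ (chartTheta x₀) y w (m 0)) (chartTheta x₀ y (m 1)))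
        (chartTheta x₀ y (m 2))
      + bE B (lieE E G (chartTheta x₀ y (m 0)) (fderiv ℝ (chartTheta x₀) y w (m 1)))
        (chartTheta x₀ y (m 2))
      + bE B (lieE E G (chartTheta x₀ y (m 0)) (chartTheta x₀ y (m 1)))
        (fderiv ℝ (chartTheta x₀) y w (m 2)) := by
    rw [← hder]
    refine congrArg (fun f : E → ℝ => fderiv ℝ f y w) (funext fun z => ?_)
    exact cartanE_apply hB _
  refine (Fin.sum_univ_four _).trans ?_
  simp only [hder']
  -- Used for i < j, so that only the six derivatives DΘ(v_i)v_j with i < j remain, together with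
  -- bracket terms.
  have hmc (i j : Fin 4) : fderiv ℝ (chartTheta x₀) y (v j) (v i) =
      fderiv ℝ (chartTheta x₀) y (v i) (v j)
        + lieE E G (chartTheta x₀ y (v i)) (chartTheta x₀ y (v j)) := by
    have h := maurerCartan x₀ hy (v i) (v j)
    rw [← neg_inj, neg_neg, neg_sub] at h
    rw [← h]; abel
  have e00 : (0 : Fin 4).removeNth v 0 = v 1 := rfl
  have e01 : (0 : Fin 4).removeNth v 1 = v 2 := rfl
  have e02 : (0 : Fin 4).removeNth v 2 = v 3 := rfl
  have e10 : (1 : Fin 4).removeNth v 0 = v 0 := rfl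
  have e11 : (1 : Fin 4).removeNth v 1 = v 2 := rfl
  have e12 : (1 : Fin 4).removeNth v 2 = v 3 := rfl
  have e20 : (2 : Fin 4).removeNth v 0 = v 0 := rfl
  have e21 : (2 : Fin 4).removeNth v 1 = v 1 := rfl
  have e22 : (2 : Fin 4).removeNth v 2 = v 3 := rfl
  have e30 : (3 : Fin 4).removeNth v 0 = v 0 := rfl
  have e31 : (3 : Fin 4).removeNth v 1 = v 1 := rfl
  have e32 : (3 : Fin 4).removeNth v 2 = v 2 := rfl
  simp only [e00, e01, e02, e10, e11, e12, e20, e21, e22, e30, e31, e32, hmc 0 1, hmc 0 2, hmc 0 3,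
    hmc 1 2, hmc 1 3, hmc 2 3]
  generalize fderiv ℝ (chartTheta x₀) y (v 0) (v 1) = d01
  generalize fderiv ℝ (chartTheta x₀) y (v 0) (v 2) = d02
  generalize fderiv ℝ (chartTheta x₀) y (v 0) (v 3) = d03
  generalize fderiv ℝ (chartTheta x₀) y (v 1) (v 2) = d12
  generalize fderiv ℝ (chartTheta x₀) y (v 1) (v 3) = d13
  generalize fderiv ℝ (chartTheta x₀) y (v 2) (v 3) = d23
  generalize chartTheta x₀ y (v 0) = x0
  generalize chartTheta x₀ y (v 1) = x1
  generalize chartTheta x₀ y (v 2) = x2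
  generalize chartTheta x₀ y (v 3) = x3
  have hcyc (x y z : E) : bE B (lieE E G x y) z = bE B (lieE E G z x) y := by
    rw [bE_lieE_left_swap hB]
  have hsk (x y z : E) : bE B (lieE E G x y) z = -bE B (lieE E G y x) z := by
    rw [lieE_skew x y, (bE B).map_neg₂]
  have hJ := bE_lieE_lieE_cyclic hB x0 x1 x2 x3
  simp only [(bE B).map_add₂, (lieE E G).map_add₂, (lieE E G _).map_add, (bE B _).map_add]
  -- Cyclicity and skew-symmetry align the terms in the six derivatives so that they cancel; the
  -- bracket terms are handled by `hJ`.
  rw [hsk x1 d02, hcyc x1 x2 d03, hcyc x0 x2 d13, hsk x0 d13, hsk x0 (lieE E G x1 x2),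
    hsk x0 (lieE E G x1 x3), bE_lieE_assoc hB (lieE E G x0 x1), bE_lieE_assoc hB (lieE E G x0 x2),
    bE_lieE_assoc hB (lieE E G x0 x3), bE_lieE_assoc hB (lieE E G x1 x2),
    bE_lieE_assoc hB (lieE E G x1 x3), bE_symm hB (lieE E G x1 x2), bE_symm hB (lieE E G x1 x3)]
  norm_num
  linarith

theorem isSmoothClosed_cartanThreeForm (hB : IsBiinvariantMetric B) :
    (cartanThreeForm B).IsSmoothClosed := fun x₀ =>
  ⟨fun y hy => by
    rw [cartanThreeForm_inChart hB]
    exact (contDiffAt_compContinuousLinearMap (cartanE B)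
      (contDiffAt_chartTheta x₀ hy)).contDiffWithinAt,
    fun _ hy => extDeriv_cartanThreeForm_inChart hB x₀ hy⟩

end CartanForm

/-! ### Assembly -/

theorem mainTheorem3 {n : ℕ} (hn : Even n)
    {G : Type*} [TopologicalSpace G] [ChartedSpace (EuclideanSpace ℝ (Fin n)) G]
    [Group G] [LieGroup (𝓡 n) ∞ G] [CompactSpace G] [T2Space G]
    (B : LinearMap.BilinForm ℝ (LieAlg (EuclideanSpace ℝ (Fin n)) G))
    (hB : IsBiinvariantMetric B)
    (h : LieSubalgebra ℂ (ℂ ⊗[ℝ] LieAlg (EuclideanSpace ℝ (Fin n)) G)) [h.IsCartanSubalgebra]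
    (hconj : ∀ z ∈ h, conjC z ∈ h)
    (P : Set (h → ℂ)) (hP : IsPositiveSystem h P)
    (Ih : Module.End ℝ (realSubspace h))
    (hI : ∀ x, Ih (Ih x) = -x)
    (hIB : ∀ x y : realSubspace h, B (Ih x) (Ih y) = B x y) :
    IsIsotropicSplittingSubalgebra B (Lphi h P Ih) ∧
    IsIsotropicSplittingSubalgebra B (Lpsi h P Ih) ∧
    ∃ Jphi Jpsi : GenEndField (EuclideanSpace ℝ (Fin n)) G,
      (∀ J, IsInducedBy B (Lphi h P Ih) J ↔ J = Jphi) ∧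
      (∀ J, IsInducedBy B (Lpsi h P Ih) J ↔ J = Jpsi) ∧
      IsTwistedGeneralizedKahler (cartanThreeForm B) Jphi Jpsi := by
  obtain ⟨J, hJ, h10, h01⟩ := exists_isIntegrableIsometry hB.symm hB.pos (B_lie hB) hI hconj hP hIB
  -- 𝔤^{1,0} is the i-eigenspace of J, hence the graph of -J; this accounts for the signs in the two
  -- endomorphisms of 𝔡.
  have hphi (a b : LieAlg (EuclideanSpace ℝ (Fin n)) G × LieAlg (EuclideanSpace ℝ (Fin n)) G) :
      mkC a b ∈ Lphi h P Ih ↔ b = LinearMap.prodMap (-J) (-J) a := by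
    rw [Lphi, mkC_mem_directSumC, h10, h10, Prod.ext_iff]
    rfl
  have hpsi (a b : LieAlg (EuclideanSpace ℝ (Fin n)) G × LieAlg (EuclideanSpace ℝ (Fin n)) G) :
      mkC a b ∈ Lpsi h P Ih ↔ b = LinearMap.prodMap (-J) J a := by
    rw [Lpsi, mkC_mem_directSumC, h10, h01, Prod.ext_iff]
    rfl
  have hJphi := hJ.neg.prodMap hJ.neg
  have hJpsi := hJ.neg.prodMap hJ
  refine ⟨hJphi.isIsotropicSplittingSubalgebra hB.pos hphi,
    hJpsi.isIsotropicSplittingSubalgebra hB.pos hpsi,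
    inducedField hB (LinearMap.prodMap (-J) (-J)), inducedField hB (LinearMap.prodMap (-J) J),
    isInducedBy_iff hB hJphi hphi, isInducedBy_iff hB hJpsi hpsi, ?_⟩
  exact isTwistedGeneralizedKahler_inducedField hB hJ (by simpa using hn)
    (isSmoothClosed_cartanThreeForm hB)
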